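/- Let $W$ be a finite Coxeter group with set of simple reflections $S$, set of reflections $T$, and length functions $\ell_S$ and $\ell_T$ with respect to the generating sets $S$ and $T$. Let $c$ be a standard Coxeter element, that is, a product of all the simple reflections, each used once, in some order. Let $\mathrm{NC}(W,c)=\{x\in W:\ell_T(x)+\ell_T(x^{-1}c)=\ell_T(c)\}$, ordered by $x\le_T y\iff \ell_T(x)+\ell_T(x^{-1}y)=\ell_T(y)$. To a maximal chain $\vec\pi=\{\pi_0<_T\pi_1<_T\cdots<_T\pi_r\}$ of $\mathrm{NC}(W,c)$ associate the word $t_1\cdots t_r$ in reflections with $t_i=\pi_{i-1}^{-1}\pi_i$. Two maximal chains are commutation equivalent if their words are related by a sequence of interchanges of adjacent commuting letters; the equivalence classes are called commutation classes. Let $\le_{\mathrm B}$ be the Bruhat order on $W$, and let $W_c^+=\{u\in W:\ell_S(uc)=\ell_S(u)+\ell_S(c)\}$. A maximal chain $\vec\pi$ is concordant with $u\in W_c^+$ if $u\pi_0\le_{\mathrm B}u\pi_1\le_{\mathrm B}\cdots\le_{\mathrm B}u\pi_r$. Let $\mathrm{Class}_c(u)$ be the set of commutation classes of maximal chains concordant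 with $u$. Fix a reduced word $\mathsf c$ in $S$ for $c$. Let $s_1s_2\cdots s_N$ be the lexicographically first subword of the infinite word $\mathsf{ccc}\cdots$ that is a reduced word for the long element of $W$, and let $\mathsf t$ be the word in reflections whose $i$-th letter is $s_1\cdots s_{i-1}s_is_{i-1}\cdots s_1$ $(1\le i\le N)$. Up to interchanges of adjacent commuting letters, $\mathsf t$ does not depend on the choice of $\mathsf c$. Every reflection occurs exactly once in $\mathsf t$. For $t,t'\in T$ write $t\preceq_c t'$ if $t=t'$ or $t$ appears to the left of $t'$ in every word obtained from $\mathsf t$ by interchanges of adjacent commuting letters. A maximal chain with word $t_1\cdots t_r$ is $\preceq_c$-increasing if there are no $i<j$ with $t_j\preceq_c t_i$, and $\preceq_c$-decreasing if there are no $i<j$ with $t_i\preceq_c t_j$. A commutation class is called $\preceq_c$-increasing (respectively, $\preceq_c$-decreasing) if it contains a $\preceq_c$-increasing (respectively, $\preceq_c$-decreasing) chain. Theorem. There is exactly one $\preceq_c$-increasing commutation class $\mathcal I_c$ of maximal chains of $\mathrm{NC}(W,c)$. For every $u\in W_c^+$, the set $\mathrm{Class}_c(u)$ contains $\mathcal I_c$,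 and it contains exactly one $\preceq_c$-decreasing class $\mathcal D_c(u)$. -/

import Mathlib

namespace CoxeterSystem

section Words

variable {G : Type*} [Group G]

/-- A single commutation move: two adjacent letters that commute in the group are interchanged. -/
inductive CommMove : List G → List G → Prop
  | swap (l₁ l₂ : List G) (s t : G) (h : s * t = t * s) :
      CommMove (l₁ ++ s :: t :: l₂) (l₁ ++ t :: s :: l₂)

/-- Two words are commutation equivalent if they are related by a sequence of commutation moves. -/
def CommEquiv : List G → List G → Prop :=
  Relation.EqvGen CommMove

/-- For a list `π₀, π₁, …, πₖ`, the word `t₁ ⋯ tₖ` with `tᵢ = πᵢ₋₁⁻¹ πᵢ`. -/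
def quotientWord (l : List G) : List G :=
  List.zipWith (fun x y => x⁻¹ * y) l l.tail

end Words

variable {B W : Type*} [Group W] {M : CoxeterMatrix B} (cs : CoxeterSystem M W)

/-- A standard Coxeter element: a product of all the simple reflections, each used exactly once,
in some order. -/
def IsStandardCoxeterElement (c : W) : Prop :=
  ∃ ω : List B, ω.Nodup ∧ (∀ i : B, i ∈ ω) ∧ cs.wordProd ω = c

/-- The reflection length `ℓ_T`: the least length of a word in the reflections representing `w`. -/
noncomputable def reflLength (w : W) : ℕ :=
  sInf {n | ∃ l : List W, (∀ t ∈ l, cs.IsReflection t) ∧ l.prod = w ∧ l.length = n}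

/-- The absolute order `x ≤_T y`: some geodesic from `1` to `y` in the right Cayley graph generated
by the reflections passes through `x`. -/
def AbsLE (x y : W) : Prop :=
  cs.reflLength x + cs.reflLength (x⁻¹ * y) = cs.reflLength y

/-- The underlying set of the noncrossing partition lattice `NC(W, c) = [1, c]_T`. -/
def noncrossing (c : W) : Set W :=
  {x | cs.AbsLE 1 x ∧ cs.AbsLE x c}

/-- A maximal chain of `NC(W, c)`, listed in strictly increasing order. -/
structure MaxChain (c : W) where
  /-- The elements `π₀, π₁, …, πᵣ` of the chain. -/
  elems : List W
  mem_noncrossing : ∀ x ∈ elems, x ∈ cs.noncrossing c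
  increasing : elems.Pairwise (fun x y => cs.AbsLE x y ∧ x ≠ y)
  maximal : ∀ x ∈ cs.noncrossing c,
    (∀ y ∈ elems, cs.AbsLE x y ∨ cs.AbsLE y x) → x ∈ elems

/-- The cover relation of the Bruhat order. -/
def BruhatCover (u v : W) : Prop :=
  cs.length v = cs.length u + 1 ∧ ∃ t, cs.IsReflection t ∧ v = u * t

/-- The Bruhat order. -/
def BruhatLE : W → W → Prop :=
  Relation.ReflTransGen cs.BruhatCover

/-- The set `W_c^+` of all `u` with `ℓ_S(uc) = ℓ_S(u) + ℓ_S(c)`. -/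
def plusSet (c : W) : Set W :=
  {u | cs.length (u * c) = cs.length u + cs.length c}

/-- `ω` is a reduced word in the simple reflections for `w`. -/
def IsReducedWordFor (ω : List B) (w : W) : Prop :=
  cs.IsReduced ω ∧ cs.wordProd ω = w

/-- The letters of the infinite word `ω ω ω ⋯` at a list of positions; the position `(k, i)` is
the `i`-th letter of the `k`-th copy of `ω`, and positions are ordered lexicographically. -/
def lettersAt (ω : List B) (P : List (ℕ ×ₗ Fin ω.length)) : List B :=
  P.map (fun p => ω.get (ofLex p).2)

/-- The word `η` is the lexicographically first subword of `ω ω ω ⋯` that is a reduced word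
for `w`; subwords are given by strictly increasing lists of positions. -/
def IsSortingWord (ω : List B) (w : W) (η : List B) : Prop :=
  ∃ P : List (ℕ ×ₗ Fin ω.length),
    IsLeast {Q | Q.Pairwise (· < ·) ∧ cs.IsReducedWordFor (lettersAt ω Q) w} P ∧
      lettersAt ω P = η

/-- The long element: its length is the number of reflections. -/
def IsLongElement (w : W) : Prop :=
  cs.length w = Nat.card {t : W // cs.IsReflection t}

/-- The partial order `t ⪯_c t'` on reflections: `t` is equal to `t'`, or `t` appears to the left
of `t'` in every word commutation equivalent to the inversion sequence of a `c`-sorting word of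
the long element. All reduced words `ω` for `c` are allowed here; the sorting words they
give are commutation equivalent to one another. -/
def SortLE (c t t' : W) : Prop :=
  t = t' ∨ ∀ (ω η : List B) (w₀ : W) (l : List W),
    cs.IsReducedWordFor ω c → cs.IsLongElement w₀ → cs.IsSortingWord ω w₀ η →
      CommEquiv (cs.leftInvSeq η) l → List.Sublist [t, t'] l

namespace MaxChain

variable {cs} {c : W}

/-- The reduced word in the reflections that corresponds to a maximal chain. -/
def reflWord (π : cs.MaxChain c) : List W :=
  quotientWord π.elems

/-- The chain `π` is concordant with `u`: `u π₀ ≤_B u π₁ ≤_B ⋯ ≤_B u πᵣ`. -/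
def Concordant (u : W) (π : cs.MaxChain c) : Prop :=
  (π.elems.map (fun x => u * x)).IsChain cs.BruhatLE

/-- There are no `i < j` with `tⱼ ⪯_c tᵢ`. -/
def IsIncreasing (π : cs.MaxChain c) : Prop :=
  π.reflWord.Pairwise (fun t t' => ¬ cs.SortLE c t' t)

/-- There are no `i < j` with `tᵢ ⪯_c tⱼ`. -/
def IsDecreasing (π : cs.MaxChain c) : Prop :=
  π.reflWord.Pairwise (fun t t' => ¬ cs.SortLE c t t')

end MaxChain

/-- Commutation equivalence of maximal chains. -/
def commSetoid (c : W) : Setoid (cs.MaxChain c) where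
  r π π' := CommEquiv π.reflWord π'.reflWord
  iseqv :=
    { refl := fun _ => Relation.EqvGen.refl _
      symm := fun h => Relation.EqvGen.symm _ _ h
      trans := fun h h' => Relation.EqvGen.trans _ _ _ h h' }

/-- The commutation classes of maximal chains of `NC(W, c)`. -/
def CommClass (c : W) : Type _ :=
  Quotient (cs.commSetoid c)

/-- The commutation class of a maximal chain. -/
def commClass {c : W} (π : cs.MaxChain c) : cs.CommClass c :=
  Quotient.mk (cs.commSetoid c) π

/-- The set of commutation classes of maximal chains concordant with `u`. -/
def concordantClasses (c u : W) : Set (cs.CommClass c) :=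
  {C | ∃ π : cs.MaxChain c, cs.commClass π = C ∧ π.Concordant u}

/-- A class is increasing if it is the class of an increasing chain. -/
def IsIncreasingClass {c : W} (C : cs.CommClass c) : Prop :=
  ∃ π : cs.MaxChain c, cs.commClass π = C ∧ π.IsIncreasing

/-- A class is decreasing if it is the class of a decreasing chain. Other chains in the class need
not be decreasing: two commuting reflections may be comparable for `⪯_c`. -/
def IsDecreasingClass {c : W} (C : cs.CommClass c) : Prop :=
  ∃ π : cs.MaxChain c, cs.commClass π = C ∧ π.IsDecreasing

end CoxeterSystem

/-!
The Euler form `E` of a word `s₁ ⋯ sₙ` for `c` is triangular for the order of the letters and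
satisfies `E(x, y) + E(y, x) = 2 (x, y)` for the canonical form `( , )` of the geometric
representation. If `t₁ ⋯ tₙ = c` is a factorization into reflections with positive roots
`β₁, …, βₙ`, then `E(βᵢ, βⱼ) = 0` for `i < j`, so that `E(βᵢ, βⱼ) - E(βⱼ, βᵢ) = -2 (βᵢ, βⱼ)`. As the
sign of this skew form decides how `⪯_c` orders noncommuting reflections, a class is increasing
exactly if the roots make pairwise nonacute angles, and decreasing exactly if they make pairwise
nonobtuse angles. Both properties are unchanged when `s₁` is rotated to the end of the word and the
factorization is conjugated by `s₁`, and uniqueness follows by induction along such rotations; in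
the decreasing case a rotation replaces `u` by `u s₁`, which the finiteness of `W` allows only
finitely often before a letter of `c` can be removed instead.
-/

namespace NoncrossingChains

open CoxeterSystem

section GeometricRepresentation

variable {B : Type*}

/-- The simple root `αᵢ`, a basis vector of the root space `B →₀ ℝ`. -/
noncomputable def simpleRoot (i : B) : B →₀ ℝ := Finsupp.single i 1

@[simp] theorem simpleRoot_self (i : B) : simpleRoot i i = 1 := Finsupp.single_eq_same

theorem simpleRoot_of_ne {i j : B} (h : j ≠ i) : simpleRoot i j = 0 :=
  Finsupp.single_eq_of_ne h

theorem simpleRoot_nonneg (i : B) : 0 ≤ simpleRoot i :=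
  Finsupp.single_nonneg.mpr zero_le_one

theorem smul_simpleRoot (a : ℝ) (i : B) : a • simpleRoot i = Finsupp.single i a :=
  Finsupp.smul_single_one i a

theorem bilin_ext {E F : LinearMap.BilinForm ℝ (B →₀ ℝ)}
    (h : ∀ i j, E (simpleRoot i) (simpleRoot j) = F (simpleRoot i) (simpleRoot j)) : E = F :=
  LinearMap.ext_basis Finsupp.basisSingleOne Finsupp.basisSingleOne h

variable (M : CoxeterMatrix B)

/-- The canonical bilinear form of a Coxeter matrix, `(αᵢ, αⱼ) = -cos (π / Mᵢⱼ)`. An infinite entry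
is encoded as `Mᵢⱼ = 0`, for which division by zero gives the desired value `-1`. -/
noncomputable def cosForm : LinearMap.BilinForm ℝ (B →₀ ℝ) :=
  Finsupp.linearCombination ℝ fun i =>
    Finsupp.linearCombination ℝ fun j => -Real.cos (Real.pi / M i j)

theorem cosForm_simpleRoot (i j : B) :
    cosForm M (simpleRoot i) (simpleRoot j) = -Real.cos (Real.pi / M i j) := by
  simp [cosForm, simpleRoot]

@[simp] theorem cosForm_simpleRoot_self (i : B) :
    cosForm M (simpleRoot i) (simpleRoot i) = 1 := by
  simp [cosForm_simpleRoot]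

variable {M} in
theorem eq_zero_or_two_le {i j : B} (h : i ≠ j) : M i j = 0 ∨ (2 : ℝ) ≤ M i j := by
  have h1 := M.off_diagonal i j h
  rcases Nat.eq_zero_or_pos (M i j) with h0 | h0
  · exact Or.inl h0
  · exact Or.inr (by exact_mod_cast (by omega : 2 ≤ M i j))

theorem cosForm_simpleRoot_nonpos {i j : B} (h : i ≠ j) :
    cosForm M (simpleRoot i) (simpleRoot j) ≤ 0 := by
  rw [cosForm_simpleRoot, neg_nonpos]
  rcases eq_zero_or_two_le h with h0 | h2
  · rw [h0]
    simp
  · refine Real.cos_nonneg_of_mem_Icc ⟨?_, by gcongr⟩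
    have : 0 ≤ Real.pi / M i j := by positivity
    linarith [Real.pi_pos]

theorem cosForm_symm (x y : B →₀ ℝ) : cosForm M x y = cosForm M y x := by
  have h : cosForm M = (cosForm M).flip := bilin_ext fun i j => by
    change _ = cosForm M (simpleRoot j) (simpleRoot i)
    rw [cosForm_simpleRoot, cosForm_simpleRoot, M.symmetric]
  exact LinearMap.congr_fun₂ h x y

/-- The reflection `sᵢ` of the root space in the simple root `αᵢ`. -/
noncomputable def simpleRefl (i : B) : (B →₀ ℝ) ≃ₗ[ℝ] (B →₀ ℝ) :=
  Module.reflection (x := simpleRoot i) (f := (2 : ℝ) • cosForm M (simpleRoot i)) (by simp)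

theorem simpleRefl_apply (i : B) (x : B →₀ ℝ) :
    simpleRefl M i x = x - (2 * cosForm M (simpleRoot i) x) • simpleRoot i := by
  simp [simpleRefl, Module.reflection_apply]

theorem simpleRefl_mul_self (i : B) : simpleRefl M i * simpleRefl M i = 1 :=
  LinearEquiv.ext fun x => by
    simp only [LinearEquiv.mul_apply, simpleRefl_apply, map_sub, map_smul,
      cosForm_simpleRoot_self, LinearEquiv.coe_one, id]
    module

theorem cosForm_simpleRefl (i : B) (x y : B →₀ ℝ) :
    cosForm M (simpleRefl M i x) (simpleRefl M i y) = cosForm M x y := by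
  simp only [simpleRefl_apply, map_sub, map_smul, LinearMap.sub_apply, LinearMap.smul_apply,
    cosForm_simpleRoot_self, smul_eq_mul, cosForm_symm M x (simpleRoot i)]
  ring

theorem simpleRefl_commute {i j : B} (h : cosForm M (simpleRoot i) (simpleRoot j) = 0) :
    simpleRefl M i * simpleRefl M j = simpleRefl M j * simpleRefl M i := by
  refine LinearEquiv.ext fun x => ?_
  have h' : cosForm M (simpleRoot j) (simpleRoot i) = 0 := by rw [cosForm_symm, h]
  simp only [LinearEquiv.mul_apply, simpleRefl_apply, map_sub, map_smul, h, h']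
  module

open Polynomial.Chebyshev in
/-- The two coefficients in `Module.reflection_mul_reflection_pow_apply` vanish when the product of
the two reflections is a rotation by `2π / m`. -/
theorem chebyshev_S_mul_eq_zero {m : ℕ} (hm : 3 ≤ m) {t : ℝ}
    (ht : t = 2 * Real.cos (2 * Real.pi / m)) :
    (S ℝ ((m - 2) / 2)).eval t * ((S ℝ ((m - 1) / 2)).eval t + (S ℝ ((m - 3) / 2)).eval t) = 0 ∧
    (S ℝ ((m - 1) / 2)).eval t * ((S ℝ (m / 2)).eval t + (S ℝ ((m - 2) / 2)).eval t) = 0 := by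
  set θ := 2 * Real.pi / m with hθ
  have hm' : (3 : ℝ) ≤ m := by exact_mod_cast hm
  have hmθ : m * θ = 2 * Real.pi := by rw [hθ]; field_simp
  have hsin : Real.sin θ ≠ 0 := by
    refine (Real.sin_pos_of_pos_of_lt_pi (by positivity) ?_).ne'
    rw [hθ, div_lt_iff₀ (by positivity)]
    nlinarith [Real.pi_pos]
  have eval_S (k : ℤ) : (S ℝ k).eval t * Real.sin θ = Real.sin ((k + 1) * θ) := by
    rw [ht, S_two_mul_real_cos]
  obtain ⟨p, rfl | rfl⟩ := Nat.even_or_odd' m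
  · have hS : (S ℝ (p - 1)).eval t = 0 := by
      have hp : (p : ℝ) * θ = Real.pi := by push_cast at hmθ; linarith
      refine (mul_eq_zero.mp ?_).resolve_right hsin
      rw [eval_S]
      push_cast
      rw [sub_add_cancel, hp, Real.sin_pi]
    rw [show ((2 * p : ℕ) - 2 : ℤ) / 2 = p - 1 by omega,
      show ((2 * p : ℕ) - 1 : ℤ) / 2 = p - 1 by omega, hS]
    simp
  · have hS : (S ℝ p).eval t + (S ℝ (p - 1)).eval t = 0 := by
      refine (mul_eq_zero.mp ?_).resolve_right hsin
      rw [add_mul, eval_S, eval_S]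
      have hp : ((p : ℝ) + 1) * θ = 2 * Real.pi - p * θ := by push_cast at hmθ; linarith
      push_cast
      rw [sub_add_cancel, hp, Real.sin_two_pi_sub]
      ring
    rw [show ((2 * p + 1 : ℕ) - 2 : ℤ) / 2 = p - 1 by omega,
      show ((2 * p + 1 : ℕ) - 1 : ℤ) / 2 = p by omega,
      show ((2 * p + 1 : ℕ) - 3 : ℤ) / 2 = p - 1 by omega,
      show ((2 * p + 1 : ℕ) : ℤ) / 2 = p by omega, hS]
    simp

theorem isLiftable_simpleRefl : M.IsLiftable (simpleRefl M) := by
  intro i j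
  rcases eq_or_ne i j with rfl | hij
  · rw [simpleRefl_mul_self, one_pow]
  rcases eq_zero_or_two_le hij with h0 | h2
  · rw [h0, pow_zero]
  replace h2 : 2 ≤ M i j := by exact_mod_cast h2
  rcases h2.eq_or_lt with h2 | h3
  · have horth : cosForm M (simpleRoot i) (simpleRoot j) = 0 := by
      simp [cosForm_simpleRoot, ← h2]
    rw [← h2, pow_two, mul_assoc, ← mul_assoc (simpleRefl M j), ← simpleRefl_commute M horth,
      mul_assoc, simpleRefl_mul_self, mul_one, simpleRefl_mul_self]
  refine LinearEquiv.ext fun z => ?_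
  have ht : ((2 : ℝ) • cosForm M (simpleRoot i)) (simpleRoot j) *
      ((2 : ℝ) • cosForm M (simpleRoot j)) (simpleRoot i) - 2 =
      2 * Real.cos (2 * Real.pi / M i j) := by
    rw [mul_div_assoc, Real.cos_two_mul]
    simp only [LinearMap.smul_apply, cosForm_simpleRoot, M.symmetric j i, smul_eq_mul]
    ring
  obtain ⟨hS, hS'⟩ := chebyshev_S_mul_eq_zero h3 ht
  rw [simpleRefl, simpleRefl, Module.reflection_mul_reflection_pow_apply, hS, hS']
  simp

end GeometricRepresentation

section Dihedral

variable {B : Type*} (M : CoxeterMatrix B)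

/-- The coefficients `sin (k π / m) / sin (π / m)` of the roots of the dihedral group of order `2m`,
written as Chebyshev polynomials so that the limiting case `m = ∞` (encoded as `m = 0`) is
included. -/
noncomputable def dihedralCoeff (m k : ℕ) : ℝ :=
  (Polynomial.Chebyshev.U ℝ (k - 1)).eval (Real.cos (Real.pi / m))

@[simp] theorem dihedralCoeff_zero (m : ℕ) : dihedralCoeff m 0 = 0 := by simp [dihedralCoeff]

@[simp] theorem dihedralCoeff_one (m : ℕ) : dihedralCoeff m 1 = 1 := by simp [dihedralCoeff]

theorem dihedralCoeff_add_two (m k : ℕ) :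
    dihedralCoeff m (k + 2) =
      2 * Real.cos (Real.pi / m) * dihedralCoeff m (k + 1) - dihedralCoeff m k := by
  have h := Polynomial.Chebyshev.U_add_two ℝ ((k : ℤ) - 1)
  rw [sub_add_cancel] at h
  simp only [dihedralCoeff, Nat.cast_add, Nat.cast_ofNat, Nat.cast_one, add_sub_cancel_right,
    add_sub_right_comm (k : ℤ) 2 1, h]
  simp

theorem dihedralCoeff_nonneg {m k : ℕ} (hm : m ≠ 1) (hk : m = 0 ∨ k ≤ m) :
    0 ≤ dihedralCoeff m k := by
  rcases Nat.eq_zero_or_pos m with rfl | h0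
  · simp [dihedralCoeff, Polynomial.Chebyshev.U_eval_one]
  have h2 : (2 : ℝ) ≤ m := by exact_mod_cast (by omega : 2 ≤ m)
  have hk : (k : ℝ) ≤ m := by exact_mod_cast hk.resolve_left h0.ne'
  have hsin : 0 < Real.sin (Real.pi / m) :=
    Real.sin_pos_of_pos_of_lt_pi (by positivity) (div_lt_self Real.pi_pos (by linarith))
  refine nonneg_of_mul_nonneg_left ?_ hsin
  rw [dihedralCoeff, Polynomial.Chebyshev.U_real_cos]
  push_cast
  rw [sub_add_cancel]
  refine Real.sin_nonneg_of_nonneg_of_le_pi (by positivity) ?_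
  rw [mul_div_assoc', div_le_iff₀ (by linarith), mul_comm]
  gcongr

theorem simpleRefl_dihedralCoeff (i j : B) (k : ℕ) :
    simpleRefl M j (dihedralCoeff (M i j) (k + 1) • simpleRoot i +
        dihedralCoeff (M i j) k • simpleRoot j) =
      dihedralCoeff (M i j) (k + 1) • simpleRoot i +
        dihedralCoeff (M i j) (k + 2) • simpleRoot j := by
  simp only [simpleRefl_apply, map_add, map_smul, cosForm_simpleRoot_self, cosForm_simpleRoot,
    M.symmetric j i, dihedralCoeff_add_two]
  module

end Dihedral

section GeometricRepresentation

variable {B W : Type*} [Group W] {M : CoxeterMatrix B} (cs : CoxeterSystem M W)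

/-- The geometric representation of a Coxeter group. -/
noncomputable def geom : W →* (B →₀ ℝ) ≃ₗ[ℝ] (B →₀ ℝ) :=
  cs.lift ⟨simpleRefl M, isLiftable_simpleRefl M⟩

theorem geom_simple (i : B) : geom cs (cs.simple i) = simpleRefl M i :=
  cs.lift_apply_simple (isLiftable_simpleRefl M) i

theorem geom_simple_apply (i : B) (x : B →₀ ℝ) :
    geom cs (cs.simple i) x = x - (2 * cosForm M (simpleRoot i) x) • simpleRoot i := by
  rw [geom_simple, simpleRefl_apply]

theorem geom_simple_apply_of_ne {i j : B} (h : j ≠ i) (x : B →₀ ℝ) :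
    geom cs (cs.simple i) x j = x j := by
  simp [geom_simple_apply, simpleRoot_of_ne h]

theorem geom_mul_apply (v w : W) (x : B →₀ ℝ) :
    geom cs (v * w) x = geom cs v (geom cs w x) := by
  rw [map_mul, LinearEquiv.mul_apply]

@[simp] theorem geom_one_apply (x : B →₀ ℝ) : geom cs 1 x = x := by
  rw [map_one, LinearEquiv.coe_one, id]

@[simp] theorem geom_inv_geom (w : W) (x : B →₀ ℝ) : geom cs w⁻¹ (geom cs w x) = x := by
  rw [← geom_mul_apply, inv_mul_cancel, geom_one_apply]

@[simp] theorem geom_geom_inv (w : W) (x : B →₀ ℝ) : geom cs w (geom cs w⁻¹ x) = x := by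
  rw [← geom_mul_apply, mul_inv_cancel, geom_one_apply]

@[simp] theorem cosForm_geom (w : W) (x y : B →₀ ℝ) :
    cosForm M (geom cs w x) (geom cs w y) = cosForm M x y := by
  induction w using cs.simple_induction_left with
  | one => simp
  | mul_simple_left w i ih =>
    rw [geom_mul_apply, geom_mul_apply, geom_simple, cosForm_simpleRefl, ih]

theorem geom_simple_simpleRoot (i : B) :
    geom cs (cs.simple i) (simpleRoot i) = -simpleRoot i := by
  rw [geom_simple_apply, cosForm_simpleRoot_self]
  module

theorem geom_alternatingWord (i j : B) (k : ℕ) :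
    geom cs (cs.wordProd (alternatingWord i j k)) (simpleRoot i) =
      if Even k then
        dihedralCoeff (M i j) (k + 1) • simpleRoot i + dihedralCoeff (M i j) k • simpleRoot j
      else
        dihedralCoeff (M i j) k • simpleRoot i +
          dihedralCoeff (M i j) (k + 1) • simpleRoot j := by
  induction k with
  | zero => simp [alternatingWord]
  | succ k ih =>
    rw [alternatingWord_succ', cs.wordProd_cons, geom_mul_apply, ih, geom_simple]
    by_cases hk : Even k
    · simp only [hk, if_true, Nat.even_add_one, not_true, if_false, simpleRefl_dihedralCoeff]
    · simp only [hk, if_false, Nat.even_add_one, not_false_iff, if_true]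
      rw [add_comm, M.symmetric, simpleRefl_dihedralCoeff, add_comm]

end GeometricRepresentation

section Positivity

variable {B W : Type*} [Group W] {M : CoxeterMatrix B} {cs : CoxeterSystem M W}

theorem not_isRightDescent_of_length_eq {v : W} {q : B} {η : List B}
    (h : cs.length (v * cs.wordProd (q :: η)) = cs.length v + (q :: η).length) :
    ¬ cs.IsRightDescent v q := by
  have h1 := cs.length_mul_le (v * cs.simple q) (cs.wordProd η)
  have h2 := cs.length_wordProd_le η
  rw [mul_assoc, ← cs.wordProd_cons, h, List.length_cons] at h1
  unfold IsRightDescent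
  omega

theorem exists_dihedral_factorization {w : W} {j : B} (hj : cs.IsRightDescent w j) (i : B) :
    ∃ v k, w = v * cs.wordProd (alternatingWord i j k) ∧ cs.length w = cs.length v + k ∧ 0 < k ∧
      ¬ cs.IsRightDescent v i ∧ ¬ cs.IsRightDescent v j := by
  classical
  let p : ℕ → Prop := fun k =>
    ∃ v, w = v * cs.wordProd (alternatingWord i j k) ∧ cs.length w = cs.length v + k
  have hp_one : p 1 :=
    ⟨w * cs.simple j, by simp [alternatingWord], (cs.isRightDescent_iff.mp hj).symm⟩
  have le_of_p (k : ℕ) (hk : p k) : k ≤ cs.length w := by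
    obtain ⟨v, -, h⟩ := hk
    omega
  set k := Nat.findGreatest p (cs.length w)
  obtain ⟨v, hv, hlen⟩ : p k := Nat.findGreatest_spec (le_of_p 1 hp_one) hp_one
  have hk_pos : 1 ≤ k := Nat.le_findGreatest (le_of_p 1 hp_one) hp_one
  have not_p_succ : ¬ p (k + 1) := fun h =>
    absurd (Nat.le_findGreatest (le_of_p _ h) h) (by omega)
  have not_descent_next : ¬ cs.IsRightDescent v (if Even k then j else i) := by
    intro hd
    have hlen' := cs.isRightDescent_iff.mp hd
    refine not_p_succ ⟨v * cs.simple (if Even k then j else i), ?_, by omega⟩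
    rw [alternatingWord_succ', cs.wordProd_cons, mul_assoc, cs.simple_mul_simple_cancel_left,
      ← hv]
  have not_descent_first : ¬ cs.IsRightDescent v (if Even k then i else j) := by
    obtain ⟨k', hk'⟩ : ∃ k', k = k' + 1 := ⟨k - 1, by omega⟩
    have hword : alternatingWord i j k =
        (if Even k then i else j) :: alternatingWord i j k' := by
      rw [hk', alternatingWord_succ']
      simp only [Nat.even_add_one, ite_not]
    refine not_isRightDescent_of_length_eq (η := alternatingWord i j k') ?_
    rw [← hword, ← hv, length_alternatingWord, hlen]
  refine ⟨v, k, hv, hlen, hk_pos, ?_⟩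
  by_cases he : Even k
  · simp only [he, if_true] at not_descent_next not_descent_first
    exact ⟨not_descent_first, not_descent_next⟩
  · simp only [he, if_false] at not_descent_next not_descent_first
    exact ⟨not_descent_next, not_descent_first⟩

theorem lt_of_not_isRightDescent_alternatingWord {v : W} {i j : B} {k : ℕ}
    (hlen : cs.length (v * cs.wordProd (alternatingWord i j k)) = cs.length v + k)
    (hi : ¬ cs.IsRightDescent (v * cs.wordProd (alternatingWord i j k)) i) :
    M i j = 0 ∨ k < M i j := by
  by_contra! hcon
  refine cs.not_isReduced_alternatingWord j i (m := k + 1)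
    (by rw [M.symmetric]; exact hcon.1) (by rw [M.symmetric]; omega) ?_
  have h := cs.length_mul_le v (cs.wordProd (alternatingWord j i (k + 1)))
  rw [alternatingWord_succ, cs.wordProd_concat, ← mul_assoc, cs.not_isRightDescent_iff.mp hi,
    hlen] at h
  have h' := cs.length_wordProd_le (alternatingWord j i (k + 1))
  rw [length_alternatingWord, alternatingWord_succ, cs.wordProd_concat] at h'
  rw [CoxeterSystem.IsReduced, length_alternatingWord, alternatingWord_succ, cs.wordProd_concat]
  omega

theorem geom_simpleRoot_nonneg {w : W} {i : B} (hi : ¬ cs.IsRightDescent w i) :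
    0 ≤ geom cs w (simpleRoot i) := by
  induction hn : cs.length w using Nat.strong_induction_on generalizing w i with
  | _ n ih =>
    rcases eq_or_ne w 1 with rfl | hw
    · simpa using simpleRoot_nonneg i
    obtain ⟨j, hj⟩ := cs.exists_rightDescent_of_ne_one hw
    have hij : i ≠ j := fun h => hi (h ▸ hj)
    obtain ⟨v, k, rfl, hlen, hk, hvi, hvj⟩ := exists_dihedral_factorization hj i
    have hkm := lt_of_not_isRightDescent_alternatingWord hlen hi
    have hm : M i j ≠ 1 := M.off_diagonal i j hij
    have hc : 0 ≤ dihedralCoeff (M i j) k := dihedralCoeff_nonneg hm (hkm.imp_right le_of_lt)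
    have hc' : 0 ≤ dihedralCoeff (M i j) (k + 1) := dihedralCoeff_nonneg hm hkm
    have hαi := ih (cs.length v) (by omega) hvi rfl
    have hαj := ih (cs.length v) (by omega) hvj rfl
    rw [geom_mul_apply, geom_alternatingWord]
    split <;> rw [map_add, map_smul, map_smul]
    · exact add_nonneg (smul_nonneg hc' hαi) (smul_nonneg hc hαj)
    · exact add_nonneg (smul_nonneg hc hαi) (smul_nonneg hc' hαj)

theorem geom_simpleRoot_nonpos {w : W} {i : B} (hi : cs.IsRightDescent w i) :
    geom cs w (simpleRoot i) ≤ 0 := by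
  have h : 0 ≤ geom cs (w * cs.simple i) (simpleRoot i) :=
    geom_simpleRoot_nonneg (cs.isRightDescent_iff_not_isRightDescent_mul.mp hi)
  rwa [geom_mul_apply, geom_simple_simpleRoot, map_neg, neg_nonneg] at h

theorem eq_one_of_geom_eq_one {w : W} (h : geom cs w = 1) : w = 1 := by
  by_contra hw
  obtain ⟨i, hi⟩ := cs.exists_rightDescent_of_ne_one hw
  have hnonpos := geom_simpleRoot_nonpos hi i
  rw [h] at hnonpos
  norm_num at hnonpos

variable (cs) in
theorem geom_injective : Function.Injective (geom cs) :=
  (injective_iff_map_eq_one _).mpr fun _ => eq_one_of_geom_eq_one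

end Positivity

section Roots

variable {B W : Type*} [Group W] {M : CoxeterMatrix B} (cs : CoxeterSystem M W)

/-- The roots: the images of the simple roots under the geometric representation. -/
def IsRoot (β : B →₀ ℝ) : Prop := ∃ w i, β = geom cs w (simpleRoot i)

theorem isRoot_simpleRoot (i : B) : IsRoot cs (simpleRoot i) := ⟨1, i, by simp⟩

variable {cs} {β : B →₀ ℝ}

theorem IsRoot.geom (h : IsRoot cs β) (w : W) : IsRoot cs (geom cs w β) := by
  obtain ⟨v, i, rfl⟩ := h
  exact ⟨w * v, i, by rw [geom_mul_apply]⟩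

theorem IsRoot.cosForm_self (h : IsRoot cs β) : cosForm M β β = 1 := by
  obtain ⟨w, i, rfl⟩ := h
  rw [cosForm_geom, cosForm_simpleRoot_self]

theorem IsRoot.ne_zero (h : IsRoot cs β) : β ≠ 0 := by
  rintro rfl
  simpa using h.cosForm_self

theorem IsRoot.nonneg_or_nonpos (h : IsRoot cs β) : 0 ≤ β ∨ β ≤ 0 := by
  obtain ⟨w, i, rfl⟩ := h
  by_cases hi : cs.IsRightDescent w i
  · exact Or.inr (geom_simpleRoot_nonpos hi)
  · exact Or.inl (geom_simpleRoot_nonneg hi)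

theorem IsRoot.not_nonpos (h : IsRoot cs β) (h0 : 0 ≤ β) : ¬ β ≤ 0 :=
  fun h1 => h.ne_zero (le_antisymm h1 h0)

theorem IsRoot.not_nonpos_iff (h : IsRoot cs β) : ¬ β ≤ 0 ↔ 0 ≤ β :=
  ⟨h.nonneg_or_nonpos.resolve_right, h.not_nonpos⟩

theorem eq_simpleRoot_of_nonneg (h : cosForm M β β = 1) (h0 : 0 ≤ β) {i : B}
    (hi : ∀ j, j ≠ i → β j = 0) : β = simpleRoot i := by
  have hβ : β = β i • simpleRoot i := by
    ext j
    rcases eq_or_ne j i with rfl | hj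
    · simp
    · simp [hi j hj, simpleRoot_of_ne hj]
  have hsq : β i * β i = 1 := by
    rw [hβ] at h
    simpa using h
  rw [hβ, (mul_self_eq_one_iff.mp hsq).resolve_right (fun h => by
    linarith [show 0 ≤ β i from h0 i]), one_smul]

theorem IsRoot.geom_simple_nonneg (h : IsRoot cs β) (h0 : 0 ≤ β) {i : B}
    (hi : β ≠ simpleRoot i) : 0 ≤ NoncrossingChains.geom cs (cs.simple i) β := by
  refine (h.geom _).nonneg_or_nonpos.resolve_right fun hneg =>
    hi (eq_simpleRoot_of_nonneg h.cosForm_self h0 fun j hj => ?_)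
  have hj' := hneg j
  rw [geom_simple_apply_of_ne cs hj] at hj'
  exact le_antisymm hj' (h0 j)

theorem geom_conj_simple (w : W) (i : B) (x : B →₀ ℝ) :
    geom cs (w * cs.simple i * w⁻¹) x =
      x - (2 * cosForm M (geom cs w (simpleRoot i)) x) • geom cs w (simpleRoot i) := by
  rw [geom_mul_apply, geom_mul_apply, geom_simple_apply, map_sub, map_smul, geom_geom_inv,
    ← cosForm_geom cs w, geom_geom_inv]

theorem exists_nonneg_root {t : W} (ht : cs.IsReflection t) :
    ∃ β, 0 ≤ β ∧ ∃ w i, t = w * cs.simple i * w⁻¹ ∧ β = geom cs w (simpleRoot i) := by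
  obtain ⟨w, i, rfl⟩ := ht
  rcases (show IsRoot cs _ from ⟨w, i, rfl⟩).nonneg_or_nonpos with h | h
  · exact ⟨_, h, w, i, rfl, rfl⟩
  · refine ⟨-geom cs w (simpleRoot i), neg_nonneg.mpr h, w * cs.simple i, i, ?_, ?_⟩
    · simp [mul_assoc]
    · rw [geom_mul_apply, geom_simple_simpleRoot, map_neg]

open Classical in
variable (cs) in
/-- The positive root of a reflection; it is `0` for elements that are not reflections. -/
noncomputable def root (t : W) : B →₀ ℝ :=
  if ht : cs.IsReflection t then (exists_nonneg_root ht).choose else 0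

variable {t t' : W}

theorem root_spec (ht : cs.IsReflection t) :
    0 ≤ root cs t ∧ ∃ w i, t = w * cs.simple i * w⁻¹ ∧ root cs t = geom cs w (simpleRoot i) := by
  rw [root, dif_pos ht]
  exact (exists_nonneg_root ht).choose_spec

theorem root_nonneg (ht : cs.IsReflection t) : 0 ≤ root cs t :=
  (root_spec ht).1

theorem isRoot_root (ht : cs.IsReflection t) : IsRoot cs (root cs t) := by
  obtain ⟨w, i, -, h⟩ := (root_spec ht).2
  exact ⟨w, i, h⟩

theorem cosForm_root_self (ht : cs.IsReflection t) : cosForm M (root cs t) (root cs t) = 1 :=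
  (isRoot_root ht).cosForm_self

theorem geom_reflection_apply (ht : cs.IsReflection t) (x : B →₀ ℝ) :
    geom cs t x = x - (2 * cosForm M (root cs t) x) • root cs t := by
  obtain ⟨w, i, h, h'⟩ := (root_spec ht).2
  rw [h', ← geom_conj_simple, ← h]

theorem geom_root (ht : cs.IsReflection t) : geom cs t (root cs t) = -root cs t := by
  rw [geom_reflection_apply ht, cosForm_root_self ht]
  module

theorem root_eq (ht : cs.IsReflection t) (h0 : 0 ≤ β) (h1 : cosForm M β β = 1)
    (h : geom cs t β = -β) : root cs t = β := by
  rw [geom_reflection_apply ht] at h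
  set k := cosForm M (root cs t) β
  have hβ : β = k • root cs t := by linear_combination (norm := module) (1 / 2 : ℝ) • h
  have hk : k * k = 1 := by
    rw [hβ] at h1
    simpa [cosForm_root_self ht] using h1
  rcases mul_self_eq_one_iff.mp hk with hk | hk
  · rw [hβ, hk, one_smul]
  · rw [hβ, hk, neg_one_smul, neg_nonneg] at h0
    exact absurd h0 ((isRoot_root ht).not_nonpos (root_nonneg ht))

@[simp] theorem root_simple (i : B) : root cs (cs.simple i) = simpleRoot i :=
  root_eq (cs.isReflection_simple i) (simpleRoot_nonneg i) (cosForm_simpleRoot_self M i)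
    (geom_simple_simpleRoot cs i)

theorem IsRoot.exists_root_eq (h : IsRoot cs β) (h0 : 0 ≤ β) :
    ∃ t, cs.IsReflection t ∧ root cs t = β := by
  obtain ⟨w, i, rfl⟩ := h
  have ht : cs.IsReflection (w * cs.simple i * w⁻¹) := ⟨w, i, rfl⟩
  refine ⟨_, ht, root_eq ht h0 (by rw [cosForm_geom, cosForm_simpleRoot_self]) ?_⟩
  rw [geom_mul_apply, geom_mul_apply, geom_inv_geom, geom_simple_simpleRoot, map_neg]

theorem root_conj (ht : cs.IsReflection t) {w : W} (h0 : 0 ≤ geom cs w (root cs t)) :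
    root cs (w * t * w⁻¹) = geom cs w (root cs t) := by
  refine root_eq (ht.conj w) h0 (by rw [cosForm_geom, cosForm_root_self ht]) ?_
  rw [geom_mul_apply, geom_mul_apply, geom_inv_geom, geom_root ht, map_neg]

theorem eq_of_root_eq (ht : cs.IsReflection t) (ht' : cs.IsReflection t')
    (h : root cs t = root cs t') : t = t' := by
  refine geom_injective cs (LinearEquiv.ext fun x => ?_)
  rw [geom_reflection_apply ht, geom_reflection_apply ht', h]

theorem root_eq_simpleRoot_iff (ht : cs.IsReflection t) {i : B} :
    root cs t = simpleRoot i ↔ t = cs.simple i := by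
  refine ⟨fun h => eq_of_root_eq ht (cs.isReflection_simple i) (by rw [h, root_simple]), ?_⟩
  rintro rfl
  exact root_simple i

theorem geom_simple_root_nonneg (ht : cs.IsReflection t) {i : B} (h : t ≠ cs.simple i) :
    0 ≤ geom cs (cs.simple i) (root cs t) :=
  (isRoot_root ht).geom_simple_nonneg (root_nonneg ht) (mt (root_eq_simpleRoot_iff ht).mp h)

theorem root_conj_simple (ht : cs.IsReflection t) {i : B} (h : t ≠ cs.simple i) :
    root cs (cs.simple i * t * cs.simple i) = geom cs (cs.simple i) (root cs t) := by
  have hconj := root_conj ht (geom_simple_root_nonneg ht h)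
  rwa [inv_simple] at hconj

theorem mem_rightInvSeq_of_geom_nonpos (ht : cs.IsReflection t) {ω : List B}
    (h : geom cs (cs.wordProd ω) (root cs t) ≤ 0) : t ∈ cs.rightInvSeq ω := by
  induction ω with
  | nil =>
    rw [cs.wordProd_nil, geom_one_apply] at h
    exact absurd h ((isRoot_root ht).not_nonpos (root_nonneg ht))
  | cons i ω ih =>
    rw [cs.wordProd_cons, geom_mul_apply] at h
    rw [rightInvSeq, List.mem_cons, or_iff_not_imp_right]
    intro htail
    have hr := (isRoot_root ht).geom (cs.wordProd ω)
    have h0 := hr.not_nonpos_iff.mp (mt ih htail)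
    have hαi : geom cs (cs.wordProd ω) (root cs t) = simpleRoot i := by
      by_contra hne
      exact (hr.geom _).not_nonpos (hr.geom_simple_nonneg h0 hne) h
    rw [← root_conj ht h0, root_eq_simpleRoot_iff (ht.conj _)] at hαi
    rw [← hαi]
    group

theorem length_mul_lt_iff (ht : cs.IsReflection t) (w : W) :
    cs.length (w * t) < cs.length w ↔ geom cs w (root cs t) ≤ 0 := by
  have of_nonpos (v : W) (h : geom cs v (root cs t) ≤ 0) : cs.length (v * t) < cs.length v := by
    obtain ⟨ω, hω, rfl⟩ := cs.exists_isReduced v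
    exact (cs.isRightInversion_of_mem_rightInvSeq hω (mem_rightInvSeq_of_geom_nonpos ht h)).2
  refine ⟨fun h => ?_, of_nonpos w⟩
  by_contra hcon
  rw [((isRoot_root ht).geom w).not_nonpos_iff] at hcon
  have hlt := of_nonpos (w * t) (by
    rwa [geom_mul_apply, geom_root ht, map_neg, neg_nonpos])
  rw [mul_assoc, ht.mul_self, mul_one] at hlt
  omega

theorem lt_length_mul_iff (ht : cs.IsReflection t) (w : W) :
    cs.length w < cs.length (w * t) ↔ 0 ≤ geom cs w (root cs t) := by
  rw [← ((isRoot_root ht).geom w).not_nonpos_iff, ← length_mul_lt_iff ht]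
  have := ht.length_mul_left_ne w
  omega

theorem length_mul_left_lt_iff (ht : cs.IsReflection t) (w : W) :
    cs.length (t * w) < cs.length w ↔ geom cs w⁻¹ (root cs t) ≤ 0 := by
  rw [← length_mul_lt_iff ht, ← cs.length_inv (w⁻¹ * t), mul_inv_rev, inv_inv, ht.inv,
    cs.length_inv]

theorem isLeftDescent_iff_geom {w : W} {i : B} :
    cs.IsLeftDescent w i ↔ geom cs w⁻¹ (simpleRoot i) ≤ 0 := by
  rw [← root_simple (cs := cs)]
  exact length_mul_left_lt_iff (cs.isReflection_simple i) w

theorem commute_of_cosForm_eq_zero (ht : cs.IsReflection t) (ht' : cs.IsReflection t')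
    (h : cosForm M (root cs t) (root cs t') = 0) : t * t' = t' * t := by
  refine geom_injective cs (LinearEquiv.ext fun x => ?_)
  have h' : cosForm M (root cs t') (root cs t) = 0 := by rw [cosForm_symm, h]
  simp only [geom_mul_apply, geom_reflection_apply ht, geom_reflection_apply ht', map_sub,
    map_smul, h, h', smul_zero]
  module

theorem cosForm_eq_zero_of_commute (ht : cs.IsReflection t) (ht' : cs.IsReflection t')
    (hne : t ≠ t') (h : t * t' = t' * t) : cosForm M (root cs t) (root cs t') = 0 := by
  by_contra hb
  have h1 : geom cs t (geom cs t' (root cs t')) = geom cs t' (geom cs t (root cs t')) := by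
    rw [← geom_mul_apply, h, geom_mul_apply]
  rw [geom_root ht', geom_reflection_apply ht (root cs t'), map_neg, map_sub, map_smul,
    geom_root ht', geom_reflection_apply ht, geom_reflection_apply ht',
    cosForm_symm M (root cs t') (root cs t)] at h1
  set b := cosForm M (root cs t) (root cs t')
  have h2 : b • (root cs t - b • root cs t') = 0 := by
    linear_combination (norm := module) (1 / 4 : ℝ) • h1
  have h3 : root cs t = b • root cs t' :=
    sub_eq_zero.mp ((smul_eq_zero.mp h2).resolve_left hb)
  refine hne (eq_of_root_eq ht ht' (root_eq ht' (root_nonneg ht) (cosForm_root_self ht) ?_).symm)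
  rw [h3, map_smul, geom_root ht', smul_neg]

end Roots

section Positivity

variable {B : Type*}

/-- The standard inner product of the root space, for which the simple roots are orthonormal. -/
noncomputable def stdForm : LinearMap.BilinForm ℝ (B →₀ ℝ) :=
  Finsupp.linearCombination ℝ fun i => Finsupp.lapply i

theorem stdForm_symm (x y : B →₀ ℝ) : stdForm x y = stdForm y x := by
  have h : stdForm (B := B) = stdForm.flip := bilin_ext fun i j => by
    change _ = stdForm (simpleRoot j) (simpleRoot i)
    classical simp [stdForm, simpleRoot, Finsupp.single_apply, eq_comm]
  exact LinearMap.congr_fun₂ h x y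

theorem stdForm_self_nonneg (x : B →₀ ℝ) : 0 ≤ stdForm x x := by
  simp only [stdForm, Finsupp.linearCombination_apply, Finsupp.sum, LinearMap.sum_apply,
    LinearMap.smul_apply, Finsupp.lapply_apply, smul_eq_mul]
  exact Finset.sum_nonneg fun i _ => mul_self_nonneg _

theorem stdForm_self_pos {x : B →₀ ℝ} (hx : x ≠ 0) : 0 < stdForm x x := by
  simp only [stdForm, Finsupp.linearCombination_apply, Finsupp.sum, LinearMap.sum_apply,
    LinearMap.smul_apply, Finsupp.lapply_apply, smul_eq_mul]
  exact Finset.sum_pos (fun i hi => mul_self_pos.mpr (Finsupp.mem_support_iff.mp hi))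
    (Finsupp.support_nonempty_iff.mpr hx)

variable {W : Type*} [Group W] {M : CoxeterMatrix B}

theorem exists_invariant_form [Finite W] (cs : CoxeterSystem M W) :
    ∃ g : LinearMap.BilinForm ℝ (B →₀ ℝ), (∀ x y, g x y = g y x) ∧ (∀ x, x ≠ 0 → 0 < g x x) ∧
      ∀ w x y, g (geom cs w x) (geom cs w y) = g x y := by
  have := Fintype.ofFinite W
  let g : LinearMap.BilinForm ℝ (B →₀ ℝ) :=
    ∑ w : W, stdForm.compl₁₂ (geom cs w).toLinearMap (geom cs w).toLinearMap
  have g_apply (x y) : g x y = ∑ w : W, stdForm (geom cs w x) (geom cs w y) := by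
    simp only [g, LinearMap.sum_apply, LinearMap.compl₁₂_apply, LinearEquiv.coe_coe]
  refine ⟨g, fun x y => ?_, fun x hx => ?_, fun v x y => ?_⟩
  · simp only [g_apply, stdForm_symm (geom cs _ x)]
  · rw [g_apply]
    refine Finset.sum_pos' (fun w _ => stdForm_self_nonneg _) ⟨1, Finset.mem_univ _, ?_⟩
    rw [geom_one_apply]
    exact stdForm_self_pos hx
  · simp only [g_apply, ← geom_mul_apply]
    exact Fintype.sum_equiv (Equiv.mulRight v) _ _ fun w => rfl

theorem invariant_form_simpleRoot {cs : CoxeterSystem M W}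
    {g : LinearMap.BilinForm ℝ (B →₀ ℝ)}
    (hg : ∀ w x y, g (geom cs w x) (geom cs w y) = g x y) (x : B →₀ ℝ) (i : B) :
    g x (simpleRoot i) = g (simpleRoot i) (simpleRoot i) * cosForm M (simpleRoot i) x := by
  have h := hg (cs.simple i) x (simpleRoot i)
  rw [geom_simple_simpleRoot, geom_simple_apply] at h
  simp only [map_neg, map_sub, map_smul, LinearMap.sub_apply, LinearMap.smul_apply,
    smul_eq_mul] at h
  linarith

/-- The linear map that divides each simple root by its length for the form `g`. -/
noncomputable def normalization (g : LinearMap.BilinForm ℝ (B →₀ ℝ)) :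
    (B →₀ ℝ) →ₗ[ℝ] (B →₀ ℝ) :=
  Finsupp.linearCombination ℝ fun i =>
    (√(g (simpleRoot i) (simpleRoot i)))⁻¹ • simpleRoot i

theorem normalization_simpleRoot (g : LinearMap.BilinForm ℝ (B →₀ ℝ)) (i : B) :
    normalization g (simpleRoot i) = (√(g (simpleRoot i) (simpleRoot i)))⁻¹ • simpleRoot i := by
  rw [normalization, simpleRoot, Finsupp.linearCombination_single, one_smul, simpleRoot]

theorem normalization_injective {g : LinearMap.BilinForm ℝ (B →₀ ℝ)}
    (hg : ∀ i, 0 < g (simpleRoot i) (simpleRoot i)) : Function.Injective (normalization g) := by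
  have hunit (i : B) : IsUnit (√(g (simpleRoot i) (simpleRoot i)))⁻¹ :=
    (inv_pos.mpr (Real.sqrt_pos.mpr (hg i))).ne'.isUnit
  have hbasis : ⇑(Finsupp.basisSingleOne.isUnitSMul hunit) =
      fun i => (√(g (simpleRoot i) (simpleRoot i)))⁻¹ • simpleRoot i := by
    funext i
    rw [Module.Basis.isUnitSMul_apply, Finsupp.coe_basisSingleOne, simpleRoot]
  have hli := (Finsupp.basisSingleOne.isUnitSMul hunit).linearIndependent
  rwa [hbasis] at hli

theorem cosForm_eq_compl_normalization {cs : CoxeterSystem M W}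
    {g : LinearMap.BilinForm ℝ (B →₀ ℝ)} (g_symm : ∀ x y, g x y = g y x)
    (g_pos : ∀ i, 0 < g (simpleRoot i) (simpleRoot i))
    (g_inv : ∀ w x y, g (geom cs w x) (geom cs w y) = g x y) :
    cosForm M = g.compl₁₂ (normalization g) (normalization g) := by
  refine bilin_ext fun i j => ?_
  have hij := invariant_form_simpleRoot g_inv (simpleRoot i) j
  have hji := invariant_form_simpleRoot g_inv (simpleRoot j) i
  rw [cosForm_symm] at hij
  rw [g_symm, hij] at hji
  rw [LinearMap.compl₁₂_apply, normalization_simpleRoot, normalization_simpleRoot, map_smul,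
    map_smul, LinearMap.smul_apply, hij, smul_eq_mul, smul_eq_mul]
  rcases eq_or_ne (cosForm M (simpleRoot i) (simpleRoot j)) 0 with h | h
  · simp [h]
  · rw [mul_right_cancel₀ h hji, ← mul_assoc, ← mul_assoc, ← mul_inv,
      Real.mul_self_sqrt (g_pos i).le, inv_mul_cancel₀ (g_pos i).ne', one_mul]

theorem cosForm_pos [Finite W] (cs : CoxeterSystem M W) {x : B →₀ ℝ} (hx : x ≠ 0) :
    0 < cosForm M x x := by
  obtain ⟨g, g_symm, g_pos, g_inv⟩ := exists_invariant_form cs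
  have g_simpleRoot_pos (i : B) : 0 < g (simpleRoot i) (simpleRoot i) :=
    g_pos _ (isRoot_simpleRoot cs i).ne_zero
  rw [cosForm_eq_compl_normalization g_symm g_simpleRoot_pos g_inv]
  exact g_pos _ ((map_ne_zero_iff _ (normalization_injective g_simpleRoot_pos)).mpr hx)

end Positivity

section Restriction

variable {B : Type*}

/-- The span of the simple roots `αᵢ` for the letters `i` of `ω`. -/
abbrev supp (ω : List B) : Submodule ℝ (B →₀ ℝ) := Finsupp.supported ℝ ℝ {i | i ∈ ω}

theorem apply_eq_zero_of_mem_supp {ω : List B} {x : B →₀ ℝ} (hx : x ∈ supp ω) {j : B}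
    (hj : j ∉ ω) : x j = 0 :=
  (Finsupp.mem_supported' ℝ x).mp hx j hj

theorem finrank_supp {ω : List B} (h : ω.Nodup) : Module.finrank ℝ (supp ω) = ω.length := by
  classical
  have e : {i | i ∈ ω} ≃ Fin ω.length := (h.getEquiv ω).symm
  rw [((Finsupp.supportedEquivFinsupp {i | i ∈ ω}).trans (Finsupp.domLCongr e)).finrank_eq,
    Module.finrank_finsupp_self, Fintype.card_fin]

instance (ω : List B) : Module.Finite ℝ (supp ω) :=
  have : Finite {i | i ∈ ω} := ω.finite_toSet
  Module.Finite.equiv (Finsupp.supportedEquivFinsupp {i | i ∈ ω}).symm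

/-- The coordinate projection onto the span of the simple roots in `ω`, for a word `ω` without
repeated letters. -/
noncomputable def restr (ω : List B) : Module.End ℝ (B →₀ ℝ) :=
  (ω.map fun i => (Finsupp.lapply i).smulRight (simpleRoot i)).sum

theorem restr_nil (x : B →₀ ℝ) : restr [] x = 0 := rfl

theorem restr_cons (i : B) (ω : List B) (x : B →₀ ℝ) :
    restr (i :: ω) x = x i • simpleRoot i + restr ω x := by
  simp [restr]

theorem restr_append (ω ω' : List B) (x : B →₀ ℝ) :
    restr (ω ++ ω') x = restr ω x + restr ω' x := by
  simp [restr]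

open Classical in
theorem restr_apply {ω : List B} (h : ω.Nodup) (x : B →₀ ℝ) (j : B) :
    restr ω x j = if j ∈ ω then x j else 0 := by
  induction ω with
  | nil => simp [restr_nil]
  | cons i ω ih =>
    rw [List.nodup_cons] at h
    rw [restr_cons, Finsupp.add_apply, ih h.2, Finsupp.smul_apply]
    rcases eq_or_ne j i with rfl | hj
    · simp [h.1]
    · simp [simpleRoot_of_ne hj, hj]

theorem restr_eq_self {ω : List B} (h : ω.Nodup) {x : B →₀ ℝ} (hx : x ∈ supp ω) :
    restr ω x = x := by
  ext j
  rw [restr_apply h]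
  split_ifs with hj
  · rfl
  · exact (apply_eq_zero_of_mem_supp hx hj).symm

theorem restr_congr {ω : List B} {x y : B →₀ ℝ} (h : ∀ j ∈ ω, x j = y j) :
    restr ω x = restr ω y := by
  induction ω with
  | nil => rfl
  | cons i ω ih =>
    rw [restr_cons, restr_cons, h i (by simp), ih fun j hj => h j (by simp [hj])]

theorem simpleRoot_apply_of_notMem {ω : List B} {i : B} (h : i ∉ ω) {j : B} (hj : j ∈ ω) :
    simpleRoot i j = 0 :=
  simpleRoot_of_ne (ne_of_mem_of_not_mem hj h)

theorem restr_simpleRoot_of_notMem {ω : List B} {i : B} (h : i ∉ ω) :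
    restr ω (simpleRoot i) = 0 := by
  rw [restr_congr (y := 0) fun j hj => simpleRoot_apply_of_notMem h hj, map_zero]

end Restriction

section EulerForm

variable {B : Type*} (M : CoxeterMatrix B)

/-- The Euler form of a word: `E(αᵢ, αᵢ) = 1`, and for distinct letters `E(αᵢ, αⱼ) = 2(αᵢ, αⱼ)`
if `i` comes after `j` and `0` if `i` comes before `j`. -/
noncomputable def euler : List B → LinearMap.BilinForm ℝ (B →₀ ℝ)
  | [] => 0
  | i :: ω => (Finsupp.lapply i + (2 : ℝ) • cosForm M (simpleRoot i) ∘ₗ restr ω).smulRight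
      (Finsupp.lapply i : (B →₀ ℝ) →ₗ[ℝ] ℝ) + euler ω

theorem euler_nil (x y : B →₀ ℝ) : euler M [] x y = 0 := rfl

theorem euler_cons (i : B) (ω : List B) (x y : B →₀ ℝ) :
    euler M (i :: ω) x y =
      (x i + 2 * cosForm M (simpleRoot i) (restr ω x)) * y i + euler M ω x y := rfl

theorem euler_concat (ω : List B) (i : B) (x y : B →₀ ℝ) :
    euler M (ω ++ [i]) x y =
      x i * (y i + 2 * cosForm M (simpleRoot i) (restr ω y)) + euler M ω x y := by
  induction ω with
  | nil => simp [euler_cons, euler_nil, restr_nil]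
  | cons j ω ih =>
    rw [List.cons_append, euler_cons, ih, euler_cons, restr_append, restr_cons, restr_nil,
      add_zero, map_add, map_smul, restr_cons, map_add, map_smul,
      cosForm_symm M (simpleRoot j) (simpleRoot i)]
    simp only [smul_eq_mul]
    ring

theorem euler_add_euler (ω : List B) (x y : B →₀ ℝ) :
    euler M ω x y + euler M ω y x = 2 * cosForm M (restr ω x) (restr ω y) := by
  induction ω with
  | nil => simp [euler_nil, restr_nil]
  | cons i ω ih =>
    rw [euler_cons, euler_cons, restr_cons, restr_cons]
    simp only [map_add, map_smul, LinearMap.add_apply, LinearMap.smul_apply, smul_eq_mul,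
      cosForm_simpleRoot_self, cosForm_symm M (restr ω x) (simpleRoot i)]
    linear_combination ih

theorem euler_congr {ω : List B} {x x' y y' : B →₀ ℝ} (hx : ∀ j ∈ ω, x j = x' j)
    (hy : ∀ j ∈ ω, y j = y' j) : euler M ω x y = euler M ω x' y' := by
  induction ω with
  | nil => rfl
  | cons i ω ih =>
    rw [euler_cons, euler_cons, hx i (by simp), hy i (by simp),
      restr_congr (fun j hj => hx j (by simp [hj])),
      ih (fun j hj => hx j (by simp [hj])) (fun j hj => hy j (by simp [hj]))]

theorem euler_simpleRoot_right_of_notMem {ω : List B} {i : B} (h : i ∉ ω) (x : B →₀ ℝ) :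
    euler M ω x (simpleRoot i) = 0 := by
  rw [euler_congr M (x' := x) (y' := 0) (fun _ _ => rfl)
    fun j hj => simpleRoot_apply_of_notMem h hj, map_zero]

theorem euler_simpleRoot_left_of_notMem {ω : List B} {i : B} (h : i ∉ ω) (y : B →₀ ℝ) :
    euler M ω (simpleRoot i) y = 0 := by
  rw [euler_congr M (x' := 0) (y' := y) (fun j hj => simpleRoot_apply_of_notMem h hj)
    fun _ _ => rfl, map_zero, LinearMap.zero_apply]

theorem euler_cons_simpleRoot {ω : List B} {i : B} (h : i ∉ ω) (y : B →₀ ℝ) :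
    euler M (i :: ω) (simpleRoot i) y = y i := by
  rw [euler_cons, euler_simpleRoot_left_of_notMem M h, restr_simpleRoot_of_notMem h]
  simp

theorem euler_concat_simpleRoot {ω : List B} {i : B} (h : i ∉ ω) (x : B →₀ ℝ) :
    euler M (ω ++ [i]) x (simpleRoot i) = x i := by
  rw [euler_concat, euler_simpleRoot_right_of_notMem M h, restr_simpleRoot_of_notMem h]
  simp

theorem cosForm_simpleRoot_nonpos_of_nonneg {i : B} {x : B →₀ ℝ} (h0 : 0 ≤ x) (hi : x i = 0) :
    cosForm M (simpleRoot i) x ≤ 0 := by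
  rw [← Finsupp.sum_single x, Finsupp.sum, map_sum]
  refine Finset.sum_nonpos fun j _ => ?_
  rw [← smul_simpleRoot, map_smul, smul_eq_mul]
  rcases eq_or_ne i j with rfl | hj
  · simp [hi]
  · exact mul_nonpos_of_nonneg_of_nonpos (h0 j) (cosForm_simpleRoot_nonpos M hj)

variable {M} {W : Type*} [Group W] (cs : CoxeterSystem M W)

theorem geom_simple_apply_self {i : B} {ω : List B} (h : (i :: ω).Nodup) {x : B →₀ ℝ}
    (hx : x ∈ supp (i :: ω)) :
    geom cs (cs.simple i) x i = -x i - 2 * cosForm M (simpleRoot i) (restr ω x) := by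
  have hr : cosForm M (simpleRoot i) x = x i + cosForm M (simpleRoot i) (restr ω x) := by
    conv_lhs => rw [← restr_eq_self h hx, restr_cons]
    simp
  rw [geom_simple_apply, Finsupp.sub_apply, Finsupp.smul_apply, simpleRoot_self, smul_eq_mul, hr]
  ring

theorem euler_rotate {i : B} {ω : List B} (h : (i :: ω).Nodup) {x y : B →₀ ℝ}
    (hx : x ∈ supp (i :: ω)) (hy : y ∈ supp (i :: ω)) :
    euler M (ω ++ [i]) (geom cs (cs.simple i) x) (geom cs (cs.simple i) y) =
      euler M (i :: ω) x y := by
  have geom_eq (z : B →₀ ℝ) : ∀ j ∈ ω, geom cs (cs.simple i) z j = z j := fun j hj =>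
    geom_simple_apply_of_ne cs (ne_of_mem_of_not_mem hj (List.nodup_cons.mp h).1) z
  rw [euler_concat, euler_cons, euler_congr M (geom_eq x) (geom_eq y), restr_congr (geom_eq y),
    geom_simple_apply_self cs h hx, geom_simple_apply_self cs h hy]
  ring

theorem geom_wordProd_apply_of_notMem {ω : List B} {j : B} (h : j ∉ ω) (x : B →₀ ℝ) :
    geom cs (cs.wordProd ω) x j = x j := by
  induction ω with
  | nil => simp
  | cons i ω ih =>
    rw [List.mem_cons, not_or] at h
    rw [wordProd_cons, geom_mul_apply, geom_simple_apply_of_ne cs h.1, ih h.2]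

theorem geom_wordProd_inv_apply_of_notMem {ω : List B} {j : B} (h : j ∉ ω) (x : B →₀ ℝ) :
    geom cs (cs.wordProd ω)⁻¹ x j = x j := by
  rw [← wordProd_reverse]
  exact geom_wordProd_apply_of_notMem cs (by simpa using h) x

theorem euler_sub_geom_inv {ω : List B} (h : ω.Nodup) (x y : B →₀ ℝ) :
    euler M ω x (y - geom cs (cs.wordProd ω)⁻¹ y) = 2 * cosForm M (restr ω x) y := by
  induction ω generalizing y with
  | nil => simp [euler_nil, restr_nil]
  | cons i ω ih =>
    rw [List.nodup_cons] at h
    set z := geom cs (cs.simple i) y with hz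
    have hyz : y = z + (2 * cosForm M (simpleRoot i) y) • simpleRoot i := by
      rw [hz, geom_simple_apply, sub_add_cancel]
    have hcoord : (y - geom cs (cs.wordProd ω)⁻¹ z) i = 2 * cosForm M (simpleRoot i) y := by
      rw [Finsupp.sub_apply, geom_wordProd_inv_apply_of_notMem cs h.1, hz, geom_simple_apply]
      simp
    have hωz : euler M ω x (y - geom cs (cs.wordProd ω)⁻¹ z) = 2 * cosForm M (restr ω x) z := by
      nth_rewrite 1 [hyz]
      rw [add_sub_right_comm, map_add, ih h.2, map_smul, euler_simpleRoot_right_of_notMem M h.1,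
        smul_zero, add_zero]
    rw [euler_cons, wordProd_cons, mul_inv_rev, inv_simple, geom_mul_apply, ← hz, hcoord, hωz, hz,
      geom_simple_apply, restr_cons, cosForm_symm M (simpleRoot i) (restr ω x)]
    simp only [map_add, map_sub, map_smul, LinearMap.add_apply, LinearMap.smul_apply, smul_eq_mul]
    ring

end EulerForm

section Factorization

variable {B W : Type*} [Group W] {M : CoxeterMatrix B} (cs : CoxeterSystem M W)

/-- The span of the roots of the letters of a word in the reflections. -/
noncomputable abbrev rootSpan (ts : List W) : Submodule ℝ (B →₀ ℝ) :=
  Submodule.span ℝ (Set.range fun k : Fin ts.length => root cs ts[k])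

instance (ts : List W) : Module.Finite ℝ (rootSpan cs ts) :=
  FiniteDimensional.span_of_finite ℝ (Set.finite_range _)

theorem root_mem_rootSpan {ts : List W} {t : W} (h : t ∈ ts) : root cs t ∈ rootSpan cs ts := by
  obtain ⟨k, hk, rfl⟩ := List.getElem_of_mem h
  exact Submodule.subset_span ⟨⟨k, hk⟩, rfl⟩

theorem rootSpan_cons (t : W) (ts : List W) :
    rootSpan cs (t :: ts) = Submodule.span ℝ {root cs t} ⊔ rootSpan cs ts := by
  rw [rootSpan, rootSpan, ← Submodule.span_union, Set.singleton_union]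
  exact congrArg _ (Fin.range_fin_succ _)

theorem rootSpan_le_cons (t : W) (ts : List W) : rootSpan cs ts ≤ rootSpan cs (t :: ts) := by
  rw [rootSpan_cons]
  exact le_sup_right

theorem finrank_rootSpan_le (ts : List W) :
    Module.finrank ℝ (rootSpan cs ts) ≤ ts.length :=
  (finrank_range_le_card _).trans (Fintype.card_fin _).le

theorem finrank_rootSpan_cons_le (t : W) (ts : List W) :
    Module.finrank ℝ (rootSpan cs (t :: ts)) ≤ Module.finrank ℝ (rootSpan cs ts) + 1 := by
  rw [rootSpan_cons]
  have hadd := Submodule.finrank_add_le_finrank_add_finrank (Submodule.span ℝ {root cs t})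
    (rootSpan cs ts)
  have hone := finrank_span_le_card (R := ℝ) ({root cs t} : Set (B →₀ ℝ))
  rw [Set.toFinset_singleton, Finset.card_singleton] at hone
  omega

theorem root_notMem_rootSpan {t : W} {ts : List W}
    (h : (t :: ts).length ≤ Module.finrank ℝ (rootSpan cs (t :: ts))) :
    root cs t ∉ rootSpan cs ts := by
  intro hmem
  rw [rootSpan_cons, sup_eq_right.mpr ((Submodule.span_singleton_le_iff_mem _ _).mpr hmem),
    List.length_cons] at h
  have := finrank_rootSpan_le cs ts
  omega

theorem sub_geom_inv_mem_rootSpan {ts : List W} (h : ∀ t ∈ ts, cs.IsReflection t)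
    (y : B →₀ ℝ) : y - geom cs ts.prod⁻¹ y ∈ rootSpan cs ts := by
  induction ts generalizing y with
  | nil => simp
  | cons t ts ih =>
    rw [List.forall_mem_cons] at h
    have hts := rootSpan_le_cons cs t ts (ih h.2 (geom cs t y))
    have ht : y - geom cs t y ∈ rootSpan cs (t :: ts) := by
      rw [geom_reflection_apply h.1, sub_sub_cancel]
      exact Submodule.smul_mem _ _ (root_mem_rootSpan cs List.mem_cons_self)
    rw [List.prod_cons, mul_inv_rev, h.1.inv, geom_mul_apply,
      ← sub_add_sub_cancel y (geom cs t y)]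
    exact Submodule.add_mem _ ht hts

theorem exists_sub_geom_eq {U : Submodule ℝ (B →₀ ℝ)} [Module.Finite ℝ U] {w : W}
    (hU : ∀ y ∈ U, y - geom cs w y ∈ U) (h0 : ∀ y ∈ U, geom cs w y = y → y = 0) {x : B →₀ ℝ}
    (hx : x ∈ U) : ∃ y ∈ U, y - geom cs w y = x := by
  let f : (B →₀ ℝ) →ₗ[ℝ] B →₀ ℝ := LinearMap.id - (geom cs w).toLinearMap
  have hinj : Set.InjOn f U :=
    LinearMap.injOn_of_disjoint_ker subset_rfl <| Submodule.disjoint_def.mpr fun y hy hker =>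
      h0 y hy (sub_eq_zero.mp hker).symm
  exact (LinearMap.injOn_iff_surjOn hU).mp hinj hx

/-- A factorization of the product of the word `ω` into `|ω|` reflections. -/
structure IsFactorization (ω : List B) (ts : List W) : Prop where
  isReflection : ∀ t ∈ ts, cs.IsReflection t
  prod_eq : ts.prod = cs.wordProd ω
  length_eq : ts.length = ω.length

/-- The bilinear form `E` is an Euler form for the word `ts` in the reflections: on the span of the
roots it symmetrizes to `2 ( , )` and is adapted to the product `c` of the word through
`E (x, (1 - c⁻¹) y) = 2 (x, y)`. -/
structure IsEulerForm (E : LinearMap.BilinForm ℝ (B →₀ ℝ)) (ts : List W) : Prop where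
  apply_sub_geom_inv : ∀ x ∈ rootSpan cs ts, ∀ y,
    E x (y - geom cs ts.prod⁻¹ y) = 2 * cosForm M x y
  add_swap : ∀ x ∈ rootSpan cs ts, ∀ y ∈ rootSpan cs ts, E x y + E y x = 2 * cosForm M x y

variable {cs}

theorem IsEulerForm.tail {E : LinearMap.BilinForm ℝ (B →₀ ℝ)} {t : W} {ts : List W}
    (hE : IsEulerForm cs E (t :: ts)) (ht : cs.IsReflection t)
    (hzero : ∀ x ∈ rootSpan cs ts, E (root cs t) x = 0) : IsEulerForm cs E ts := by
  have hle := rootSpan_le_cons cs t ts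
  refine ⟨fun x hx y => ?_, fun x hx y hy => hE.add_swap x (hle hx) y (hle hy)⟩
  obtain ⟨z, rfl⟩ : ∃ z, y = geom cs t z :=
    ⟨geom cs t y, by rw [← geom_mul_apply, ht.mul_self, geom_one_apply]⟩
  have hz := hE.apply_sub_geom_inv x (hle hx) z
  have hroot := hE.add_swap x (hle hx) _ (root_mem_rootSpan cs List.mem_cons_self)
  rw [hzero x hx, add_zero] at hroot
  rw [List.prod_cons, mul_inv_rev, ht.inv, geom_mul_apply] at hz
  have hsplit : geom cs t z - geom cs ts.prod⁻¹ (geom cs t z) =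
      (z - geom cs ts.prod⁻¹ (geom cs t z)) - (2 * cosForm M (root cs t) z) • root cs t := by
    rw [sub_right_comm, ← geom_reflection_apply ht z]
  rw [hsplit, map_sub, hz, map_smul, hroot, geom_reflection_apply ht, map_sub, map_smul]
  simp only [smul_eq_mul]
  ring

variable [Finite W]

theorem eq_zero_of_cosForm_self (cs : CoxeterSystem M W) {x : B →₀ ℝ} (h : cosForm M x x = 0) :
    x = 0 := by
  by_contra hx
  exact (cosForm_pos cs hx).ne' h

theorem eq_zero_of_geom_inv_wordProd_eq {ω : List B} (h : ω.Nodup) {y : B →₀ ℝ}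
    (hy : y ∈ supp ω) (hfix : geom cs (cs.wordProd ω)⁻¹ y = y) : y = 0 := by
  have hE := euler_sub_geom_inv cs h y y
  rw [hfix, sub_self, map_zero, restr_eq_self h hy] at hE
  exact eq_zero_of_cosForm_self cs (by linarith)

theorem exists_sub_geom_inv_wordProd_eq {ω : List B} (h : ω.Nodup) {x : B →₀ ℝ}
    (hx : x ∈ supp ω) : ∃ y ∈ supp ω, y - geom cs (cs.wordProd ω)⁻¹ y = x := by
  refine exists_sub_geom_eq cs (fun y _ => (Finsupp.mem_supported' ℝ _).mpr fun j hj => ?_)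
    (fun y hy => eq_zero_of_geom_inv_wordProd_eq h hy) hx
  rw [Finsupp.sub_apply, geom_wordProd_inv_apply_of_notMem cs hj, sub_self]

variable {ω : List B} {ts : List W}

theorem supp_le_rootSpan (h : ω.Nodup) (hts : ∀ t ∈ ts, cs.IsReflection t)
    (hprod : ts.prod = cs.wordProd ω) : supp ω ≤ rootSpan cs ts := by
  intro x hx
  obtain ⟨y, -, rfl⟩ := exists_sub_geom_inv_wordProd_eq (cs := cs) h hx
  rw [← hprod]
  exact sub_geom_inv_mem_rootSpan cs hts y

theorem length_le_of_prod_eq (h : ω.Nodup) (hts : ∀ t ∈ ts, cs.IsReflection t)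
    (hprod : ts.prod = cs.wordProd ω) : ω.length ≤ ts.length := by
  rw [← finrank_supp h]
  exact (Submodule.finrank_mono (supp_le_rootSpan h hts hprod)).trans (finrank_rootSpan_le cs ts)

theorem IsFactorization.supp_eq (hts : IsFactorization cs ω ts) (h : ω.Nodup) :
    supp ω = rootSpan cs ts := by
  refine Submodule.eq_of_le_of_finrank_le (supp_le_rootSpan h hts.1 hts.2) ?_
  rw [finrank_supp h, ← hts.length_eq]
  exact finrank_rootSpan_le cs ts

theorem IsFactorization.root_mem_supp (hts : IsFactorization cs ω ts) (h : ω.Nodup) {t : W}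
    (ht : t ∈ ts) : root cs t ∈ supp ω := by
  rw [hts.supp_eq h]
  exact root_mem_rootSpan cs ht

theorem IsEulerForm.apply_root_eq_zero {E : LinearMap.BilinForm ℝ (B →₀ ℝ)} {t : W}
    (hE : IsEulerForm cs E (t :: ts)) (hts : ∀ t' ∈ t :: ts, cs.IsReflection t')
    (hnot : root cs t ∉ rootSpan cs ts) {x : B →₀ ℝ} (hx : x ∈ rootSpan cs ts) :
    E (root cs t) x = 0 := by
  have ht := hts t List.mem_cons_self
  obtain ⟨y, -, hy⟩ := exists_sub_geom_eq cs (U := rootSpan cs (t :: ts))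
    (fun y _ => sub_geom_inv_mem_rootSpan cs hts y)
    (fun y hy hfix => eq_zero_of_cosForm_self cs (by
      have hyy := hE.apply_sub_geom_inv y hy y
      rw [hfix, sub_self, map_zero] at hyy
      linarith)) (rootSpan_le_cons cs t ts hx)
  have hroot := hE.apply_sub_geom_inv _ (root_mem_rootSpan cs List.mem_cons_self) y
  rw [hy] at hroot
  have hmem : (2 * cosForm M (root cs t) y) • root cs t ∈ rootSpan cs ts := by
    have hsplit : (2 * cosForm M (root cs t) y) • root cs t =
        x - (geom cs t y - geom cs ts.prod⁻¹ (geom cs t y)) := by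
      rw [← hy, List.prod_cons, mul_inv_rev, ht.inv, geom_mul_apply, sub_sub_sub_cancel_right,
        geom_reflection_apply ht y, sub_sub_cancel]
    rw [hsplit]
    exact Submodule.sub_mem _ hx
      (sub_geom_inv_mem_rootSpan cs (fun t' ht' => hts t' (List.mem_cons_of_mem t ht')) _)
  by_contra hne
  rw [hroot] at hne
  exact hnot ((Submodule.smul_mem_iff _ hne).mp hmem)

theorem IsEulerForm.pairwise_eq_zero {E : LinearMap.BilinForm ℝ (B →₀ ℝ)}
    (hE : IsEulerForm cs E ts) (hts : ∀ t ∈ ts, cs.IsReflection t)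
    (hind : ts.length ≤ Module.finrank ℝ (rootSpan cs ts)) :
    ts.Pairwise fun t t' => t ≠ t' ∧ E (root cs t) (root cs t') = 0 := by
  induction ts with
  | nil => exact List.Pairwise.nil
  | cons t ts ih =>
    have hnot := root_notMem_rootSpan cs hind
    have hzero (x) (hx : x ∈ rootSpan cs ts) : E (root cs t) x = 0 :=
      hE.apply_root_eq_zero hts hnot hx
    rw [List.forall_mem_cons] at hts
    refine List.pairwise_cons.mpr ⟨fun t' ht' => ⟨?_, hzero _ (root_mem_rootSpan cs ht')⟩,
      ih (hE.tail hts.1 hzero) hts.2 ?_⟩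
    · rintro rfl
      exact hnot (root_mem_rootSpan cs ht')
    · have := finrank_rootSpan_cons_le cs t ts
      rw [List.length_cons] at hind
      omega

theorem IsFactorization.isEulerForm (hts : IsFactorization cs ω ts) (h : ω.Nodup) :
    IsEulerForm cs (euler M ω) ts := by
  constructor
  · intro x hx y
    rw [← hts.supp_eq h] at hx
    rw [hts.prod_eq, euler_sub_geom_inv cs h, restr_eq_self h hx]
  · intro x hx y hy
    rw [← hts.supp_eq h] at hx hy
    rw [euler_add_euler, restr_eq_self h hx, restr_eq_self h hy]

theorem IsFactorization.pairwise (hts : IsFactorization cs ω ts) (h : ω.Nodup) :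
    ts.Pairwise fun t t' => t ≠ t' ∧ euler M ω (root cs t) (root cs t') = 0 :=
  (hts.isEulerForm h).pairwise_eq_zero hts.isReflection
    (by rw [← hts.supp_eq h, finrank_supp h, hts.length_eq])

theorem IsFactorization.nodup (hts : IsFactorization cs ω ts) (h : ω.Nodup) : ts.Nodup :=
  (hts.pairwise h).imp And.left

end Factorization

section Words

variable {G : Type*} [Group G] {l l' l'' : List G}

theorem commEquiv_equivalence : Equivalence (CommEquiv (G := G)) :=
  Relation.EqvGen.is_equivalence _

theorem commEquiv_refl (l : List G) : CommEquiv l l :=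
  commEquiv_equivalence.refl l

theorem commEquiv_symm (h : CommEquiv l l') : CommEquiv l' l :=
  commEquiv_equivalence.symm h

theorem commEquiv_trans (h : CommEquiv l l') (h' : CommEquiv l' l'') : CommEquiv l l'' :=
  commEquiv_equivalence.trans h h'

theorem commEquiv_swap (l₁ l₂ : List G) {s t : G} (h : s * t = t * s) :
    CommEquiv (l₁ ++ s :: t :: l₂) (l₁ ++ t :: s :: l₂) :=
  Relation.EqvGen.rel _ _ (CommMove.swap l₁ l₂ s t h)

theorem rel_of_commEquiv {r : List G → List G → Prop} (hr : Equivalence r)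
    (hmove : ∀ l₁ l₂ s t, s * t = t * s → r (l₁ ++ s :: t :: l₂) (l₁ ++ t :: s :: l₂))
    (h : CommEquiv l l') : r l l' :=
  hr.eqvGen_iff.mp <| h.mono fun _ _ ⟨l₁, l₂, s, t, hst⟩ => hmove l₁ l₂ s t hst

theorem perm_of_commEquiv (h : CommEquiv l l') : l.Perm l' :=
  rel_of_commEquiv (List.Perm.eqv G) (fun l₁ _ _ _ _ => (List.Perm.swap _ _ _).append_left l₁) h

theorem prod_eq_of_commEquiv (h : CommEquiv l l') : l.prod = l'.prod := by
  refine rel_of_commEquiv (eq_equivalence.comap List.prod) (fun l₁ l₂ s t hst => ?_) h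
  simp only [Function.onFun, List.prod_append, List.prod_cons]
  rw [← mul_assoc s, hst, mul_assoc]

theorem commEquiv_of_move {H : Type*} [Group H] {f : List G → List H}
    (hmove : ∀ l₁ l₂ s t, s * t = t * s →
      CommEquiv (f (l₁ ++ s :: t :: l₂)) (f (l₁ ++ t :: s :: l₂)))
    (h : CommEquiv l l') : CommEquiv (f l) (f l') :=
  rel_of_commEquiv (r := Function.onFun CommEquiv f) (commEquiv_equivalence.comap f) hmove h

theorem commEquiv_append_left (a : List G) (h : CommEquiv l l') :
    CommEquiv (a ++ l) (a ++ l') := by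
  refine commEquiv_of_move (f := (a ++ ·)) (fun l₁ l₂ s t hst => ?_) h
  simpa only [List.append_assoc] using commEquiv_swap (a ++ l₁) l₂ hst

theorem commEquiv_cons (a : G) (h : CommEquiv l l') : CommEquiv (a :: l) (a :: l') :=
  commEquiv_append_left [a] h

theorem commEquiv_append_right (a : List G) (h : CommEquiv l l') :
    CommEquiv (l ++ a) (l' ++ a) := by
  refine commEquiv_of_move (f := (· ++ a)) (fun l₁ l₂ s t hst => ?_) h
  simpa only [List.append_assoc, List.cons_append] using
    commEquiv_swap l₁ (l₂ ++ a) hst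

theorem commEquiv_map (f : G →* G) (h : CommEquiv l l') : CommEquiv (l.map f) (l'.map f) := by
  refine commEquiv_of_move (f := List.map f) (fun l₁ l₂ s t hst => ?_) h
  simp only [List.map_append, List.map_cons]
  exact commEquiv_swap _ _ (by rw [← map_mul, hst, map_mul])

theorem commEquiv_move_front {l₁ : List G} (l₂ : List G) {s : G} (h : ∀ x ∈ l₁, x * s = s * x) :
    CommEquiv (l₁ ++ s :: l₂) (s :: (l₁ ++ l₂)) := by
  induction l₁ with
  | nil => exact commEquiv_refl _
  | cons x l₁ ih =>
    rw [List.forall_mem_cons] at h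
    exact commEquiv_trans (commEquiv_cons x (ih h.2)) (commEquiv_swap [] (l₁ ++ l₂) h.1)

theorem commEquiv_move_back (l₁ : List G) {l₂ : List G} {s : G} (h : ∀ x ∈ l₂, s * x = x * s) :
    CommEquiv (l₁ ++ s :: l₂) (l₁ ++ l₂ ++ [s]) := by
  have hfront := commEquiv_move_front [] fun x hx => (h x hx).symm
  rw [List.append_nil] at hfront
  rw [List.append_assoc]
  exact commEquiv_append_left l₁ (commEquiv_symm hfront)

end Words

section Rotation

variable {B W : Type*} [Group W] {M : CoxeterMatrix B} (cs : CoxeterSystem M W)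

/-- The word obtained from `ts` by conjugating every letter by a simple reflection. -/
def conjWord (i : B) (ts : List W) : List W :=
  ts.map (MulAut.conj (cs.simple i) : W →* W)

theorem conj_simple_apply (i : B) (t : W) :
    (MulAut.conj (cs.simple i) : W →* W) t = cs.simple i * t * cs.simple i := by
  rw [MonoidHom.coe_coe, MulAut.conj_apply, inv_simple]

theorem conjWord_cons (i : B) (t : W) (ts : List W) :
    conjWord cs i (t :: ts) = cs.simple i * t * cs.simple i :: conjWord cs i ts := by
  rw [conjWord, List.map_cons, conj_simple_apply, conjWord]

theorem length_conjWord (i : B) (ts : List W) : (conjWord cs i ts).length = ts.length :=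
  List.length_map _

theorem prod_conjWord (i : B) (ts : List W) :
    (conjWord cs i ts).prod = cs.simple i * ts.prod * cs.simple i := by
  rw [conjWord, ← map_list_prod, conj_simple_apply]

theorem mem_conjWord {i : B} {ts : List W} {t : W} :
    t ∈ conjWord cs i ts ↔ ∃ t' ∈ ts, cs.simple i * t' * cs.simple i = t := by
  simp only [conjWord, List.mem_map, conj_simple_apply]

theorem simple_notMem_conjWord {i : B} {ts : List W} (h : cs.simple i ∉ ts) :
    cs.simple i ∉ conjWord cs i ts := by
  rw [mem_conjWord]
  rintro ⟨t, ht, he⟩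
  rw [mul_eq_right, mul_eq_one_iff_eq_inv', inv_simple] at he
  exact h (he ▸ ht)

theorem conjWord_conjWord (i : B) (ts : List W) : conjWord cs i (conjWord cs i ts) = ts := by
  induction ts with
  | nil => rfl
  | cons t ts ih =>
    rw [conjWord_cons, conjWord_cons, ih, mul_assoc _ t, simple_mul_simple_cancel_left,
      simple_mul_simple_cancel_right]

variable {cs} {ω : List B} {ts ts' : List W} {i : B}

theorem commEquiv_conjWord (h : CommEquiv (conjWord cs i ts) ts') :
    CommEquiv ts (conjWord cs i ts') := by
  have hconj := commEquiv_map (MulAut.conj (cs.simple i) : W →* W) h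
  rwa [← conjWord, ← conjWord, conjWord_conjWord] at hconj

theorem isReflection_of_mem_conjWord (h : ∀ t ∈ ts, cs.IsReflection t) :
    ∀ t ∈ conjWord cs i ts, cs.IsReflection t := by
  intro t ht
  obtain ⟨t', ht', rfl⟩ := (mem_conjWord cs).mp ht
  simpa only [inv_simple] using (h t' ht').conj (cs.simple i)

theorem IsFactorization.rotate (h : IsFactorization cs (i :: ω) ts) :
    IsFactorization cs (ω ++ [i]) (conjWord cs i ts) where
  isReflection := isReflection_of_mem_conjWord h.isReflection
  prod_eq := by
    rw [prod_conjWord, h.prod_eq, wordProd_cons, wordProd_append, wordProd_singleton,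
      simple_mul_simple_cancel_left]
  length_eq := by rw [length_conjWord, h.length_eq, List.length_append, List.length_cons]; rfl

theorem IsFactorization.rotate_symm (h : IsFactorization cs (ω ++ [i]) ts) :
    IsFactorization cs (i :: ω) (conjWord cs i ts) where
  isReflection := isReflection_of_mem_conjWord h.isReflection
  prod_eq := by
    rw [prod_conjWord, h.prod_eq, wordProd_cons, wordProd_append, wordProd_singleton, mul_assoc,
      simple_mul_simple_cancel_right]
  length_eq := by rw [length_conjWord, h.length_eq, List.length_append, List.length_cons]; rfl

theorem IsFactorization.of_commEquiv_cons {l : List W} (h : IsFactorization cs (i :: ω) ts)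
    (hc : CommEquiv ts (cs.simple i :: l)) : IsFactorization cs ω l where
  isReflection t ht :=
    h.isReflection t ((perm_of_commEquiv hc).mem_iff.mpr (List.mem_cons_of_mem _ ht))
  prod_eq := by
    have hprod := prod_eq_of_commEquiv hc
    rw [h.prod_eq, List.prod_cons, wordProd_cons] at hprod
    exact (mul_left_cancel hprod).symm
  length_eq := by
    have hlen := (perm_of_commEquiv hc).length_eq
    rw [h.length_eq] at hlen
    exact (Nat.succ.inj hlen).symm

variable (cs) in
/-- The positive roots of the letters make pairwise nonacute angles. -/
def IsNonacute (ts : List W) : Prop :=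
  ts.Pairwise fun t t' => cosForm M (root cs t) (root cs t') ≤ 0

variable (cs) in
/-- The positive roots of the letters make pairwise nonobtuse angles. -/
def IsNonobtuse (ts : List W) : Prop :=
  ts.Pairwise fun t t' => 0 ≤ cosForm M (root cs t) (root cs t')

theorem pairwise_cosForm_conjWord {p : ℝ → Prop} (hts : ∀ t ∈ ts, cs.IsReflection t)
    (hi : cs.simple i ∉ ts) (h : ts.Pairwise fun t t' => p (cosForm M (root cs t) (root cs t'))) :
    (conjWord cs i ts).Pairwise fun t t' => p (cosForm M (root cs t) (root cs t')) := by
  rw [conjWord, List.pairwise_map]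
  refine h.imp_of_mem fun {t t'} ht ht' hp => ?_
  rwa [conj_simple_apply, conj_simple_apply,
    root_conj_simple (hts _ ht) (ne_of_mem_of_not_mem ht hi),
    root_conj_simple (hts _ ht') (ne_of_mem_of_not_mem ht' hi), cosForm_geom]

theorem IsNonacute.conjWord (h : IsNonacute cs ts) (hts : ∀ t ∈ ts, cs.IsReflection t)
    (hi : cs.simple i ∉ ts) : IsNonacute cs (conjWord cs i ts) :=
  pairwise_cosForm_conjWord (p := (· ≤ 0)) hts hi h

theorem IsNonobtuse.conjWord (h : IsNonobtuse cs ts) (hts : ∀ t ∈ ts, cs.IsReflection t)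
    (hi : cs.simple i ∉ ts) : IsNonobtuse cs (conjWord cs i ts) :=
  pairwise_cosForm_conjWord (p := (0 ≤ ·)) hts hi h

theorem IsNonacute.perm (h : IsNonacute cs ts) (hperm : ts.Perm ts') : IsNonacute cs ts' :=
  (hperm.pairwise_iff fun h' => by rwa [cosForm_symm]).mp h

theorem IsNonobtuse.perm (h : IsNonobtuse cs ts) (hperm : ts.Perm ts') : IsNonobtuse cs ts' :=
  (hperm.pairwise_iff fun h' => by rwa [cosForm_symm]).mp h

theorem simpleRoot_mem_supp (h : i ∈ ω) : simpleRoot i ∈ supp ω :=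
  Finsupp.single_mem_supported ℝ _ h

variable (cs) in
/-- A nonacute factorization that is not commutation equivalent to the factorization into simple
reflections. There is none, see `not_isExotic`. -/
structure IsExotic (ω : List B) (ts : List W) : Prop extends IsFactorization cs ω ts where
  isNonacute : IsNonacute cs ts
  not_commEquiv : ¬ CommEquiv ts (ω.map cs.simple)

theorem IsExotic.rotate (h : IsExotic cs (i :: ω) ts) (hi : cs.simple i ∉ ts) :
    IsExotic cs (ω ++ [i]) (conjWord cs i ts) where
  toIsFactorization := h.toIsFactorization.rotate
  isNonacute := h.isNonacute.conjWord h.isReflection hi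
  not_commEquiv hc := by
    refine simple_notMem_conjWord cs hi ((perm_of_commEquiv hc).mem_iff.mpr ?_)
    exact List.mem_map_of_mem (List.mem_append_right ω List.mem_cons_self)

theorem geom_inv_wordProd_pow_mem_supp {x : B →₀ ℝ} (hx : x ∈ supp ω) (k : ℕ) :
    geom cs ((cs.wordProd ω)⁻¹ ^ k) x ∈ supp ω := by
  induction k with
  | zero => rwa [pow_zero, geom_one_apply]
  | succ k ih =>
    rw [pow_succ', geom_mul_apply, Finsupp.mem_supported']
    intro j hj
    rw [geom_wordProd_inv_apply_of_notMem cs hj, apply_eq_zero_of_mem_supp ih hj]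

variable [Finite W] {l₁ l₂ : List W}

theorem IsFactorization.move_front (h : IsFactorization cs (i :: ω) (l₁ ++ cs.simple i :: l₂))
    (hω : (i :: ω).Nodup) (hp : IsNonacute cs (l₁ ++ cs.simple i :: l₂)) :
    CommEquiv (l₁ ++ cs.simple i :: l₂) (cs.simple i :: (l₁ ++ l₂)) := by
  refine commEquiv_move_front l₂ fun t ht => ?_
  have hmem : t ∈ l₁ ++ cs.simple i :: l₂ := List.mem_append_left _ ht
  have hr := h.isReflection t hmem
  refine commute_of_cosForm_eq_zero hr (cs.isReflection_simple i) ?_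
  have heuler := ((List.pairwise_append.mp (h.pairwise hω)).2.2 t ht _ List.mem_cons_self).2
  have hcos := (List.pairwise_append.mp hp).2.2 t ht _ List.mem_cons_self
  rw [root_simple] at heuler hcos ⊢
  have hadd := euler_add_euler M (i :: ω) (root cs t) (simpleRoot i)
  rw [restr_eq_self hω (h.root_mem_supp hω hmem),
    restr_eq_self hω (simpleRoot_mem_supp List.mem_cons_self), heuler,
    euler_cons_simpleRoot M (List.nodup_cons.mp hω).1] at hadd
  have hcoord : 0 ≤ root cs t i := root_nonneg hr i
  linarith

theorem IsFactorization.move_back (h : IsFactorization cs (i :: ω) (l₁ ++ cs.simple i :: l₂))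
    (hω : (i :: ω).Nodup) (hp : IsNonobtuse cs (l₁ ++ cs.simple i :: l₂)) :
    CommEquiv (l₁ ++ cs.simple i :: l₂) (l₁ ++ l₂ ++ [cs.simple i]) := by
  refine commEquiv_move_back l₁ fun t ht => ?_
  have hr := h.isReflection t (List.mem_append_right _ (List.mem_cons_of_mem _ ht))
  refine commute_of_cosForm_eq_zero (cs.isReflection_simple i) hr ?_
  have heuler := ((List.pairwise_cons.mp (List.pairwise_append.mp (h.pairwise hω)).2.1).1 t ht).2
  have hcos := (List.pairwise_cons.mp (List.pairwise_append.mp hp).2.1).1 t ht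
  rw [root_simple] at heuler hcos ⊢
  rw [euler_cons_simpleRoot M (List.nodup_cons.mp hω).1] at heuler
  exact le_antisymm (cosForm_simpleRoot_nonpos_of_nonneg M (root_nonneg hr) heuler) hcos

theorem IsFactorization.move_front_of_concat
    (h : IsFactorization cs (ω ++ [i]) (l₁ ++ cs.simple i :: l₂)) (hω : (ω ++ [i]).Nodup)
    (hp : IsNonobtuse cs (l₁ ++ cs.simple i :: l₂)) :
    CommEquiv (l₁ ++ cs.simple i :: l₂) (cs.simple i :: (l₁ ++ l₂)) := by
  refine commEquiv_move_front l₂ fun t ht => ?_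
  have hr := h.isReflection t (List.mem_append_left _ ht)
  refine (commute_of_cosForm_eq_zero (cs.isReflection_simple i) hr ?_).symm
  have heuler := ((List.pairwise_append.mp (h.pairwise hω)).2.2 t ht _ List.mem_cons_self).2
  have hcos := (List.pairwise_append.mp hp).2.2 t ht _ List.mem_cons_self
  rw [root_simple] at heuler hcos ⊢
  rw [euler_concat_simpleRoot M ((List.nodup_cons (l := ω)).mp (List.nodup_append_comm.mp hω)).1]
    at heuler
  rw [cosForm_symm] at hcos
  exact le_antisymm (cosForm_simpleRoot_nonpos_of_nonneg M (root_nonneg hr) heuler) hcos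

theorem eq_zero_of_geom_inv_wordProd_pow_nonneg (h : ω.Nodup) {x : B →₀ ℝ} (hx : x ∈ supp ω)
    (hpos : ∀ k : ℕ, 0 ≤ geom cs ((cs.wordProd ω)⁻¹ ^ k) x) : x = 0 := by
  set c := (cs.wordProd ω)⁻¹
  -- the sum over the `c`-orbit of `x` is fixed by `c`, hence zero
  have hfix : geom cs c (∑ k ∈ Finset.range (orderOf c), geom cs (c ^ k) x) =
      ∑ k ∈ Finset.range (orderOf c), geom cs (c ^ k) x := by
    simp only [map_sum, ← geom_mul_apply, ← pow_succ']
    have hshift := Finset.sum_range_succ (fun k => geom cs (c ^ k) x) (orderOf c)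
    rw [Finset.sum_range_succ', pow_zero, pow_orderOf_eq_one] at hshift
    exact add_right_cancel hshift
  have hsum := eq_zero_of_geom_inv_wordProd_eq h
    (Submodule.sum_mem _ fun k _ => geom_inv_wordProd_pow_mem_supp hx k) hfix
  have hzero := (Finset.sum_eq_zero_iff_of_nonneg fun k _ => hpos k).mp hsum 0
    (Finset.mem_range.mpr (orderOf_pos c))
  rwa [pow_zero, geom_one_apply] at hzero

theorem IsExotic.simple_notMem (h : IsExotic cs (i :: ω) ts) (hω : (i :: ω).Nodup)
    (hmin : ∀ ts', ¬ IsExotic cs ω ts') : cs.simple i ∉ ts := by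
  intro hmem
  obtain ⟨l₁, l₂, rfl⟩ := List.append_of_mem hmem
  have hc := h.move_front hω h.isNonacute
  refine hmin (l₁ ++ l₂) ⟨h.of_commEquiv_cons hc,
    (List.pairwise_cons.mp (h.isNonacute.perm (perm_of_commEquiv hc))).2, fun hc' => ?_⟩
  exact h.not_commEquiv (commEquiv_trans hc (commEquiv_cons _ hc'))

theorem IsExotic.exists_geom_inv {ω₁ ω₂ : List B} {t : W} (h : IsExotic cs (ω₁ ++ ω₂) ts)
    (hω : (ω₁ ++ ω₂).Nodup) (hmin : ∀ ω' ts', ω'.length < (ω₁ ++ ω₂).length → ω'.Nodup →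
      ¬ IsExotic cs ω' ts') (ht : t ∈ ts) :
    ∃ ts' t', IsExotic cs (ω₂ ++ ω₁) ts' ∧ t' ∈ ts' ∧
      root cs t' = geom cs (cs.wordProd ω₁)⁻¹ (root cs t) := by
  induction ω₁ generalizing ω₂ ts t with
  | nil => exact ⟨ts, t, by rwa [List.append_nil], ht, by simp⟩
  | cons i ω₁ ih =>
    rw [List.cons_append] at h hω hmin
    have hi := h.simple_notMem hω fun ts' =>
      hmin _ ts' (Nat.lt_succ_self _) (List.nodup_cons.mp hω).2
    have hrot := h.rotate hi
    rw [List.append_assoc] at hrot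
    obtain ⟨ts', t', h', ht', hroot⟩ := ih hrot
      (by rw [← List.append_assoc]; exact List.nodup_append_comm.mp hω)
      (fun ω' ts' hlen => hmin ω' ts' (by simpa [Nat.add_assoc] using hlen))
      ((mem_conjWord cs).mpr ⟨t, ht, rfl⟩)
    rw [List.append_assoc, List.singleton_append] at h'
    refine ⟨ts', t', h', ht', ?_⟩
    rw [hroot, root_conj_simple (h.isReflection t ht) (ne_of_mem_of_not_mem ht hi),
      wordProd_cons, mul_inv_rev, geom_mul_apply, inv_simple]

theorem IsExotic.exists_geom_inv_pow {t : W} (h : IsExotic cs ω ts) (hω : ω.Nodup)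
    (hmin : ∀ ω' ts', ω'.length < ω.length → ω'.Nodup → ¬ IsExotic cs ω' ts') (ht : t ∈ ts)
    (k : ℕ) : ∃ ts' t', IsExotic cs ω ts' ∧ t' ∈ ts' ∧
      root cs t' = geom cs ((cs.wordProd ω)⁻¹ ^ k) (root cs t) := by
  induction k with
  | zero => exact ⟨ts, t, h, ht, by rw [pow_zero, geom_one_apply]⟩
  | succ k ih =>
    obtain ⟨ts', t', h', ht', hroot⟩ := ih
    rw [← List.append_nil ω] at h' hω hmin
    obtain ⟨ts'', t'', h'', ht'', hroot'⟩ := h'.exists_geom_inv hω hmin ht'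
    exact ⟨ts'', t'', h'', ht'', by rw [hroot', hroot, pow_succ', geom_mul_apply]⟩

theorem not_isExotic (hω : ω.Nodup) : ¬ IsExotic cs ω ts := by
  induction hn : ω.length using Nat.strong_induction_on generalizing ω ts with
  | _ n ih =>
    subst hn
    intro h
    rcases eq_or_ne ts [] with rfl | hne
    · have hnil : ω = [] := List.length_eq_zero_iff.mp h.length_eq.symm
      subst hnil
      exact h.not_commEquiv (commEquiv_refl [])
    obtain ⟨t, ht⟩ := List.exists_mem_of_ne_nil ts hne
    refine (isRoot_root (h.isReflection t ht)).ne_zero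
      (eq_zero_of_geom_inv_wordProd_pow_nonneg (cs := cs) hω (h.root_mem_supp hω ht) fun k => ?_)
    obtain ⟨ts', t', h', ht', hroot⟩ :=
      h.exists_geom_inv_pow hω (fun ω' ts' hlen hω' => ih _ hlen hω' rfl) ht k
    rw [← hroot]
    exact root_nonneg (h'.isReflection t' ht')

theorem IsFactorization.commEquiv_of_isNonacute (h : IsFactorization cs ω ts) (hω : ω.Nodup)
    (hp : IsNonacute cs ts) : CommEquiv ts (ω.map cs.simple) := by
  by_contra hc
  exact not_isExotic hω ⟨h, hp, hc⟩

end Rotation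

section Ascent

variable {B W : Type*} [Group W] {M : CoxeterMatrix B} (cs : CoxeterSystem M W)

/-- Every step of the path `u, u t₁, u t₁ t₂, …` goes up in length, expressed through the positive
roots of the reflections `t₁, t₂, …`. -/
def IsUp (u : W) : List W → Prop
  | [] => True
  | t :: ts => 0 ≤ geom cs u (root cs t) ∧ IsUp (u * t) ts

variable {cs} {u : W} {i : B} {ω : List B} {ts ts' : List W}

theorem isUp_append {l₁ l₂ : List W} :
    IsUp cs u (l₁ ++ l₂) ↔ IsUp cs u l₁ ∧ IsUp cs (u * l₁.prod) l₂ := by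
  induction l₁ generalizing u with
  | nil => simp [IsUp]
  | cons t l₁ ih => simp [IsUp, ih, and_assoc, mul_assoc]

theorem isUp_concat_simple {l : List W} :
    IsUp cs u (l ++ [cs.simple i]) ↔
      IsUp cs u l ∧ cs.length (u * l.prod) < cs.length (u * l.prod * cs.simple i) := by
  rw [isUp_append, lt_length_mul_iff (cs.isReflection_simple i)]
  exact and_congr_right fun _ => and_iff_left trivial

theorem IsUp.length_le (h : IsUp cs u ts) (hts : ∀ t ∈ ts, cs.IsReflection t) :
    cs.length u + ts.length ≤ cs.length (u * ts.prod) := by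
  induction ts generalizing u with
  | nil => simp
  | cons t ts ih =>
    rw [List.forall_mem_cons] at hts
    have hstep := (lt_length_mul_iff hts.1 u).mpr h.1
    have hrest := ih h.2 hts.2
    rw [List.prod_cons, ← mul_assoc, List.length_cons]
    omega

theorem IsUp.swap {s t : W} {l : List W} (h : IsUp cs u (s :: t :: l)) (hs : cs.IsReflection s)
    (ht : cs.IsReflection t) (hst : s * t = t * s) : IsUp cs u (t :: s :: l) := by
  rcases eq_or_ne s t with rfl | hne
  · exact h
  have horth := cosForm_eq_zero_of_commute hs ht hne hst
  have horth' : cosForm M (root cs t) (root cs s) = 0 := by rw [cosForm_symm, horth]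
  obtain ⟨hus, hut, hl⟩ := h
  rw [geom_mul_apply, geom_reflection_apply hs, horth, mul_zero, zero_smul, sub_zero] at hut
  refine ⟨hut, ?_, ?_⟩
  · rwa [geom_mul_apply, geom_reflection_apply ht, horth', mul_zero, zero_smul, sub_zero]
  · rwa [mul_assoc, ← hst, ← mul_assoc]

theorem IsUp.of_commEquiv (h : IsUp cs u ts) (hc : CommEquiv ts ts')
    (hts : ∀ t ∈ ts, cs.IsReflection t) : IsUp cs u ts' := by
  let P (l : List W) : Prop := (∀ t ∈ l, cs.IsReflection t) ∧ IsUp cs u l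
  have hP (l₁ l₂ : List W) (s t : W) (hst : s * t = t * s)
      (hl : P (l₁ ++ s :: t :: l₂)) : P (l₁ ++ t :: s :: l₂) := by
    obtain ⟨hrefl, hup⟩ := hl
    have hswap := (List.Perm.swap s t l₂).append_left l₁
    refine ⟨fun x hx => hrefl x (hswap.mem_iff.mp hx), ?_⟩
    rw [isUp_append] at hup ⊢
    exact ⟨hup.1, hup.2.swap (hrefl s (by simp)) (hrefl t (by simp)) hst⟩
  have hiff : P ts = P ts' := rel_of_commEquiv (r := fun l l' => P l = P l')
    (eq_equivalence.comap P)
    (fun l₁ l₂ s t hst => propext ⟨hP l₁ l₂ s t hst, hP l₁ l₂ t s hst.symm⟩) hc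
  exact (hiff.mp ⟨hts, h⟩).2

theorem IsUp.conjWord (h : IsUp cs u ts) (hts : ∀ t ∈ ts, cs.IsReflection t)
    (hi : cs.simple i ∉ ts) : IsUp cs (u * cs.simple i) (conjWord cs i ts) := by
  induction ts generalizing u with
  | nil => exact trivial
  | cons t ts ih =>
    rw [List.forall_mem_cons] at hts
    rw [List.mem_cons, not_or] at hi
    rw [conjWord_cons]
    refine ⟨?_, ?_⟩
    · rw [root_conj_simple hts.1 (Ne.symm hi.1), ← geom_mul_apply, simple_mul_simple_cancel_right]
      exact h.1
    · rw [mul_assoc (cs.simple i), ← mul_assoc, simple_mul_simple_cancel_right, ← mul_assoc]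
      exact ih h.2 hts.2 hi.2

variable (cs) in
/-- An upward factorization whose positive roots make pairwise nonobtuse angles. -/
structure IsNonobtuseUp (ω : List B) (u : W) (ts : List W) : Prop
    extends IsFactorization cs ω ts where
  isUp : IsUp cs u ts
  isNonobtuse : IsNonobtuse cs ts

theorem IsNonobtuseUp.rotate (h : IsNonobtuseUp cs (i :: ω) u ts) (hi : cs.simple i ∉ ts) :
    IsNonobtuseUp cs (ω ++ [i]) (u * cs.simple i) (conjWord cs i ts) where
  toIsFactorization := h.toIsFactorization.rotate
  isUp := h.isUp.conjWord h.isReflection hi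
  isNonobtuse := h.isNonobtuse.conjWord h.isReflection hi

theorem IsNonobtuseUp.rotate_symm (h : IsNonobtuseUp cs (ω ++ [i]) (u * cs.simple i) ts)
    (hi : cs.simple i ∉ ts) : IsNonobtuseUp cs (i :: ω) u (conjWord cs i ts) where
  toIsFactorization := h.toIsFactorization.rotate_symm
  isUp := by simpa only [simple_mul_simple_cancel_right] using h.isUp.conjWord h.isReflection hi
  isNonobtuse := h.isNonobtuse.conjWord h.isReflection hi

variable [Finite W]

theorem IsNonobtuseUp.exists_commEquiv_concat (h : IsNonobtuseUp cs (i :: ω) u ts)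
    (hω : (i :: ω).Nodup) (hi : cs.simple i ∈ ts) :
    ∃ l, CommEquiv ts (l ++ [cs.simple i]) ∧ IsUp cs u (l ++ [cs.simple i]) ∧
      IsNonobtuseUp cs ω (u * cs.simple i) (conjWord cs i l) := by
  obtain ⟨l₁, l₂, rfl⟩ := List.append_of_mem hi
  have hc := h.move_back hω h.isNonobtuse
  have hperm := perm_of_commEquiv hc
  have hup := h.isUp.of_commEquiv hc h.isReflection
  have hnot : cs.simple i ∉ l₁ ++ l₂ := fun hmem =>
    (List.nodup_append.mp (hperm.nodup_iff.mp (h.nodup hω))).2.2 _ hmem _ List.mem_cons_self rfl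
  have hrefl (t) (ht : t ∈ l₁ ++ l₂) : cs.IsReflection t :=
    h.isReflection t (hperm.mem_iff.mpr (List.mem_append_left _ ht))
  refine ⟨l₁ ++ l₂, hc, hup, ⟨isReflection_of_mem_conjWord hrefl, ?_, ?_⟩,
    (isUp_append.mp hup).1.conjWord hrefl hnot,
    IsNonobtuse.conjWord (List.pairwise_append.mp (h.isNonobtuse.perm hperm)).1 hrefl hnot⟩
  · have hprod := prod_eq_of_commEquiv hc
    rw [h.prod_eq, wordProd_cons, List.prod_append, List.prod_singleton] at hprod
    rw [prod_conjWord, mul_assoc, ← hprod, simple_mul_simple_cancel_left]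
  · have hlen := hperm.length_eq
    rw [h.length_eq, List.length_append, List.length_singleton] at hlen
    rw [length_conjWord]
    exact (Nat.succ.inj hlen).symm

omit [Finite W] in
theorem cosForm_root_conj_simple_nonneg {t : W} (ht : cs.IsReflection t)
    (hzero : root cs t i = 0) (hne : t ≠ cs.simple i) :
    0 ≤ cosForm M (root cs (cs.simple i * t * cs.simple i)) (simpleRoot i) := by
  rw [root_conj_simple ht hne, ← cosForm_geom cs (cs.simple i), ← geom_mul_apply,
    simple_mul_simple_self, geom_one_apply, geom_simple_simpleRoot, map_neg, cosForm_symm,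
    neg_nonneg]
  exact cosForm_simpleRoot_nonpos_of_nonneg M (root_nonneg ht) hzero

theorem IsNonobtuseUp.concat (h : IsNonobtuseUp cs ω (u * cs.simple i) ts)
    (hω : (i :: ω).Nodup)
    (hlt : cs.length (u * cs.wordProd (i :: ω) * cs.simple i) <
      cs.length (u * cs.wordProd (i :: ω))) :
    IsNonobtuseUp cs (i :: ω) u (conjWord cs i ts ++ [cs.simple i]) := by
  rw [List.nodup_cons] at hω
  have hzero (t) (ht : t ∈ ts) : root cs t i = 0 :=
    apply_eq_zero_of_mem_supp (h.root_mem_supp hω.2 ht) hω.1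
  have hnot : cs.simple i ∉ ts := fun hmem => by
    have hone := hzero _ hmem
    rw [root_simple, simpleRoot_self] at hone
    exact one_ne_zero hone
  have hprod : (conjWord cs i ts).prod = cs.wordProd (i :: ω) * cs.simple i := by
    rw [prod_conjWord, h.prod_eq, wordProd_cons]
  refine ⟨⟨?_, ?_, ?_⟩, ?_, ?_⟩
  · rw [List.forall_mem_append, List.forall_mem_singleton]
    exact ⟨isReflection_of_mem_conjWord h.isReflection, cs.isReflection_simple i⟩
  · rw [List.prod_append, List.prod_singleton, hprod, simple_mul_simple_cancel_right]
  · rw [List.length_append, length_conjWord, h.length_eq]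
    rfl
  · rw [isUp_concat_simple, hprod, ← mul_assoc, simple_mul_simple_cancel_right]
    exact ⟨by simpa only [simple_mul_simple_cancel_right] using
      h.isUp.conjWord h.isReflection hnot, hlt⟩
  · refine List.pairwise_append.mpr ⟨h.isNonobtuse.conjWord h.isReflection hnot,
      List.pairwise_singleton _ _, fun t ht s hs => ?_⟩
    obtain ⟨t', ht', rfl⟩ := (mem_conjWord cs).mp ht
    rw [List.mem_singleton.mp hs, root_simple]
    exact cosForm_root_conj_simple_nonneg (h.isReflection t' ht') (hzero t' ht')
      (ne_of_mem_of_not_mem ht' hnot)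

theorem IsNonobtuseUp.simple_notMem_of_concat
    (h : IsNonobtuseUp cs (ω ++ [i]) (u * cs.simple i) ts) (hω : (ω ++ [i]).Nodup)
    (hlt : cs.length u < cs.length (u * cs.simple i)) : cs.simple i ∉ ts := by
  intro hmem
  obtain ⟨l₁, l₂, rfl⟩ := List.append_of_mem hmem
  have hc := h.move_front_of_concat hω h.isNonobtuse
  have hdown := (h.isUp.of_commEquiv hc h.isReflection).1
  rw [← lt_length_mul_iff (cs.isReflection_simple i), simple_mul_simple_cancel_right] at hdown
  omega

theorem IsNonobtuseUp.simple_mem_iff (h : IsNonobtuseUp cs (i :: ω) u ts) (hω : (i :: ω).Nodup)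
    (hlen : cs.length (u * cs.wordProd (i :: ω)) = cs.length u + (i :: ω).length)
    (hlt : cs.length u < cs.length (u * cs.simple i)) :
    cs.simple i ∈ ts ↔ cs.length (u * cs.wordProd (i :: ω) * cs.simple i) <
      cs.length (u * cs.wordProd (i :: ω)) := by
  constructor
  · intro hmem
    obtain ⟨l, hc, hup, -⟩ := h.exists_commEquiv_concat hω hmem
    have hprod := prod_eq_of_commEquiv hc
    rw [h.prod_eq, List.prod_append, List.prod_singleton] at hprod
    rw [hprod, ← mul_assoc, simple_mul_simple_cancel_right]
    exact (isUp_concat_simple.mp hup).2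
  · intro hdown
    by_contra hnot
    have hrot := h.rotate hnot
    have hle := hrot.isUp.length_le hrot.isReflection
    rw [hrot.prod_eq, hrot.length_eq, wordProd_append, wordProd_singleton, ← mul_assoc,
      mul_assoc u, ← wordProd_cons, List.length_append] at hle
    simp only [List.length_cons, List.length_nil] at hle hlen
    omega

/-- Up to commutations, exactly one word satisfies `P`. -/
def ExistsUniqueUpToComm (P : List W → Prop) : Prop :=
  ∃ ts, P ts ∧ ∀ ts', P ts' → CommEquiv ts' ts

omit [Finite W] in
theorem length_lt_length_mul_simple
    (hlen : cs.length (u * cs.wordProd (i :: ω)) = cs.length u + (i :: ω).length) :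
    cs.length u < cs.length (u * cs.simple i) := by
  have hmul := cs.length_mul_le (u * cs.simple i) (cs.wordProd ω)
  have hword := cs.length_wordProd_le ω
  rw [mul_assoc, ← wordProd_cons, hlen, List.length_cons] at hmul
  omega

theorem existsUnique_isNonobtuseUp_of_rotate (hω : (i :: ω).Nodup)
    (hlen : cs.length (u * cs.wordProd (i :: ω)) = cs.length u + (i :: ω).length)
    (hup : cs.length (u * cs.wordProd (i :: ω)) <
      cs.length (u * cs.wordProd (i :: ω) * cs.simple i))
    (h : ExistsUniqueUpToComm (IsNonobtuseUp cs (ω ++ [i]) (u * cs.simple i))) :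
    ExistsUniqueUpToComm (IsNonobtuseUp cs (i :: ω) u) := by
  have hlt := length_lt_length_mul_simple hlen
  obtain ⟨ts, hts, huniq⟩ := h
  refine ⟨conjWord cs i ts,
    hts.rotate_symm (hts.simple_notMem_of_concat (List.nodup_append_comm.mp hω) hlt),
    fun ts' hts' => commEquiv_conjWord (huniq _ (hts'.rotate fun hmem => ?_))⟩
  exact hup.not_gt ((hts'.simple_mem_iff hω hlen hlt).mp hmem)

theorem existsUnique_isNonobtuseUp_of_tail (hω : (i :: ω).Nodup)
    (hlen : cs.length (u * cs.wordProd (i :: ω)) = cs.length u + (i :: ω).length)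
    (hdown : cs.length (u * cs.wordProd (i :: ω) * cs.simple i) <
      cs.length (u * cs.wordProd (i :: ω)))
    (h : ExistsUniqueUpToComm (IsNonobtuseUp cs ω (u * cs.simple i))) :
    ExistsUniqueUpToComm (IsNonobtuseUp cs (i :: ω) u) := by
  have hlt := length_lt_length_mul_simple hlen
  obtain ⟨ts, hts, huniq⟩ := h
  refine ⟨_, hts.concat hω hdown, fun ts' hts' => ?_⟩
  obtain ⟨l, hc, -, hl⟩ :=
    hts'.exists_commEquiv_concat hω ((hts'.simple_mem_iff hω hlen hlt).mpr hdown)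
  exact commEquiv_trans hc (commEquiv_append_right _ (commEquiv_conjWord (huniq _ hl)))

omit [Finite W] in
theorem existsUnique_isNonobtuseUp_nil : ExistsUniqueUpToComm (IsNonobtuseUp cs [] u) := by
  refine ⟨[], ⟨⟨by simp, rfl, rfl⟩, trivial, List.Pairwise.nil⟩, fun ts hts => ?_⟩
  rw [List.eq_nil_of_length_eq_zero hts.length_eq]
  exact commEquiv_refl _

/-- Each reduction either keeps the number of letters of `ω` and lengthens `u`, or removes a letter
from `ω`. -/
theorem existsUnique_isNonobtuseUp {ω : List B} {u : W} (hω : ω.Nodup)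
    (hlen : cs.length (u * cs.wordProd ω) = cs.length u + ω.length) :
    ExistsUniqueUpToComm (IsNonobtuseUp cs ω u) := by
  match ω, hω, hlen with
  | [], _, _ => exact existsUnique_isNonobtuseUp_nil
  | i :: ω, hω, hlen =>
    have hlt := length_lt_length_mul_simple hlen
    have hlen' : cs.length (u * cs.simple i) = cs.length u + 1 := by
      rcases cs.length_mul_simple u i with h | h <;> omega
    have hbound := le_csSup (Set.finite_range cs.length).bddAbove
      (Set.mem_range_self (u * cs.simple i))
    rw [List.length_cons] at hlen
    rcases cs.length_mul_simple (u * cs.wordProd (i :: ω)) i with hup | hdown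
    · refine existsUnique_isNonobtuseUp_of_rotate hω hlen (by omega)
        (existsUnique_isNonobtuseUp (List.nodup_append_comm.mp hω) ?_)
      rw [wordProd_append, wordProd_singleton, ← mul_assoc, mul_assoc u, ← wordProd_cons, hup,
        hlen, hlen', List.length_append, List.length_singleton]
      omega
    · refine existsUnique_isNonobtuseUp_of_tail hω hlen (by omega)
        (existsUnique_isNonobtuseUp (List.nodup_cons.mp hω).2 ?_)
      rw [mul_assoc, ← wordProd_cons, hlen, hlen']
      omega
termination_by (ω.length, sSup (Set.range cs.length) - cs.length u)
decreasing_by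
  · simp only [List.length_append, List.length_cons, List.length_nil, zero_add]
    exact Prod.Lex.right _ (by omega)
  · exact Prod.Lex.left _ _ (Nat.lt_succ_self _)

end Ascent

section SkewForm

variable {B : Type*}

/-- A word in which every letter occurs exactly once; its product is a standard Coxeter element. -/
structure IsCoxeterWord (ω : List B) : Prop where
  nodup : ω.Nodup
  mem (i : B) : i ∈ ω

variable {i : B} {ω : List B} {x x' y : B →₀ ℝ}

theorem IsCoxeterWord.rotate (h : IsCoxeterWord (i :: ω)) : IsCoxeterWord (ω ++ [i]) where
  nodup := List.nodup_append_comm.mp h.nodup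
  mem j := by simpa [or_comm] using h.mem j

theorem IsCoxeterWord.notMem (h : IsCoxeterWord (i :: ω)) : i ∉ ω :=
  (List.nodup_cons.mp h.nodup).1

theorem IsCoxeterWord.mem_supp (h : IsCoxeterWord ω) (x : B →₀ ℝ) : x ∈ supp ω :=
  (Finsupp.mem_supported ℝ x).mpr fun j _ => h.mem j

theorem IsCoxeterWord.restr_eq (h : IsCoxeterWord ω) (x : B →₀ ℝ) : restr ω x = x :=
  restr_eq_self h.nodup (h.mem_supp x)

variable (M : CoxeterMatrix B)

/-- The skew form of a word: the antisymmetrization of its Euler form. -/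
noncomputable def skew (ω : List B) : LinearMap.BilinForm ℝ (B →₀ ℝ) :=
  euler M ω - (euler M ω).flip

theorem skew_apply (ω : List B) (x y : B →₀ ℝ) :
    skew M ω x y = euler M ω x y - euler M ω y x := rfl

theorem skew_swap (ω : List B) (x y : B →₀ ℝ) : skew M ω y x = -skew M ω x y := by
  rw [skew_apply, skew_apply, neg_sub]

/-- The skew form is nonnegative on the pair, and positive unless the pair is orthogonal. -/
def SkewLE (ω : List B) (x y : B →₀ ℝ) : Prop :=
  0 ≤ skew M ω x y ∧ (skew M ω x y = 0 → cosForm M x y = 0)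

variable {M}

theorem SkewLE.add_smul {a : ℝ} (ha : 0 ≤ a) (h : SkewLE M ω x y) (h' : SkewLE M ω x' y) :
    SkewLE M ω (x + a • x') y := by
  rcases ha.eq_or_lt with rfl | ha
  · rwa [zero_smul, add_zero]
  have hskew : skew M ω (x + a • x') y = skew M ω x y + a * skew M ω x' y := by simp
  have hnonneg := mul_nonneg ha.le h'.1
  refine ⟨hskew ▸ add_nonneg h.1 hnonneg, fun hzero => ?_⟩
  rw [hskew, add_eq_zero_iff_of_nonneg h.1 hnonneg, mul_eq_zero] at hzero
  simp [h.2 hzero.1, h'.2 (hzero.2.resolve_left ha.ne')]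

theorem skew_cons_simpleRoot (hω : IsCoxeterWord (i :: ω)) (y : B →₀ ℝ) :
    skew M (i :: ω) (simpleRoot i) y = 2 * (y i - cosForm M (simpleRoot i) y) := by
  have hsum := euler_add_euler M (i :: ω) (simpleRoot i) y
  have hleft := euler_cons_simpleRoot M hω.notMem y
  rw [hω.restr_eq, hω.restr_eq] at hsum
  rw [skew_apply]
  linarith

theorem skew_concat_simpleRoot (hω : IsCoxeterWord (i :: ω)) (y : B →₀ ℝ) :
    skew M (ω ++ [i]) (simpleRoot i) y = -(2 * (y i - cosForm M (simpleRoot i) y)) := by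
  have hsum := euler_add_euler M (ω ++ [i]) (simpleRoot i) y
  have hright := euler_concat_simpleRoot M hω.notMem y
  rw [hω.rotate.restr_eq, hω.rotate.restr_eq] at hsum
  rw [skew_apply]
  linarith

variable (M) in
theorem cosForm_simpleRoot_le (hy : 0 ≤ y) : cosForm M (simpleRoot i) y ≤ y i := by
  have hrest : 0 ≤ y - y i • simpleRoot i := fun j => by
    by_cases hj : j = i
    · simp [hj]
    · simpa [simpleRoot_of_ne hj] using hy j
  have hle := cosForm_simpleRoot_nonpos_of_nonneg M hrest (i := i) (by simp)
  rw [map_sub, map_smul, cosForm_simpleRoot_self, smul_eq_mul, mul_one] at hle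
  linarith

theorem skew_cons_eq_skew_concat (hx : x i = 0) (hy : y i = 0) :
    skew M (i :: ω) x y = skew M (ω ++ [i]) x y := by
  simp only [skew_apply, euler_cons, euler_concat, hx, hy, mul_zero, zero_mul]

variable {W : Type*} [Group W] (cs : CoxeterSystem M W)

theorem skew_rotate (hω : IsCoxeterWord (i :: ω)) (x y : B →₀ ℝ) :
    skew M (i :: ω) (geom cs (cs.simple i) x) (geom cs (cs.simple i) y) =
      skew M (ω ++ [i]) x y := by
  have hrot (x y) := euler_rotate cs hω.nodup (hω.mem_supp x) (hω.mem_supp y)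
  simp only [skew_apply, ← hrot, ← geom_mul_apply, simple_mul_simple_self, geom_one_apply]

variable {cs}

theorem skewLE_rotate (hω : IsCoxeterWord (i :: ω)) :
    SkewLE M (i :: ω) (geom cs (cs.simple i) x) (geom cs (cs.simple i) y) ↔
      SkewLE M (ω ++ [i]) x y := by
  rw [SkewLE, SkewLE, skew_rotate cs hω, cosForm_geom]

theorem IsRoot.skewLE_simpleRoot (hy : IsRoot cs y) (hω : IsCoxeterWord (i :: ω)) (h0 : 0 ≤ y)
    (hne : y ≠ simpleRoot i) : SkewLE M (i :: ω) (simpleRoot i) y := by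
  have hle := cosForm_simpleRoot_le M (i := i) h0
  rw [SkewLE, skew_cons_simpleRoot hω]
  refine ⟨by linarith, fun hzero => ?_⟩
  have hrefl : 0 ≤ NoncrossingChains.geom cs (cs.simple i) y i := hy.geom_simple_nonneg h0 hne i
  have hi : 0 ≤ y i := h0 i
  rw [geom_simple_apply] at hrefl
  simp only [Finsupp.sub_apply, Finsupp.smul_apply, simpleRoot_self, smul_eq_mul] at hrefl
  linarith

end SkewForm

section RootSequence

variable {B W : Type*} [Group W] {M : CoxeterMatrix B} {cs : CoxeterSystem M W}
variable {η η₁ η₂ : List B} {i j : B} {r y : B →₀ ℝ}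

theorem isReduced_left_of_append (h : cs.IsReduced (η₁ ++ η₂)) : cs.IsReduced η₁ := by
  simpa only [List.take_left'] using h.take η₁.length

theorem isReduced_right_of_append (h : cs.IsReduced (η₁ ++ η₂)) : cs.IsReduced η₂ := by
  simpa only [List.drop_left'] using h.drop η₁.length

theorem isReduced_of_cons (h : cs.IsReduced (i :: η)) : cs.IsReduced η :=
  isReduced_right_of_append (η₁ := [i]) h

theorem isLeftDescent_of_isReduced_cons (h : cs.IsReduced (i :: η)) :
    cs.IsLeftDescent (cs.wordProd (i :: η)) i := by
  rw [IsLeftDescent, wordProd_cons, simple_mul_simple_cancel_left, ← wordProd_cons,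
    (isReduced_of_cons h).eq, h.eq]
  exact Nat.lt_succ_self _

variable (cs) in
/-- The roots `s₁ ⋯ sₖ₋₁ αₖ` of a word `s₁ s₂ ⋯`; if the word is reduced, then these are the
positive roots of its left inversion sequence. -/
noncomputable def rootSeq : List B → List (B →₀ ℝ)
  | [] => []
  | i :: η => simpleRoot i :: (rootSeq η).map (geom cs (cs.simple i))

theorem rootSeq_append (η₁ η₂ : List B) :
    rootSeq cs (η₁ ++ η₂) =
      rootSeq cs η₁ ++ (rootSeq cs η₂).map (geom cs (cs.wordProd η₁)) := by
  induction η₁ with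
  | nil => simp [rootSeq]
  | cons i η₁ ih =>
    simp only [List.cons_append, rootSeq, ih, List.map_append, List.map_map, wordProd_cons]
    congr 3
    funext x
    rw [Function.comp_apply, geom_mul_apply]

theorem rootSeq_concat (η : List B) (j : B) :
    rootSeq cs (η ++ [j]) = rootSeq cs η ++ [geom cs (cs.wordProd η) (simpleRoot j)] := by
  rw [rootSeq_append]
  rfl

theorem exists_of_mem_rootSeq (h : r ∈ rootSeq cs η) :
    ∃ η₁ j η₂, η = η₁ ++ j :: η₂ ∧ r = geom cs (cs.wordProd η₁) (simpleRoot j) := by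
  induction η generalizing r with
  | nil => exact absurd h List.not_mem_nil
  | cons i η ih =>
    rw [rootSeq, List.mem_cons, List.mem_map] at h
    rcases h with rfl | ⟨r', h', rfl⟩
    · exact ⟨[], i, η, rfl, by simp⟩
    · obtain ⟨η₁, j, η₂, rfl, rfl⟩ := ih h'
      exact ⟨i :: η₁, j, η₂, rfl, by rw [wordProd_cons, geom_mul_apply]⟩

theorem geom_wordProd_nonneg_of_isReduced (h : cs.IsReduced (η ++ [j])) :
    0 ≤ geom cs (cs.wordProd η) (simpleRoot j) := by
  refine geom_simpleRoot_nonneg (not_isRightDescent_of_length_eq (η := []) ?_)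
  rw [← wordProd_append, h.eq, (isReduced_left_of_append h).eq, List.length_append]

theorem rootSeq_spec (hη : cs.IsReduced η) (h : r ∈ rootSeq cs η) :
    IsRoot cs r ∧ 0 ≤ r ∧ geom cs (cs.wordProd η)⁻¹ r ≤ 0 := by
  obtain ⟨η₁, j, η₂, rfl, rfl⟩ := exists_of_mem_rootSeq h
  refine ⟨⟨_, _, rfl⟩, ?_, ?_⟩
  · rw [List.append_cons] at hη
    exact geom_wordProd_nonneg_of_isReduced (isReduced_left_of_append hη)
  · rw [wordProd_append, mul_inv_rev, geom_mul_apply, geom_inv_geom]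
    exact isLeftDescent_iff_geom.mp
      (isLeftDescent_of_isReduced_cons (isReduced_right_of_append hη))

theorem map_root_leftInvSeq (hη : cs.IsReduced η) :
    (cs.leftInvSeq η).map (root cs) = rootSeq cs η := by
  induction η with
  | nil => rfl
  | cons i η ih =>
    have hih := ih (isReduced_of_cons hη)
    rw [leftInvSeq, rootSeq, List.map_cons, root_simple, ← hih, List.map_map, List.map_map]
    congr 1
    refine List.map_congr_left fun t ht => ?_
    have hmem : geom cs (cs.simple i) (root cs t) ∈ rootSeq cs (i :: η) := by
      rw [rootSeq, ← hih]
      exact List.mem_cons_of_mem _ (List.mem_map_of_mem (List.mem_map_of_mem ht))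
    exact root_conj (cs.isReflection_of_mem_leftInvSeq η ht) (rootSeq_spec hη hmem).2.1

theorem notMem_of_rootSeq_apply_eq_zero (h : ∀ r ∈ rootSeq cs η, r i = 0) : i ∉ η := by
  induction η with
  | nil => exact List.not_mem_nil
  | cons j η ih =>
    rw [rootSeq, List.forall_mem_cons, List.forall_mem_map] at h
    have hij : i ≠ j := by
      rintro rfl
      exact one_ne_zero ((simpleRoot_self i).symm.trans h.1)
    refine List.not_mem_cons_of_ne_of_not_mem hij (ih fun r hr => ?_)
    rw [← geom_simple_apply_of_ne cs hij, h.2 r hr]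

theorem geom_wordProd_concat_simpleRoot (η : List B) (i j : B) :
    geom cs (cs.wordProd (η ++ [j])) (simpleRoot i) =
      geom cs (cs.wordProd η) (simpleRoot i) +
        (-(2 * cosForm M (simpleRoot j) (simpleRoot i))) •
          geom cs (cs.wordProd η) (simpleRoot j) := by
  rw [wordProd_append, wordProd_singleton, geom_mul_apply, geom_simple_apply, map_sub, map_smul,
    neg_smul, ← sub_eq_add_neg]

theorem skewLE_geom_wordProd {ω : List B} (hi : SkewLE M ω (simpleRoot i) y) (hη : i ∉ η)
    (h : ∀ r ∈ rootSeq cs η, SkewLE M ω r y) :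
    SkewLE M ω (geom cs (cs.wordProd η) (simpleRoot i)) y := by
  induction η using List.reverseRecOn with
  | nil => simpa using hi
  | append_singleton η j ih =>
    rw [rootSeq_concat, List.forall_mem_append, List.forall_mem_singleton] at h
    rw [List.mem_append, List.mem_singleton, not_or] at hη
    rw [geom_wordProd_concat_simpleRoot]
    refine SkewLE.add_smul ?_ (ih hη.1 h.1) h.2
    linarith [cosForm_simpleRoot_nonpos M (Ne.symm hη.2)]

end RootSequence

section Aligned

variable {B W : Type*} [Group W] {M : CoxeterMatrix B} (cs : CoxeterSystem M W)

/-- The element `w` is aligned with the word `ω`: in every positive combination of two positive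
roots that is an inversion of `w`, the root that comes first is an inversion of `w`, too. -/
def Aligned (ω : List B) (w : W) : Prop :=
  ∀ (α γ : B →₀ ℝ) (a b : ℝ), IsRoot cs α → 0 ≤ α → IsRoot cs γ → 0 ≤ γ → 0 < a → 0 < b →
    IsRoot cs (a • α + b • γ) → 0 < skew M ω α γ → geom cs w⁻¹ (a • α + b • γ) ≤ 0 →
    geom cs w⁻¹ α ≤ 0

variable {cs} {i j : B} {ω η : List B} {v w : W} {α β γ : B →₀ ℝ}

theorem add_smul_nonneg {a b : ℝ} (ha : 0 < a) (hb : 0 < b) (hα : 0 ≤ α) (hγ : 0 ≤ γ) :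
    0 ≤ a • α + b • γ :=
  add_nonneg (smul_nonneg ha.le hα) (smul_nonneg hb.le hγ)

theorem apply_eq_zero_of_add_smul_apply_eq_zero {a b : ℝ} (ha : 0 < a) (hb : 0 < b) (hα : 0 ≤ α)
    (hγ : 0 ≤ γ) (h : (a • α + b • γ) i = 0) : α i = 0 ∧ γ i = 0 := by
  rw [Finsupp.add_apply, Finsupp.smul_apply, Finsupp.smul_apply,
    add_eq_zero_iff_of_nonneg (smul_nonneg ha.le (hα i)) (smul_nonneg hb.le (hγ i))] at h
  exact ⟨(smul_eq_zero.mp h.1).resolve_left ha.ne', (smul_eq_zero.mp h.2).resolve_left hb.ne'⟩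

theorem Aligned.take (h : Aligned cs (i :: ω) w) (hω : IsCoxeterWord (i :: ω))
    (hd : cs.IsLeftDescent w i) : Aligned cs (ω ++ [i]) (cs.simple i * w) := by
  intro α γ a b hα hα0 hγ hγ0 ha hb hβ hs hinv
  rw [mul_inv_rev, inv_simple, geom_mul_apply] at hinv ⊢
  have hαi : α ≠ simpleRoot i := by
    rintro rfl
    rw [skew_concat_simpleRoot hω] at hs
    linarith [cosForm_simpleRoot_le M (i := i) hγ0]
  have hmap : geom cs (cs.simple i) (a • α + b • γ) =
      a • geom cs (cs.simple i) α + b • geom cs (cs.simple i) γ := by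
    rw [map_add, map_smul, map_smul]
  by_cases hγi : γ = simpleRoot i
  · rw [isLeftDescent_iff_geom] at hd
    rw [hmap, hγi, geom_simple_simpleRoot, map_add, map_smul, map_smul, map_neg, smul_neg,
      ← sub_eq_add_neg, sub_nonpos] at hinv
    exact (smul_le_smul_iff_of_pos_left ha).mp
      ((hinv.trans (smul_nonpos_of_nonneg_of_nonpos hb.le hd)).trans_eq (smul_zero a).symm)
  · refine h _ _ a b (hα.geom _) (hα.geom_simple_nonneg hα0 hαi) (hγ.geom _)
      (hγ.geom_simple_nonneg hγ0 hγi) ha hb ?_ ?_ (hmap ▸ hinv)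
    · rw [← hmap]
      exact hβ.geom _
    · rwa [skew_rotate cs hω]

theorem Aligned.skip (h : Aligned cs (i :: ω) w)
    (hinv : ∀ β, 0 ≤ β → geom cs w⁻¹ β ≤ 0 → β i = 0) : Aligned cs (ω ++ [i]) w := by
  intro α γ a b hα hα0 hγ hγ0 ha hb hβ hs hle
  obtain ⟨hαi, hγi⟩ := apply_eq_zero_of_add_smul_apply_eq_zero ha hb hα0 hγ0
    (hinv _ (add_smul_nonneg ha hb hα0 hγ0) hle)
  refine h α γ a b hα hα0 hγ hγ0 ha hb hβ ?_ hle
  rwa [skew_cons_eq_skew_concat hαi hγi]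

variable (cs) in
/-- `v` is the parabolic part of `w` with respect to the simple reflections other than `sᵢ`. -/
structure IsParabolicPart (i : B) (v w : W) : Prop where
  exists_word : ∃ ζ : List B, i ∉ ζ ∧ cs.wordProd ζ = v
  length_add : cs.length v + cs.length (v⁻¹ * w) = cs.length w
  not_isLeftDescent : ∀ j ≠ i, ¬ cs.IsLeftDescent (v⁻¹ * w) j

variable (cs) in
theorem exists_isParabolicPart (i : B) (w : W) : ∃ v, IsParabolicPart cs i v w := by
  induction hn : cs.length w using Nat.strong_induction_on generalizing w with
  | _ n ih =>
    subst hn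
    by_cases hw : ∀ j ≠ i, ¬ cs.IsLeftDescent w j
    · exact ⟨1, ⟨[], List.not_mem_nil, rfl⟩, by simp, by simpa using hw⟩
    push Not at hw
    obtain ⟨j, hj, hd⟩ := hw
    obtain ⟨v, ⟨ζ, hζ, rfl⟩, hlen, hnot⟩ := ih _ hd _ rfl
    have hrest : (cs.wordProd (j :: ζ))⁻¹ * w = (cs.wordProd ζ)⁻¹ * (cs.simple j * w) := by
      rw [wordProd_cons, mul_inv_rev, inv_simple, mul_assoc]
    refine ⟨cs.wordProd (j :: ζ), ⟨j :: ζ, List.not_mem_cons_of_ne_of_not_mem hj.symm hζ, rfl⟩,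
      le_antisymm ?_ ?_, by rwa [hrest]⟩
    · have hle := cs.length_mul_le (cs.simple j) (cs.wordProd ζ)
      rw [isLeftDescent_iff] at hd
      rw [hrest, wordProd_cons]
      rw [length_simple] at hle
      omega
    · simpa using cs.length_mul_le (cs.wordProd (j :: ζ)) ((cs.wordProd (j :: ζ))⁻¹ * w)

theorem geom_inv_nonneg_of_forall_not_isLeftDescent (h : ∀ j ≠ i, ¬ cs.IsLeftDescent w j)
    {x : B →₀ ℝ} (hx : 0 ≤ x) (hxi : x i = 0) : 0 ≤ geom cs w⁻¹ x := by
  rw [← Finsupp.sum_single x, map_finsuppSum]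
  refine Finsupp.sum_nonneg fun j _ => ?_
  rw [← smul_simpleRoot, map_smul]
  rcases eq_or_ne j i with rfl | hj
  · rw [hxi, zero_smul]
  · have hnot := h j hj
    rw [isLeftDescent_iff_geom, ((isRoot_simpleRoot cs j).geom _).not_nonpos_iff] at hnot
    exact smul_nonneg (hx j) hnot

theorem IsParabolicPart.geom_inv_apply (h : IsParabolicPart cs i v w) (x : B →₀ ℝ) :
    geom cs v⁻¹ x i = x i := by
  obtain ⟨ζ, hζ, rfl⟩ := h.exists_word
  exact geom_wordProd_inv_apply_of_notMem cs hζ x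

theorem geom_inv_mul_inv_geom_inv (v w : W) (x : B →₀ ℝ) :
    geom cs (v⁻¹ * w)⁻¹ (geom cs v⁻¹ x) = geom cs w⁻¹ x := by
  rw [← geom_mul_apply, mul_inv_rev, inv_inv, mul_inv_cancel_right]

theorem IsParabolicPart.geom_inv_nonpos_iff (h : IsParabolicPart cs i v w) (hβ : IsRoot cs β)
    (h0 : 0 ≤ β) : geom cs v⁻¹ β ≤ 0 ↔ β i = 0 ∧ geom cs w⁻¹ β ≤ 0 := by
  have hcone {x : B →₀ ℝ} (hx : 0 ≤ x) (hxi : x i = 0) :=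
    geom_inv_nonneg_of_forall_not_isLeftDescent h.not_isLeftDescent hx hxi
  constructor
  · intro hle
    have hi : β i = 0 := le_antisymm (h.geom_inv_apply β ▸ hle i) (h0 i)
    have hneg := hcone (neg_nonneg.mpr hle) <| by
      rw [Finsupp.neg_apply, h.geom_inv_apply, hi, neg_zero]
    rw [map_neg, geom_inv_mul_inv_geom_inv] at hneg
    exact ⟨hi, neg_nonneg.mp hneg⟩
  · rintro ⟨hi, hle⟩
    by_contra hnot
    have hpos := hcone ((hβ.geom _).not_nonpos_iff.mp hnot) ((h.geom_inv_apply β).trans hi)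
    rw [geom_inv_mul_inv_geom_inv] at hpos
    exact (hβ.geom _).not_nonpos hpos hle

theorem IsParabolicPart.aligned (h : IsParabolicPart cs i v w) (hw : Aligned cs ω w) :
    Aligned cs ω v := by
  intro α γ a b hα hα0 hγ hγ0 ha hb hβ hs hle
  have hβ0 := add_smul_nonneg ha hb hα0 hγ0
  rw [h.geom_inv_nonpos_iff hβ hβ0] at hle
  rw [h.geom_inv_nonpos_iff hα hα0]
  exact ⟨(apply_eq_zero_of_add_smul_apply_eq_zero ha hb hα0 hγ0 hle.1).1,
    hw α γ a b hα hα0 hγ hγ0 ha hb hβ hs hle.2⟩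

theorem IsParabolicPart.isLeftDescent (h : IsParabolicPart cs i v w) (hne : v ≠ w) :
    cs.IsLeftDescent (v⁻¹ * w) i := by
  obtain ⟨j, hj⟩ := cs.exists_leftDescent_of_ne_one (inv_mul_eq_one.not.mpr hne)
  by_cases hji : j = i
  · exact hji ▸ hj
  · exact absurd hj (h.not_isLeftDescent j hji)

theorem IsParabolicPart.length_lt (h : IsParabolicPart cs i v w) (hne : v ≠ w) :
    cs.length v < cs.length w := by
  have hpos : cs.length (v⁻¹ * w) ≠ 0 := by
    rwa [Ne, length_eq_zero_iff, inv_mul_eq_one]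
  have hlen := h.length_add
  omega

theorem Aligned.geom_inv_nonpos_of_concat (h : Aligned cs (i :: ω) w)
    (hω : IsCoxeterWord (i :: ω)) (hred : cs.IsReduced (η ++ [j])) (hi : i ∉ η ++ [j])
    (hpw : (rootSeq cs (η ++ [j])).Pairwise (SkewLE M (i :: ω)))
    (hle : geom cs w⁻¹ (geom cs (cs.wordProd (η ++ [j])) (simpleRoot i)) ≤ 0) :
    geom cs w⁻¹ (geom cs (cs.wordProd η) (simpleRoot i)) ≤ 0 := by
  rw [List.mem_append, List.mem_singleton, not_or] at hi
  rw [rootSeq_concat, List.pairwise_append] at hpw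
  have hroot (k) : IsRoot cs (geom cs (cs.wordProd η) (simpleRoot k)) :=
    (isRoot_simpleRoot cs k).geom _
  have hcoord (k) : geom cs (cs.wordProd η) (simpleRoot k) i = simpleRoot k i :=
    geom_wordProd_apply_of_notMem cs hi.1 _
  have hj0 := geom_wordProd_nonneg_of_isReduced hred
  have hi0 : 0 ≤ geom cs (cs.wordProd η) (simpleRoot i) := by
    refine (hroot i).not_nonpos_iff.mp fun hcon => ?_
    have hone := hcon i
    rw [hcoord, simpleRoot_self] at hone
    exact one_pos.not_ge hone
  have hjne : geom cs (cs.wordProd η) (simpleRoot j) ≠ simpleRoot i := fun hcon => by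
    have hone := hcoord j
    rw [hcon, simpleRoot_self, simpleRoot_of_ne hi.2] at hone
    exact one_ne_zero hone
  have hskew : SkewLE M (i :: ω) (geom cs (cs.wordProd η) (simpleRoot i))
      (geom cs (cs.wordProd η) (simpleRoot j)) :=
    skewLE_geom_wordProd ((hroot j).skewLE_simpleRoot hω hj0 hjne) hi.1
      fun r hr => hpw.2.2 r hr _ List.mem_cons_self
  have hcomb := geom_wordProd_concat_simpleRoot (cs := cs) η i j
  rcases (cosForm_simpleRoot_nonpos M (Ne.symm hi.2)).eq_or_lt with horth | hobtuse
  · rwa [hcomb, horth, mul_zero, neg_zero, zero_smul, add_zero] at hle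
  · rw [← one_smul ℝ (geom cs (cs.wordProd η) (simpleRoot i))] at hcomb
    refine h _ _ 1 _ (hroot i) hi0 (hroot j) hj0 one_pos (by linarith)
      (hcomb ▸ (isRoot_simpleRoot cs i).geom _) (hskew.1.lt_of_ne fun hzero => ?_) (hcomb ▸ hle)
    have horth := hskew.2 hzero.symm
    rw [cosForm_geom, cosForm_symm] at horth
    exact hobtuse.ne horth

theorem Aligned.isLeftDescent_of_geom_inv_nonpos (h : Aligned cs (i :: ω) w)
    (hω : IsCoxeterWord (i :: ω)) (hred : cs.IsReduced η) (hi : i ∉ η)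
    (hpw : (rootSeq cs η).Pairwise (SkewLE M (i :: ω)))
    (hle : geom cs w⁻¹ (geom cs (cs.wordProd η) (simpleRoot i)) ≤ 0) :
    cs.IsLeftDescent w i := by
  induction η using List.reverseRecOn with
  | nil => exact isLeftDescent_iff_geom.mpr (by simpa using hle)
  | append_singleton η j ih =>
    have hstep := h.geom_inv_nonpos_of_concat hω hred hi hpw hle
    rw [rootSeq_concat] at hpw
    exact ih (isReduced_left_of_append hred) (fun hmem => hi (List.mem_append_left _ hmem))
      (List.pairwise_append.mp hpw).1 hstep

variable (cs) in
/-- Some reduced word of `v` lists its inversions in the order of the skew form of `ω`. -/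
def HasSkewSortedWord (ω : List B) (v : W) : Prop :=
  ∃ η, cs.IsReducedWordFor η v ∧ (rootSeq cs η).Pairwise (SkewLE M ω)

/-- Otherwise the parabolic part `v` of `w` is proper, `v⁻¹ w` begins with `sᵢ`, and alignment moves
the inversion `v αᵢ` back along a sorted word of `v` to `αᵢ`. -/
theorem Aligned.apply_eq_zero (h : Aligned cs (i :: ω) w) (hω : IsCoxeterWord (i :: ω))
    (hd : ¬ cs.IsLeftDescent w i)
    (ih : ∀ v, cs.length v < cs.length w → Aligned cs (i :: ω) v →
      HasSkewSortedWord cs (i :: ω) v)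
    (hβ0 : 0 ≤ β) (hinv : geom cs w⁻¹ β ≤ 0) : β i = 0 := by
  obtain ⟨v, hv⟩ := exists_isParabolicPart cs i w
  rcases eq_or_ne v w with rfl | hne
  · exact le_antisymm (hv.geom_inv_apply β ▸ hinv i) (hβ0 i)
  obtain ⟨η, ⟨hred, rfl⟩, hpw⟩ := ih v (hv.length_lt hne) (hv.aligned h)
  have hi : i ∉ η := notMem_of_rootSeq_apply_eq_zero fun r hr => by
    obtain ⟨hroot, h0, hle⟩ := rootSeq_spec hred hr
    exact ((hv.geom_inv_nonpos_iff hroot h0).mp hle).1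
  have hle := isLeftDescent_iff_geom.mp (hv.isLeftDescent hne)
  rw [← geom_inv_geom cs (cs.wordProd η) (simpleRoot i), geom_inv_mul_inv_geom_inv] at hle
  exact absurd (h.isLeftDescent_of_geom_inv_nonpos hω hred hi hpw hle) hd

end Aligned

section Greedy

variable {B W : Type*} [Group W] {M : CoxeterMatrix B} (cs : CoxeterSystem M W)

/-- The greedy reduced word `η` for `w` along the periodic word `ω ω ω ⋯`, together with the list
of its positions, which are counted from `p`. -/
inductive SortSeq : List B → ℕ → W → List B → List ℕ → Prop
  | nil (ω : List B) (p : ℕ) : SortSeq ω p 1 [] []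
  | take {i : B} {ω : List B} {p : ℕ} {w : W} {η : List B} {P : List ℕ}
      (h : cs.IsLeftDescent w i) (h' : SortSeq (ω ++ [i]) (p + 1) (cs.simple i * w) η P) :
      SortSeq (i :: ω) p w (i :: η) (p :: P)
  | skip {i : B} {ω : List B} {p : ℕ} {w : W} {η : List B} {P : List ℕ}
      (h : ¬ cs.IsLeftDescent w i) (h' : SortSeq (ω ++ [i]) (p + 1) w η P) :
      SortSeq (i :: ω) p w η P

variable {cs} {i : B} {ω η : List B} {p : ℕ} {w : W} {P : List ℕ}

theorem SortSeq.isReducedWordFor (h : SortSeq cs ω p w η P) : cs.IsReducedWordFor η w := by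
  induction h with
  | nil => exact ⟨cs.length_one, wordProd_nil cs⟩
  | take hd _ ih =>
    have hprod := ih.2
    have hred := ih.1.eq
    rw [isLeftDescent_iff] at hd
    rw [hprod] at hred
    refine ⟨?_, by rw [wordProd_cons, hprod, simple_mul_simple_cancel_left]⟩
    rw [CoxeterSystem.IsReduced, wordProd_cons, hprod, simple_mul_simple_cancel_left,
      List.length_cons]
    omega
  | skip _ _ ih => exact ih

variable (cs) in
theorem exists_sortSeq (hω : ∀ i, i ∈ ω) (p : ℕ) (w : W) : ∃ η P, SortSeq cs ω p w η P := by
  induction hn : cs.length w using Nat.strong_induction_on generalizing ω p w with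
  | _ n ih =>
    subst hn
    rcases eq_or_ne w 1 with rfl | hne
    · exact ⟨_, _, SortSeq.nil _ _⟩
    obtain ⟨j, hj⟩ := cs.exists_leftDescent_of_ne_one hne
    obtain ⟨ω₁, ω₂, rfl⟩ := List.append_of_mem (hω j)
    have hrot {i : B} {ω : List B} (h : ∀ k, k ∈ i :: ω) (k) : k ∈ ω ++ [i] :=
      (List.perm_append_singleton i ω).mem_iff.mpr (h k)
    induction ω₁ generalizing p ω₂ with
    | nil =>
      obtain ⟨η, P, h⟩ := ih _ hj (hrot hω) (p + 1) _ rfl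
      exact ⟨_, _, SortSeq.take hj h⟩
    | cons i ω₁ ih' =>
      by_cases hi : cs.IsLeftDescent w i
      · obtain ⟨η, P, h⟩ := ih _ hi (hrot hω) (p + 1) _ rfl
        exact ⟨_, _, SortSeq.take hi h⟩
      · obtain ⟨η, P, h⟩ := ih' (p + 1) (ω₂ ++ [i]) (by simpa using hrot hω)
        exact ⟨η, P, SortSeq.skip hi (by simpa using h)⟩

theorem pairwise_skewLE_cons (hω : IsCoxeterWord (i :: ω)) (hred : cs.IsReduced (i :: η))
    (h : (rootSeq cs η).Pairwise (SkewLE M (ω ++ [i]))) :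
    (rootSeq cs (i :: η)).Pairwise (SkewLE M (i :: ω)) := by
  rw [rootSeq, List.pairwise_cons, List.forall_mem_map, List.pairwise_map]
  refine ⟨fun r hr => ?_, h.imp (skewLE_rotate hω).mpr⟩
  have hr' := rootSeq_spec hred (List.mem_cons_of_mem _ (List.mem_map_of_mem hr))
  refine hr'.1.skewLE_simpleRoot hω hr'.2.1 fun heq => ?_
  have hneg : r = -simpleRoot i := by
    rw [← geom_simple_simpleRoot cs, ← heq, ← geom_mul_apply, simple_mul_simple_self,
      geom_one_apply]
  have hpos := (rootSeq_spec (isReduced_of_cons hred) hr).2.1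
  rw [hneg] at hpos
  exact (isRoot_simpleRoot cs i).not_nonpos (simpleRoot_nonneg i) (neg_nonneg.mp hpos)

theorem pairwise_skewLE_of_apply_eq_zero (hred : cs.IsReduced η)
    (hinv : ∀ β, 0 ≤ β → geom cs (cs.wordProd η)⁻¹ β ≤ 0 → β i = 0)
    (h : (rootSeq cs η).Pairwise (SkewLE M (ω ++ [i]))) :
    (rootSeq cs η).Pairwise (SkewLE M (i :: ω)) := by
  have hzero {r} (hr : r ∈ rootSeq cs η) : r i = 0 :=
    have hspec := rootSeq_spec hred hr
    hinv r hspec.2.1 hspec.2.2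
  refine h.imp_of_mem fun {x y} hx hy hxy => ?_
  rwa [SkewLE, skew_cons_eq_skew_concat (hzero hx) (hzero hy)]

theorem SortSeq.pairwise_skewLE (h : SortSeq cs ω p w η P) (hω : IsCoxeterWord ω)
    (hw : Aligned cs ω w) : (rootSeq cs η).Pairwise (SkewLE M ω) := by
  induction hn : cs.length w using Nat.strong_induction_on generalizing ω p w η P with
  | _ n ih =>
    subst hn
    induction h with
    | nil => exact List.Pairwise.nil
    | @take i ω p w η P hd h' =>
      exact pairwise_skewLE_cons hω (SortSeq.take hd h').isReducedWordFor.1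
        (ih _ hd h' hω.rotate (hw.take hω hd) rfl)
    | @skip i ω p w η P hd h' ih' =>
      obtain ⟨hred, rfl⟩ := h'.isReducedWordFor
      have hinv (β) (hβ : 0 ≤ β) (hle : geom cs (cs.wordProd η)⁻¹ β ≤ 0) : β i = 0 := by
        refine hw.apply_eq_zero hω hd (fun v hv hval => ?_) hβ hle
        obtain ⟨η', P', hs⟩ := exists_sortSeq cs hω.mem 0 v
        exact ⟨η', hs.isReducedWordFor, ih _ hv hs hω hval rfl⟩
      exact pairwise_skewLE_of_apply_eq_zero hred hinv (ih' hω.rotate (hw.skip hinv) ih)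

end Greedy

section Positions

/-- The positions `(k, i)` of a periodic word of period `n`, counted as the natural numbers
`k n + i`. -/
noncomputable def positionIso {n : ℕ} (hn : 0 < n) : ℕ ×ₗ Fin n ≃o ℕ :=
  StrictMono.orderIsoOfRightInverse (fun q => (ofLex q).1 * n + (ofLex q).2)
    (by
      intro a b hab
      rw [Prod.Lex.lt_iff] at hab
      have ha := (ofLex a).2.isLt
      rcases hab with hfst | ⟨hfst, hsnd⟩
      · have hmul := Nat.mul_le_mul_right n (Nat.succ_le_of_lt hfst)
        rw [Nat.succ_mul] at hmul
        dsimp only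
        omega
      · dsimp only
        rw [hfst]
        exact Nat.add_lt_add_left hsnd _)
    (fun m => toLex (m / n, ⟨m % n, Nat.mod_lt _ hn⟩))
    (fun m => Nat.div_add_mod' m n)

theorem positionIso_symm_succ_le {n : ℕ} (hn : 0 < n) {p : ℕ} {q : ℕ ×ₗ Fin n}
    (h : (positionIso hn).symm p < q) : (positionIso hn).symm (p + 1) ≤ q := by
  rw [OrderIso.symm_apply_le]
  exact (OrderIso.symm_apply_lt _).mp h

variable {B : Type*} {i : B} {ω ω₀ : List B} {p : ℕ}

theorem nil_le_list {α : Type*} [LinearOrder α] : ∀ l : List α, [] ≤ l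
  | [] => le_rfl
  | _ :: _ => le_of_lt List.Lex.nil

theorem rotate_succ_eq_of_eq_cons (h : ω₀.rotate p = i :: ω) : ω₀.rotate (p + 1) = ω ++ [i] := by
  rw [← List.rotate_rotate, h, List.rotate_cons_succ, List.rotate_zero]

theorem get_positionIso_symm (hn : 0 < ω₀.length) (h : ω₀.rotate p = i :: ω) :
    ω₀.get (ofLex ((positionIso hn).symm p)).2 = i := by
  have hhead := congrArg (·[0]?) h
  simp only [List.getElem?_cons_zero] at hhead
  rw [List.getElem?_rotate hn, zero_add, List.getElem?_eq_getElem (Nat.mod_lt _ hn)] at hhead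
  exact Option.some.inj hhead

theorem lettersAt_cons (hn : 0 < ω₀.length) (h : ω₀.rotate p = i :: ω)
    (Q : List (ℕ ×ₗ Fin ω₀.length)) :
    lettersAt ω₀ ((positionIso hn).symm p :: Q) = i :: lettersAt ω₀ Q := by
  rw [lettersAt, List.map_cons, get_positionIso_symm hn h, ← lettersAt]

end Positions

section SortingWords

variable {B W : Type*} [Group W] {M : CoxeterMatrix B} {cs : CoxeterSystem M W} {i : B}
  {ω ω₀ η η' : List B} {p : ℕ} {w : W} {P : List ℕ}

theorem SortSeq.lettersAt_map (h : SortSeq cs ω p w η P) (hn : 0 < ω₀.length)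
    (hω : ω₀.rotate p = ω) : lettersAt ω₀ (P.map (positionIso hn).symm) = η := by
  induction h with
  | nil => rfl
  | take _ _ ih =>
    rw [List.map_cons, lettersAt_cons hn hω, ih (rotate_succ_eq_of_eq_cons hω)]
  | skip _ _ ih => exact ih (rotate_succ_eq_of_eq_cons hω)

theorem SortSeq.le_of_mem (h : SortSeq cs ω p w η P) : ∀ q ∈ P, p ≤ q := by
  induction h with
  | nil => exact fun _ => False.elim ∘ List.not_mem_nil
  | take _ _ ih => exact List.forall_mem_cons.mpr ⟨le_rfl, fun q hq => Nat.le_of_lt (ih q hq)⟩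
  | skip _ _ ih => exact fun q hq => Nat.le_of_lt (ih q hq)

theorem SortSeq.pairwise_lt (h : SortSeq cs ω p w η P) : P.Pairwise (· < ·) := by
  induction h with
  | nil => exact List.Pairwise.nil
  | take _ h' ih => exact List.pairwise_cons.mpr ⟨h'.le_of_mem, ih⟩
  | skip _ _ ih => exact ih

theorem isReducedWordFor_of_cons (h : cs.IsReducedWordFor (i :: η) w) :
    cs.IsReducedWordFor η (cs.simple i * w) := by
  obtain ⟨hred, rfl⟩ := h
  exact ⟨isReduced_of_cons hred, by rw [wordProd_cons, simple_mul_simple_cancel_left]⟩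

variable (cs) in
/-- `Q` is an increasing list of positions, not before `p`, of a reduced word for `w`. -/
structure IsPositionListFrom (hn : 0 < ω₀.length) (p : ℕ) (w : W)
    (Q : List (ℕ ×ₗ Fin ω₀.length)) : Prop where
  pairwise_lt : Q.Pairwise (· < ·)
  le_of_mem : ∀ q ∈ Q, (positionIso hn).symm p ≤ q
  isReducedWordFor : cs.IsReducedWordFor (lettersAt ω₀ Q) w

variable {hn : 0 < ω₀.length} {Q : List (ℕ ×ₗ Fin ω₀.length)}

theorem IsPositionListFrom.tail (h : IsPositionListFrom cs hn p w ((positionIso hn).symm p :: Q))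
    (hω : ω₀.rotate p = i :: ω) : IsPositionListFrom cs hn (p + 1) (cs.simple i * w) Q where
  pairwise_lt := (List.pairwise_cons.mp h.pairwise_lt).2
  le_of_mem q hq := positionIso_symm_succ_le hn ((List.pairwise_cons.mp h.pairwise_lt).1 q hq)
  isReducedWordFor := isReducedWordFor_of_cons (lettersAt_cons hn hω Q ▸ h.isReducedWordFor)

theorem IsPositionListFrom.succ (h : IsPositionListFrom cs hn p w Q)
    (hω : ω₀.rotate p = i :: ω) (hd : ¬ cs.IsLeftDescent w i) :
    IsPositionListFrom cs hn (p + 1) w Q where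
  pairwise_lt := h.pairwise_lt
  le_of_mem q hq := by
    refine positionIso_symm_succ_le hn ((h.le_of_mem q hq).lt_of_ne ?_)
    rintro rfl
    obtain ⟨q₀, Q, rfl⟩ := List.exists_cons_of_ne_nil (List.ne_nil_of_mem hq)
    have hhead : q₀ = (positionIso hn).symm p := by
      refine le_antisymm ?_ (h.le_of_mem q₀ List.mem_cons_self)
      rcases List.mem_cons.mp hq with heq | hmem
      · exact heq.ge
      · exact ((List.pairwise_cons.mp h.pairwise_lt).1 _ hmem).le
    obtain ⟨hred, hprod⟩ := h.isReducedWordFor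
    rw [hhead, lettersAt_cons hn hω] at hred hprod
    exact hd (hprod ▸ isLeftDescent_of_isReduced_cons hred)
  isReducedWordFor := h.isReducedWordFor

theorem SortSeq.le (h : SortSeq cs ω p w η P) (hω : ω₀.rotate p = ω)
    (hQ : IsPositionListFrom cs hn p w Q) : P.map (positionIso hn).symm ≤ Q := by
  induction h generalizing Q with
  | nil => exact nil_le_list Q
  | @take i ω p w η P hd _ ih =>
    cases Q with
    | nil =>
      obtain rfl : 1 = w := hQ.isReducedWordFor.2
      exact absurd hd (cs.not_isLeftDescent_one i)
    | cons q Q =>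
      rcases (hQ.le_of_mem q List.mem_cons_self).eq_or_lt with rfl | hlt
      · exact List.cons_le_cons _ (ih (rotate_succ_eq_of_eq_cons hω) (hQ.tail hω))
      · exact le_of_lt (List.Lex.rel hlt)
  | skip hd _ ih => exact ih (rotate_succ_eq_of_eq_cons hω) (hQ.succ hω hd)

theorem SortSeq.isSortingWord (h : SortSeq cs ω 0 w η P) : cs.IsSortingWord ω w η := by
  rcases Nat.eq_zero_or_pos ω.length with hzero | hn
  · rw [List.length_eq_zero_iff] at hzero
    subst hzero
    cases h
    exact ⟨[], ⟨⟨List.Pairwise.nil, (SortSeq.nil [] 0).isReducedWordFor⟩,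
      fun Q _ => nil_le_list Q⟩, rfl⟩
  · have hletters := h.lettersAt_map hn (List.rotate_zero ω)
    refine ⟨P.map (positionIso hn).symm, ⟨⟨?_, hletters.symm ▸ h.isReducedWordFor⟩,
      fun Q hQ => h.le (List.rotate_zero ω) ⟨hQ.1, fun q _ => ?_, hQ.2⟩⟩, hletters⟩
    · exact h.pairwise_lt.map _ fun _ _ hlt => (positionIso hn).symm.strictMono hlt
    · rw [OrderIso.symm_apply_le]
      exact Nat.zero_le _

theorem isReducedWordFor_of_isSortingWord (h : cs.IsSortingWord ω w η) :
    cs.IsReducedWordFor η w := by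
  obtain ⟨P, hP, rfl⟩ := h
  exact hP.1.2

theorem isSortingWord_unique (h : cs.IsSortingWord ω w η) (h' : cs.IsSortingWord ω w η') :
    η = η' := by
  obtain ⟨P, hP, rfl⟩ := h
  obtain ⟨P', hP', rfl⟩ := h'
  rw [hP.unique hP']

end SortingWords

section LongElement

variable {B W : Type*} [Group W] {M : CoxeterMatrix B} {cs : CoxeterSystem M W} {η : List B}
  {t w w₀ : W} {β : B →₀ ℝ}

theorem ncard_leftInvSeq (hη : cs.IsReduced η) :
    {t | t ∈ cs.leftInvSeq η}.ncard = cs.length (cs.wordProd η) := by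
  classical
  rw [hη.eq, ← length_leftInvSeq cs, ← List.toFinset_card_of_nodup hη.nodup_leftInvSeq,
    ← Set.ncard_coe_finset, List.coe_toFinset]

theorem mem_leftInvSeq_of_geom_inv_nonpos (ht : cs.IsReflection t)
    (h : geom cs (cs.wordProd η)⁻¹ (root cs t) ≤ 0) : t ∈ cs.leftInvSeq η := by
  rw [← List.reverse_reverse η, leftInvSeq_reverse, List.mem_reverse]
  exact mem_rightInvSeq_of_geom_nonpos ht (wordProd_reverse cs η ▸ h)

theorem geom_nonpos_of_forall_simpleRoot (h : ∀ i, geom cs w (simpleRoot i) ≤ 0) (hβ : 0 ≤ β) :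
    geom cs w β ≤ 0 := by
  rw [← Finsupp.sum_single β, map_finsuppSum]
  refine Finset.sum_nonpos fun i _ => ?_
  dsimp only
  rw [← smul_simpleRoot, map_smul]
  exact smul_nonpos_of_nonneg_of_nonpos (hβ i) (h i)

variable [Finite W]

theorem mem_leftInvSeq_of_isLongElement (hw : cs.IsLongElement w₀)
    (hη : cs.IsReducedWordFor η w₀) (ht : cs.IsReflection t) : t ∈ cs.leftInvSeq η := by
  have hcard : {t | cs.IsReflection t}.ncard ≤ {t | t ∈ cs.leftInvSeq η}.ncard := by
    rw [ncard_leftInvSeq hη.1, hη.2, hw]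
    exact (Nat.card_coe_set_eq _).ge
  exact (Set.eq_of_subset_of_ncard_le (fun t => cs.isReflection_of_mem_leftInvSeq η) hcard).ge ht

theorem aligned_of_isLongElement (hw : cs.IsLongElement w₀) (ω : List B) : Aligned cs ω w₀ := by
  intro α _ _ _ hα hα0 _ _ _ _ _ _ _
  obtain ⟨t, ht, rfl⟩ := hα.exists_root_eq hα0
  obtain ⟨η, hη, rfl⟩ := cs.exists_isReduced w₀
  have hmem := mem_leftInvSeq_of_isLongElement hw ⟨hη, rfl⟩ ht
  exact (length_mul_left_lt_iff ht _).mp (cs.isLeftInversion_of_mem_leftInvSeq hη hmem).2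

variable (cs) in
theorem exists_isLongElement : ∃ w₀, cs.IsLongElement w₀ := by
  obtain ⟨w, hmax⟩ := Finite.exists_max cs.length
  obtain ⟨η, hη, rfl⟩ := cs.exists_isReduced w
  have hsimple (i) : geom cs (cs.wordProd η)⁻¹ (simpleRoot i) ≤ 0 :=
    isLeftDescent_iff_geom.mp <|
      (hmax _).lt_of_ne (cs.length_simple_mul_ne (cs.wordProd η) i)
  have hinv : {t | t ∈ cs.leftInvSeq η} = {t | cs.IsReflection t} :=
    Set.ext fun t => ⟨cs.isReflection_of_mem_leftInvSeq η, fun ht =>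
      mem_leftInvSeq_of_geom_inv_nonpos ht
        (geom_nonpos_of_forall_simpleRoot hsimple (root_nonneg ht))⟩
  refine ⟨cs.wordProd η, ?_⟩
  rw [IsLongElement, ← ncard_leftInvSeq hη, hinv]
  exact (Nat.card_coe_set_eq _).symm

end LongElement

section Sublists

theorem pair_sublist_iff_idxOf_lt {α : Type*} [DecidableEq α] {l : List α} {s t : α}
    (hl : l.Nodup) (ht : t ∈ l) : [s, t].Sublist l ↔ l.idxOf s < l.idxOf t := by
  induction l with
  | nil => exact absurd ht List.not_mem_nil
  | cons a l ih =>
    rw [List.nodup_cons] at hl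
    rw [List.sublist_cons_iff]
    grind [List.Sublist.subset]

variable {G : Type*} [Group G] {l l' : List G} {s t : G}

theorem pair_sublist_of_commEquiv (hne : s * t ≠ t * s) (h : CommEquiv l l')
    (hl : [s, t].Sublist l) : [s, t].Sublist l' := by
  classical
  have hfilter : l.filter (· ∈ [s, t]) = l'.filter (· ∈ [s, t]) := by
    refine rel_of_commEquiv (r := fun l l' => l.filter (· ∈ [s, t]) = l'.filter (· ∈ [s, t]))
      (eq_equivalence.comap _) (fun l₁ l₂ a b hab => ?_) h
    simp only [List.filter_append, List.filter_cons]
    grind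
  have hsub := hl.filter (· ∈ [s, t])
  rw [hfilter, List.filter_eq_self.mpr (by simp)] at hsub
  exact hsub.trans List.filter_sublist

theorem commEquiv_orderedInsert {r : G → G → Prop} [DecidableRel r] {a : G}
    (h : ∀ x ∈ l, ¬ r a x → a * x = x * a) : CommEquiv (a :: l) (l.orderedInsert r a) := by
  induction l with
  | nil => exact commEquiv_refl _
  | cons b l ih =>
    rw [List.forall_mem_cons] at h
    rw [List.orderedInsert_cons]
    split_ifs with hab
    · exact commEquiv_refl _
    · exact commEquiv_trans (commEquiv_swap [] l (h.1 hab)) (commEquiv_cons b (ih h.2))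

theorem exists_commEquiv_pairwise_le {α : Type*} [LinearOrder α] (f : G → α)
    (h : l.Pairwise fun s t => s * t ≠ t * s → f s ≤ f t) :
    ∃ l', CommEquiv l l' ∧ l'.Pairwise fun s t => f s ≤ f t := by
  induction l with
  | nil => exact ⟨[], commEquiv_refl _, List.Pairwise.nil⟩
  | cons a l ih =>
    rw [List.pairwise_cons] at h
    obtain ⟨l', hl', hsorted⟩ := ih h.2
    refine ⟨l'.orderedInsert (fun s t => f s ≤ f t) a,
      commEquiv_trans (commEquiv_cons a hl') (commEquiv_orderedInsert fun x hx => ?_), ?_⟩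
    · exact not_imp_comm.mp (h.1 x ((perm_of_commEquiv hl').mem_iff.mpr hx))
    · have : Std.Total fun s t => f s ≤ f t := ⟨fun s t => le_total _ _⟩
      have : IsTrans G fun s t => f s ≤ f t := ⟨fun _ _ _ => le_trans⟩
      exact hsorted.orderedInsert a l'

end Sublists

section SortOrder

variable {B W : Type*} [Group W] {M : CoxeterMatrix B} {cs : CoxeterSystem M W}
  {ω ω₀ η : List B} {ts : List W} {t t' w₀ : W}

theorem isFactorization_map_simple (h : cs.wordProd ω = cs.wordProd ω₀)
    (hlen : ω.length = ω₀.length) : IsFactorization cs ω₀ (ω.map cs.simple) where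
  isReflection := List.forall_mem_map.mpr fun i _ => cs.isReflection_simple i
  prod_eq := h
  length_eq := by rw [List.length_map, hlen]

variable [Finite W]

theorem length_wordProd_of_nodup (hω : ω.Nodup) : cs.length (cs.wordProd ω) = ω.length := by
  refine le_antisymm (cs.length_wordProd_le ω) ?_
  obtain ⟨ω', hred, hprod⟩ := cs.exists_isReduced (cs.wordProd ω)
  have hle := length_le_of_prod_eq (cs := cs) (ts := ω'.map cs.simple) hω
    (List.forall_mem_map.mpr fun i _ => cs.isReflection_simple i) hprod.symm
  rwa [List.length_map, ← hred.eq, ← hprod] at hle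

theorem isCoxeterWord_of_isReducedWordFor (hω₀ : IsCoxeterWord ω₀)
    (h : cs.IsReducedWordFor ω (cs.wordProd ω₀)) : IsCoxeterWord ω := by
  have hlen : ω.length = ω₀.length := by
    rw [← h.1.eq, h.2, length_wordProd_of_nodup hω₀.nodup]
  have hnodup : ω.Nodup :=
    List.Nodup.of_map _ ((isFactorization_map_simple h.2 hlen).nodup hω₀.nodup)
  have hperm := (List.subperm_of_subset hnodup fun i _ => hω₀.mem i).perm_of_length_le hlen.ge
  exact ⟨hnodup, fun i => hperm.mem_iff.mpr (hω₀.mem i)⟩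

theorem euler_eq_of_wordProd_eq (hω : IsCoxeterWord ω) (hω₀ : IsCoxeterWord ω₀)
    (h : cs.wordProd ω = cs.wordProd ω₀) : euler M ω = euler M ω₀ := by
  refine LinearMap.ext fun x => LinearMap.ext fun y => ?_
  obtain ⟨z, -, rfl⟩ := exists_sub_geom_inv_wordProd_eq (cs := cs) hω₀.nodup (hω₀.mem_supp y)
  rw [euler_sub_geom_inv cs hω₀.nodup, ← h, euler_sub_geom_inv cs hω.nodup, hω₀.restr_eq,
    hω.restr_eq]

theorem skewLE_of_sublist_leftInvSeq (hω₀ : IsCoxeterWord ω₀)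
    (hω : cs.IsReducedWordFor ω (cs.wordProd ω₀)) (hw : cs.IsLongElement w₀)
    (hη : cs.IsSortingWord ω w₀ η) (h : [t, t'].Sublist (cs.leftInvSeq η)) :
    SkewLE M ω₀ (root cs t) (root cs t') := by
  have hcox := isCoxeterWord_of_isReducedWordFor hω₀ hω
  obtain ⟨η', P, hsort⟩ := exists_sortSeq cs hcox.mem 0 w₀
  obtain rfl := isSortingWord_unique hη hsort.isSortingWord
  have hpair := hsort.pairwise_skewLE hcox (aligned_of_isLongElement hw ω)
  rw [← map_root_leftInvSeq hsort.isReducedWordFor.1, List.pairwise_map] at hpair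
  have hskew := List.pairwise_pair.mp (hpair.sublist h)
  rwa [SkewLE, skew, euler_eq_of_wordProd_eq hcox hω₀ hω.2] at hskew

theorem exists_sort_rank (hω : IsCoxeterWord ω) : ∃ f : W → ℕ, ∀ t t',
    cs.IsReflection t' → t ≠ t' → (f t < f t' → SkewLE M ω (root cs t) (root cs t')) ∧
      (cs.SortLE (cs.wordProd ω) t t' → f t < f t') := by
  classical
  obtain ⟨w₀, hw⟩ := exists_isLongElement cs
  obtain ⟨η, P, hsort⟩ := exists_sortSeq cs hω.mem 0 w₀
  have hred : cs.IsReducedWordFor ω (cs.wordProd ω) := ⟨length_wordProd_of_nodup hω.nodup, rfl⟩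
  refine ⟨(cs.leftInvSeq η).idxOf, fun t t' ht' hne => ?_⟩
  rw [← pair_sublist_iff_idxOf_lt hsort.isReducedWordFor.1.nodup_leftInvSeq
    (mem_leftInvSeq_of_isLongElement hw hsort.isReducedWordFor ht')]
  exact ⟨skewLE_of_sublist_leftInvSeq hω hred hw hsort.isSortingWord, fun h =>
    (h.resolve_left hne) ω η w₀ _ hred hw hsort.isSortingWord (commEquiv_refl _)⟩

theorem sortLE_of_skew_pos (hω : IsCoxeterWord ω) (ht : cs.IsReflection t)
    (ht' : cs.IsReflection t') (hne : t * t' ≠ t' * t)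
    (h : 0 < skew M ω (root cs t) (root cs t')) : cs.SortLE (cs.wordProd ω) t t' := by
  classical
  refine Or.inr fun ω₁ η w₀ l hred hw hη hl => pair_sublist_of_commEquiv hne hl ?_
  have hηred := isReducedWordFor_of_isSortingWord hη
  have hmem {r : W} (hr : cs.IsReflection r) := mem_leftInvSeq_of_isLongElement hw hηred hr
  have hidx : (cs.leftInvSeq η).idxOf t ≠ (cs.leftInvSeq η).idxOf t' := fun heq =>
    hne (by rw [(List.idxOf_inj (hmem ht)).mp heq])
  rw [pair_sublist_iff_idxOf_lt hηred.1.nodup_leftInvSeq (hmem ht')]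
  refine hidx.lt_or_gt.resolve_right fun hgt => ?_
  have hskew := skewLE_of_sublist_leftInvSeq hω hred hw hη
    ((pair_sublist_iff_idxOf_lt hηred.1.nodup_leftInvSeq (hmem ht)).mpr hgt)
  have := hskew.1
  rw [skew_swap] at this
  linarith

end SortOrder

section SortedFactorizations

variable {B W : Type*} [Group W] [Finite W] {M : CoxeterMatrix B} {cs : CoxeterSystem M W}
  {ω : List B} {ts : List W}

theorem IsFactorization.pairwise_skew (hts : IsFactorization cs ω ts) (hω : IsCoxeterWord ω) :
    ts.Pairwise fun t t' => t ≠ t' ∧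
      skew M ω (root cs t) (root cs t') = -(2 * cosForm M (root cs t) (root cs t')) := by
  refine (hts.pairwise hω.nodup).imp fun {t t'} ⟨hne, hzero⟩ => ⟨hne, ?_⟩
  have hsum := euler_add_euler M ω (root cs t) (root cs t')
  rw [hω.restr_eq, hω.restr_eq, hzero] at hsum
  rw [skew_apply, hzero]
  linarith

theorem IsFactorization.pairwise_sortLE (hts : IsFactorization cs ω ts) (hω : IsCoxeterWord ω) :
    ts.Pairwise fun t t' =>
      (0 < cosForm M (root cs t) (root cs t') → cs.SortLE (cs.wordProd ω) t' t) ∧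
        (cosForm M (root cs t) (root cs t') < 0 → cs.SortLE (cs.wordProd ω) t t') := by
  refine (hts.pairwise_skew hω).imp_of_mem fun {t t'} ht ht' ⟨hne, hskew⟩ => ?_
  have hcomm (h : cosForm M (root cs t) (root cs t') ≠ 0) : t * t' ≠ t' * t :=
    mt (cosForm_eq_zero_of_commute (hts.isReflection t ht) (hts.isReflection t' ht') hne) h
  refine ⟨fun h => sortLE_of_skew_pos hω (hts.isReflection t' ht') (hts.isReflection t ht)
    (hcomm h.ne').symm ?_, fun h => sortLE_of_skew_pos hω (hts.isReflection t ht)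
    (hts.isReflection t' ht') (hcomm h.ne) ?_⟩
  · rw [skew_swap, hskew]
    linarith
  · rw [hskew]
    linarith

theorem IsFactorization.isNonacute_of_increasing (hts : IsFactorization cs ω ts)
    (hω : IsCoxeterWord ω)
    (h : ts.Pairwise fun t t' => ¬ cs.SortLE (cs.wordProd ω) t' t) : IsNonacute cs ts :=
  ((hts.pairwise_sortLE hω).and h).imp fun ⟨hle, hnot⟩ => not_lt.mp (mt hle.1 hnot)

theorem IsFactorization.isNonobtuse_of_decreasing (hts : IsFactorization cs ω ts)
    (hω : IsCoxeterWord ω)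
    (h : ts.Pairwise fun t t' => ¬ cs.SortLE (cs.wordProd ω) t t') : IsNonobtuse cs ts :=
  ((hts.pairwise_sortLE hω).and h).imp fun ⟨hle, hnot⟩ => not_lt.mp (mt hle.2 hnot)

theorem IsFactorization.exists_commEquiv_increasing (hts : IsFactorization cs ω ts)
    (hω : IsCoxeterWord ω) (h : IsNonacute cs ts) :
    ∃ ts', CommEquiv ts ts' ∧ ts'.Pairwise fun t t' => ¬ cs.SortLE (cs.wordProd ω) t' t := by
  obtain ⟨f, hf⟩ := exists_sort_rank (cs := cs) hω
  obtain ⟨ts', hcomm, hsorted⟩ := exists_commEquiv_pairwise_le f (l := ts) <|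
    ((hts.pairwise_skew hω).and h).imp_of_mem fun {t t'} ht ht' ⟨⟨hne, hskew⟩, hcos⟩ hst => by
      by_contra! hlt
      have hle := ((hf t' t (hts.isReflection t ht) hne.symm).1 hlt).1
      rw [skew_swap, hskew] at hle
      exact hst (commute_of_cosForm_eq_zero (hts.isReflection t ht) (hts.isReflection t' ht')
        (hcos.antisymm (by linarith)))
  have hperm := perm_of_commEquiv hcomm
  refine ⟨ts', hcomm, (hsorted.and (hperm.nodup (hts.nodup hω.nodup))).imp_of_mem
    fun {t t'} ht _ ⟨hle, hne⟩ hsort => hle.not_gt ?_⟩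
  exact (hf t' t (hts.isReflection t (hperm.mem_iff.mpr ht)) hne.symm).2 hsort

theorem IsFactorization.exists_commEquiv_decreasing (hts : IsFactorization cs ω ts)
    (hω : IsCoxeterWord ω) (h : IsNonobtuse cs ts) :
    ∃ ts', CommEquiv ts ts' ∧ ts'.Pairwise fun t t' => ¬ cs.SortLE (cs.wordProd ω) t t' := by
  obtain ⟨f, hf⟩ := exists_sort_rank (cs := cs) hω
  obtain ⟨ts', hcomm, hsorted⟩ := exists_commEquiv_pairwise_le (OrderDual.toDual ∘ f) (l := ts) <|
    ((hts.pairwise_skew hω).and h).imp_of_mem fun {t t'} ht ht' ⟨⟨hne, hskew⟩, hcos⟩ hst => by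
      by_contra! hlt
      have hle := ((hf t t' (hts.isReflection t' ht') hne).1 hlt).1
      rw [hskew] at hle
      exact hst (commute_of_cosForm_eq_zero (hts.isReflection t ht) (hts.isReflection t' ht')
        (le_antisymm (by linarith) hcos))
  have hperm := perm_of_commEquiv hcomm
  refine ⟨ts', hcomm, (hsorted.and (hperm.nodup (hts.nodup hω.nodup))).imp_of_mem
    fun {t t'} _ ht' ⟨hle, hne⟩ hsort => not_lt_of_ge hle ?_⟩
  exact (hf t t' (hts.isReflection t' (hperm.mem_iff.mpr ht')) hne).2 hsort

end SortedFactorizations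

section QuotientWord

variable {G : Type*} [Group G]

theorem quotientWord_cons_cons (a b : G) (l : List G) :
    quotientWord (a :: b :: l) = a⁻¹ * b :: quotientWord (b :: l) :=
  rfl

theorem length_quotientWord_cons (a : G) (l : List G) :
    (quotientWord (a :: l)).length = l.length := by
  simp [quotientWord]

theorem mul_prod_quotientWord (a : G) (l : List G) :
    a * (quotientWord (a :: l)).prod = (a :: l).getLast (List.cons_ne_nil a l) := by
  induction l generalizing a with
  | nil => simp [quotientWord]
  | cons b l ih =>
    rw [quotientWord_cons_cons, List.prod_cons, ← mul_assoc, mul_inv_cancel_left, ih,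
      List.getLast_cons_cons]

theorem forall_mem_quotientWord {P : G → Prop} {l : List G} :
    (∀ t ∈ quotientWord l, P t) ↔ l.IsChain fun x y => P (x⁻¹ * y) := by
  induction l with
  | nil => simp [quotientWord]
  | cons a l ih =>
    cases l with
    | nil => simp [quotientWord]
    | cons b l => rw [quotientWord_cons_cons, List.forall_mem_cons, ih, List.isChain_cons_cons]

theorem exists_quotientWord_eq (a : G) (ts : List G) : ∃ l, quotientWord (a :: l) = ts := by
  induction ts generalizing a with
  | nil => exact ⟨[], rfl⟩
  | cons t ts ih =>
    obtain ⟨l, hl⟩ := ih (a * t)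
    exact ⟨a * t :: l, by rw [quotientWord_cons_cons, inv_mul_cancel_left, hl]⟩

end QuotientWord

section AbsoluteOrder

variable {B W : Type*} [Group W] {M : CoxeterMatrix B} {cs : CoxeterSystem M W} {x y z : W}

theorem exists_prod_eq_length_eq_reflLength (cs : CoxeterSystem M W) (w : W) :
    ∃ ts : List W, (∀ t ∈ ts, cs.IsReflection t) ∧ ts.prod = w ∧ ts.length = cs.reflLength w := by
  obtain ⟨ω, -, hω⟩ := cs.exists_isReduced w
  exact Nat.sInf_mem (s := {n | ∃ ts : List W,
    (∀ t ∈ ts, cs.IsReflection t) ∧ ts.prod = w ∧ ts.length = n})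
    ⟨_, ω.map cs.simple, List.forall_mem_map.mpr fun i _ => cs.isReflection_simple i, hω.symm, rfl⟩

theorem reflLength_prod_le {ts : List W} (hts : ∀ t ∈ ts, cs.IsReflection t) :
    cs.reflLength ts.prod ≤ ts.length :=
  Nat.sInf_le ⟨ts, hts, rfl, rfl⟩

theorem reflLength_le_one {t : W} (ht : cs.IsReflection t) : cs.reflLength t ≤ 1 := by
  simpa using reflLength_prod_le (List.forall_mem_singleton.mpr ht)

theorem reflLength_one : cs.reflLength 1 = 0 :=
  Nat.le_zero.mp (reflLength_prod_le (cs := cs) (List.forall_mem_nil _))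

theorem eq_one_of_reflLength_eq_zero (h : cs.reflLength x = 0) : x = 1 := by
  obtain ⟨ts, -, rfl, hlen⟩ := exists_prod_eq_length_eq_reflLength cs x
  rw [List.length_eq_zero_iff.mp (hlen.trans h), List.prod_nil]

theorem reflLength_mul_le (cs : CoxeterSystem M W) (x y : W) :
    cs.reflLength (x * y) ≤ cs.reflLength x + cs.reflLength y := by
  obtain ⟨ts, hts, rfl, hlen⟩ := exists_prod_eq_length_eq_reflLength cs x
  obtain ⟨ts', hts', rfl, hlen'⟩ := exists_prod_eq_length_eq_reflLength cs y
  rw [← hlen, ← hlen', ← List.prod_append, ← List.length_append]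
  exact reflLength_prod_le (List.forall_mem_append.mpr ⟨hts, hts'⟩)

theorem reflLength_le_add_inv_mul (cs : CoxeterSystem M W) (x y : W) :
    cs.reflLength y ≤ cs.reflLength x + cs.reflLength (x⁻¹ * y) := by
  simpa only [mul_inv_cancel_left] using reflLength_mul_le cs x (x⁻¹ * y)

theorem one_absLE (cs : CoxeterSystem M W) (x : W) : cs.AbsLE 1 x := by
  simp [AbsLE, reflLength_one]

theorem eq_of_absLE_of_reflLength_le (h : cs.AbsLE x y)
    (hle : cs.reflLength y ≤ cs.reflLength x) : x = y := by
  rw [AbsLE] at h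
  exact inv_mul_eq_one.mp (eq_one_of_reflLength_eq_zero (cs := cs) (by lia))

theorem reflLength_le_of_absLE (h : cs.AbsLE x y) : cs.reflLength x ≤ cs.reflLength y :=
  Nat.le.intro h

instance isPartialOrder_absLE (cs : CoxeterSystem M W) : IsPartialOrder W cs.AbsLE where
  refl x := by simp [AbsLE, reflLength_one]
  trans x y z hxy hyz := by
    have hmul := reflLength_mul_le cs (x⁻¹ * y) (y⁻¹ * z)
    have hle := reflLength_le_add_inv_mul cs x z
    rw [mul_assoc, mul_inv_cancel_left] at hmul
    rw [AbsLE] at *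
    lia
  antisymm _ _ hxy hyx := eq_of_absLE_of_reflLength_le hxy (reflLength_le_of_absLE hyx)

theorem reflLength_lt_of_absLE_of_ne (h : cs.AbsLE x y) (hne : x ≠ y) :
    cs.reflLength x < cs.reflLength y :=
  not_le.mp (mt (eq_of_absLE_of_reflLength_le h) hne)

/-- The cover relation of the absolute order. -/
def AbsCover (cs : CoxeterSystem M W) (x y : W) : Prop :=
  cs.reflLength y = cs.reflLength x + 1 ∧ cs.IsReflection (x⁻¹ * y)

theorem AbsCover.absLE (h : AbsCover cs x y) : cs.AbsLE x y := by
  have hle := reflLength_le_add_inv_mul cs x y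
  have hone := reflLength_le_one h.2
  have hlen := h.1
  rw [AbsLE]
  lia

theorem exists_absCover_absLE (h : cs.AbsLE x y) (hne : x ≠ y) :
    ∃ z, AbsCover cs x z ∧ cs.AbsLE z y := by
  obtain ⟨ts, hts, hprod, hlen⟩ := exists_prod_eq_length_eq_reflLength cs (x⁻¹ * y)
  cases ts with
  | nil => exact absurd (inv_mul_eq_one.mp hprod.symm) hne
  | cons t ts =>
    rw [List.forall_mem_cons] at hts
    have hquot : (x * t)⁻¹ * y = ts.prod := by
      rw [mul_inv_rev, mul_assoc, ← hprod, List.prod_cons, inv_mul_cancel_left]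
    have hxt := reflLength_mul_le cs x t
    have ht := reflLength_le_one hts.1
    have htail := reflLength_prod_le hts.2
    have hle := reflLength_le_add_inv_mul cs (x * t) y
    rw [hquot] at hle
    rw [List.length_cons] at hlen
    rw [AbsLE] at h
    refine ⟨x * t, ⟨by lia, (inv_mul_cancel_left x t).symm ▸ hts.1⟩, ?_⟩
    rw [AbsLE, hquot]
    lia

theorem reflLength_getLast_of_isChain_absCover {a : W} {l : List W}
    (h : (a :: l).IsChain (AbsCover cs)) :
    cs.reflLength ((a :: l).getLast (List.cons_ne_nil a l)) = cs.reflLength a + l.length := by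
  induction l generalizing a with
  | nil => simp
  | cons b l ih =>
    rw [List.isChain_cons_cons] at h
    rw [List.getLast_cons_cons, ih h.2, h.1.1, List.length_cons]
    lia

theorem isChain_absCover_of_reflLength {a : W} {l : List W}
    (hrefl : ∀ t ∈ quotientWord (a :: l), cs.IsReflection t)
    (hlen : cs.reflLength ((a :: l).getLast (List.cons_ne_nil a l)) =
      cs.reflLength a + l.length) : (a :: l).IsChain (AbsCover cs) := by
  induction l generalizing a with
  | nil => exact List.isChain_singleton a
  | cons b l ih =>
    rw [quotientWord_cons_cons, List.forall_mem_cons] at hrefl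
    rw [List.getLast_cons_cons, List.length_cons] at hlen
    have hb := reflLength_le_add_inv_mul cs a b
    have hone := reflLength_le_one hrefl.1
    have hlast := reflLength_mul_le cs b (quotientWord (b :: l)).prod
    have htail := reflLength_prod_le hrefl.2
    rw [mul_prod_quotientWord] at hlast
    rw [length_quotientWord_cons] at htail
    exact List.isChain_cons_cons.mpr ⟨⟨by lia, hrefl.1⟩, ih hrefl.2 (by lia)⟩

theorem exists_mem_reflLength_eq {a : W} {l : List W} (h : (a :: l).IsChain (AbsCover cs)) {n : ℕ}
    (hn : cs.reflLength a ≤ n) (hn' : n ≤ cs.reflLength a + l.length) :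
    ∃ y ∈ a :: l, cs.reflLength y = n := by
  induction l generalizing a with
  | nil => exact ⟨a, List.mem_cons_self, hn.antisymm hn'⟩
  | cons b l ih =>
    obtain rfl | hlt := hn.eq_or_lt
    · exact ⟨a, List.mem_cons_self, rfl⟩
    · rw [List.isChain_cons_cons] at h
      have hb := h.1.1
      rw [List.length_cons] at hn'
      obtain ⟨y, hy, hlen⟩ := ih h.2 (by lia) (by lia)
      exact ⟨y, List.mem_cons_of_mem a hy, hlen⟩

end AbsoluteOrder

section MaximalChains

variable {B W : Type*} [Group W] {M : CoxeterMatrix B} {cs : CoxeterSystem M W} {c : W}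

theorem pairwise_absLE_elems (π : cs.MaxChain c) : π.elems.Pairwise cs.AbsLE :=
  π.increasing.imp And.left

theorem head_elems (π : cs.MaxChain c) (h : π.elems ≠ []) : π.elems.head h = 1 :=
  antisymm (r := cs.AbsLE) ((pairwise_absLE_elems π).rel_head
    (π.maximal 1 ⟨one_absLE cs 1, one_absLE cs c⟩ fun y _ => Or.inl (one_absLE cs y)))
    (one_absLE cs _)

theorem getLast_elems (π : cs.MaxChain c) (h : π.elems ≠ []) : π.elems.getLast h = c :=
  antisymm (r := cs.AbsLE) (π.mem_noncrossing _ (List.getLast_mem h)).2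
    ((pairwise_absLE_elems π).rel_getLast
      (π.maximal c ⟨one_absLE cs c, refl_of cs.AbsLE c⟩ fun y hy =>
        Or.inr (π.mem_noncrossing y hy).2))

theorem exists_elems_eq_cons (π : cs.MaxChain c) :
    ∃ l, π.elems = 1 :: l ∧ (1 :: l).getLast (List.cons_ne_nil 1 l) = c := by
  have hmem := π.maximal 1 ⟨one_absLE cs 1, one_absLE cs c⟩ fun y _ => Or.inl (one_absLE cs y)
  have hne := List.ne_nil_of_mem hmem
  have helems := head_elems π hne ▸ (List.cons_head_tail hne).symm
  exact ⟨π.elems.tail, helems, by simp only [← helems, getLast_elems]⟩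

theorem isChain_absCover_elems (π : cs.MaxChain c) : π.elems.IsChain (AbsCover cs) := by
  refine List.isChain_iff_forall_rel_of_append_cons_cons.mpr fun x y l₁ l₂ helems => ?_
  have hinc := π.increasing
  simp only [helems, List.pairwise_append, List.pairwise_cons, List.forall_mem_cons] at hinc
  obtain ⟨-, ⟨⟨⟨hxy, hne⟩, -⟩, hy, -⟩, hl⟩ := hinc
  obtain ⟨z, hxz, hzy⟩ := exists_absCover_absLE hxy hne
  have hz : z ∈ π.elems := by
    have hyc := (π.mem_noncrossing y (by simp [helems])).2
    refine π.maximal z ⟨one_absLE cs z, trans_of cs.AbsLE hzy hyc⟩ ?_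
    simp only [helems, List.forall_mem_append, List.forall_mem_cons]
    exact ⟨fun w hw => Or.inr (trans_of cs.AbsLE (hl w hw).1.1 hxz.absLE), Or.inr hxz.absLE,
      Or.inl hzy, fun w hw => Or.inl (trans_of cs.AbsLE hzy (hy w hw).1)⟩
  have hlen_xz := hxz.1
  have hlen_zy := reflLength_le_of_absLE hzy
  simp only [helems, List.mem_append, List.mem_cons] at hz
  rcases hz with hz | rfl | rfl | hz
  · have := reflLength_lt_of_absLE_of_ne (hl z hz).1.1 (hl z hz).1.2
    lia
  · lia
  · exact hxz
  · have := reflLength_lt_of_absLE_of_ne (hy z hz).1 (hy z hz).2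
    lia

theorem exists_maxChain_elems_eq {l : List W} (h : (1 :: l).IsChain (AbsCover cs))
    (hlast : (1 :: l).getLast (List.cons_ne_nil 1 l) = c) :
    ∃ π : cs.MaxChain c, π.elems = 1 :: l := by
  have hle : (1 :: l).Pairwise cs.AbsLE := (h.imp fun _ _ => AbsCover.absLE).pairwise
  have hlt : (1 :: l).Pairwise (InvImage (· < ·) cs.reflLength) :=
    (h.imp fun _ _ hxy => Nat.lt_of_succ_le hxy.1.ge).pairwise
  have hlen := hlast ▸ reflLength_getLast_of_isChain_absCover h
  refine ⟨⟨1 :: l, fun x hx => ⟨one_absLE cs x, hlast ▸ hle.rel_getLast hx⟩,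
    (hle.and hlt).imp fun hxy => ⟨hxy.1, fun he => hxy.2.ne (congrArg _ he)⟩,
    fun x hx hcomp => ?_⟩, rfl⟩
  obtain ⟨y, hy, hxy⟩ := exists_mem_reflLength_eq h (n := cs.reflLength x)
    (by rw [reflLength_one]; exact Nat.zero_le _) (hlen ▸ reflLength_le_of_absLE hx.2)
  obtain rfl : x = y := (hcomp y hy).elim (eq_of_absLE_of_reflLength_le · hxy.le)
    fun hyx => (eq_of_absLE_of_reflLength_le hyx hxy.ge).symm
  exact hy

theorem isReflection_of_mem_reflWord (π : cs.MaxChain c) : ∀ t ∈ π.reflWord, cs.IsReflection t :=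
  forall_mem_quotientWord.mpr ((isChain_absCover_elems π).imp fun _ _ => And.right)

theorem prod_reflWord (π : cs.MaxChain c) : π.reflWord.prod = c := by
  obtain ⟨l, helems, hlast⟩ := exists_elems_eq_cons π
  rw [MaxChain.reflWord, helems, ← hlast, ← mul_prod_quotientWord, one_mul]

theorem length_reflWord (π : cs.MaxChain c) : π.reflWord.length = cs.reflLength c := by
  obtain ⟨l, helems, hlast⟩ := exists_elems_eq_cons π
  have hlen := reflLength_getLast_of_isChain_absCover (helems ▸ isChain_absCover_elems π)
  rw [MaxChain.reflWord, helems, length_quotientWord_cons, ← hlast, hlen, reflLength_one, zero_add]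

theorem exists_maxChain_reflWord_eq {ts : List W} (hts : ∀ t ∈ ts, cs.IsReflection t)
    (hprod : ts.prod = c) (hlen : ts.length = cs.reflLength c) :
    ∃ π : cs.MaxChain c, π.reflWord = ts := by
  obtain ⟨l, rfl⟩ := exists_quotientWord_eq 1 ts
  have hlast : (1 :: l).getLast (List.cons_ne_nil 1 l) = c := by
    rw [← mul_prod_quotientWord, one_mul, hprod]
  have hchain := isChain_absCover_of_reflLength hts <| by
    rw [hlast, ← hlen, length_quotientWord_cons, reflLength_one, zero_add]
  exact (exists_maxChain_elems_eq hchain hlast).imp fun π hπ => congrArg quotientWord hπ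

end MaximalChains

section Bruhat

variable {B W : Type*} [Group W] {M : CoxeterMatrix B} {cs : CoxeterSystem M W} {u : W}

theorem length_le_of_bruhatLE {v w : W} (h : cs.BruhatLE v w) : cs.length v ≤ cs.length w := by
  induction h with
  | refl => exact le_rfl
  | tail _ hcover ih => exact ih.trans (hcover.1 ▸ Nat.le_succ _)

theorem isUp_of_isChain_bruhatLE {a : W} {l : List W}
    (hrefl : ∀ t ∈ quotientWord (a :: l), cs.IsReflection t)
    (h : (a :: l).IsChain fun x y => cs.BruhatLE (u * x) (u * y)) :
    IsUp cs (u * a) (quotientWord (a :: l)) := by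
  induction l generalizing a with
  | nil => trivial
  | cons b l ih =>
    rw [quotientWord_cons_cons, List.forall_mem_cons] at hrefl
    rw [List.isChain_cons_cons] at h
    have hb : u * b = u * a * (a⁻¹ * b) := by rw [mul_assoc, mul_inv_cancel_left]
    refine ⟨(lt_length_mul_iff hrefl.1 _).mp ?_, hb ▸ ih hrefl.2 h.2⟩
    exact (hb ▸ length_le_of_bruhatLE h.1).lt_of_ne (hrefl.1.length_mul_left_ne _).symm

theorem isChain_bruhatLE_of_isUp {a : W} {l : List W}
    (hrefl : ∀ t ∈ quotientWord (a :: l), cs.IsReflection t)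
    (hlen : cs.length (u * (a :: l).getLast (List.cons_ne_nil a l)) =
      cs.length (u * a) + l.length)
    (h : IsUp cs (u * a) (quotientWord (a :: l))) :
    (a :: l).IsChain fun x y => cs.BruhatLE (u * x) (u * y) := by
  induction l generalizing a with
  | nil => exact List.isChain_singleton a
  | cons b l ih =>
    rw [quotientWord_cons_cons, List.forall_mem_cons] at hrefl
    rw [List.getLast_cons_cons, List.length_cons] at hlen
    have hb : u * b = u * a * (a⁻¹ * b) := by rw [mul_assoc, mul_inv_cancel_left]
    have htail : IsUp cs (u * b) (quotientWord (b :: l)) := hb ▸ h.2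
    have hlt : cs.length (u * a) < cs.length (u * b) :=
      hb ▸ (lt_length_mul_iff hrefl.1 _).mpr h.1
    have hle := htail.length_le hrefl.2
    rw [mul_assoc, mul_prod_quotientWord, length_quotientWord_cons] at hle
    exact List.isChain_cons_cons.mpr
      ⟨.single ⟨by lia, a⁻¹ * b, hrefl.1, hb⟩, ih hrefl.2 (by lia) htail⟩

theorem concordant_iff_isUp {c : W} (hu : cs.length (u * c) = cs.length u + cs.reflLength c)
    (π : cs.MaxChain c) : π.Concordant u ↔ IsUp cs u π.reflWord := by
  have hrefl := isReflection_of_mem_reflWord π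
  have hlen := length_reflWord π
  obtain ⟨l, helems, hlast⟩ := exists_elems_eq_cons π
  rw [MaxChain.reflWord, helems] at hrefl hlen
  rw [length_quotientWord_cons] at hlen
  rw [MaxChain.Concordant, MaxChain.reflWord, helems, List.isChain_map]
  have hiff := Iff.intro (isUp_of_isChain_bruhatLE (u := u) hrefl)
    (isChain_bruhatLE_of_isUp hrefl (by rw [hlast, hu, hlen, mul_one]))
  rwa [mul_one] at hiff

theorem isUp_map_simple {ω : List B}
    (h : cs.length (u * cs.wordProd ω) = cs.length u + ω.length) :
    IsUp cs u (ω.map cs.simple) := by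
  induction ω generalizing u with
  | nil => trivial
  | cons i ω ih =>
    rw [wordProd_cons, ← mul_assoc, List.length_cons] at h
    have htail := cs.length_mul_le (u * cs.simple i) (cs.wordProd ω)
    have hω := cs.length_wordProd_le ω
    have hi := cs.length_mul_le u (cs.simple i)
    rw [length_simple] at hi
    exact ⟨(lt_length_mul_iff (cs.isReflection_simple i) u).mp (by lia), ih (by lia)⟩

end Bruhat

section CommutationClasses

variable {B W : Type*} [Group W] {M : CoxeterMatrix B} {cs : CoxeterSystem M W} {ω : List B}

theorem IsFactorization.of_commEquiv {ts ts' : List W} (hts : IsFactorization cs ω ts)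
    (h : CommEquiv ts ts') : IsFactorization cs ω ts' where
  isReflection t ht := hts.isReflection t ((perm_of_commEquiv h).mem_iff.mpr ht)
  prod_eq := (prod_eq_of_commEquiv h).symm.trans hts.prod_eq
  length_eq := (perm_of_commEquiv h).length_eq.symm.trans hts.length_eq

theorem commClass_eq_commClass_iff {c : W} {π π' : cs.MaxChain c} :
    cs.commClass π = cs.commClass π' ↔ CommEquiv π.reflWord π'.reflWord :=
  Quotient.eq

theorem exists_commClass_eq {c : W} (C : cs.CommClass c) :
    ∃ π : cs.MaxChain c, cs.commClass π = C :=
  Quotient.exists_rep C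

variable [Finite W]

theorem reflLength_wordProd (hω : ω.Nodup) : cs.reflLength (cs.wordProd ω) = ω.length := by
  have hfact : IsFactorization cs ω (ω.map cs.simple) := isFactorization_map_simple rfl rfl
  obtain ⟨ts, hts, hprod, hlen⟩ := exists_prod_eq_length_eq_reflLength cs (cs.wordProd ω)
  refine le_antisymm ?_ (hlen ▸ length_le_of_prod_eq hω hts hprod)
  simpa only [hfact.prod_eq, hfact.length_eq] using reflLength_prod_le hfact.isReflection

theorem isFactorization_reflWord (hω : ω.Nodup) (π : cs.MaxChain (cs.wordProd ω)) :
    IsFactorization cs ω π.reflWord where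
  isReflection := isReflection_of_mem_reflWord π
  prod_eq := prod_reflWord π
  length_eq := (length_reflWord π).trans (reflLength_wordProd hω)

theorem IsFactorization.exists_maxChain {ts : List W} (hts : IsFactorization cs ω ts)
    (hω : ω.Nodup) : ∃ π : cs.MaxChain (cs.wordProd ω), π.reflWord = ts :=
  exists_maxChain_reflWord_eq hts.isReflection hts.prod_eq
    (hts.length_eq.trans (reflLength_wordProd hω).symm)

theorem length_mul_wordProd_of_mem_plusSet (hω : ω.Nodup) {u : W}
    (hu : u ∈ cs.plusSet (cs.wordProd ω)) :
    cs.length (u * cs.wordProd ω) = cs.length u + ω.length :=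
  hu.trans (by rw [length_wordProd_of_nodup hω])

theorem commClass_mem_concordantClasses_iff (hω : ω.Nodup) {u : W}
    (hu : u ∈ cs.plusSet (cs.wordProd ω)) {π : cs.MaxChain (cs.wordProd ω)} :
    cs.commClass π ∈ cs.concordantClasses (cs.wordProd ω) u ↔ IsUp cs u π.reflWord := by
  have hconc (σ : cs.MaxChain (cs.wordProd ω)) : σ.Concordant u ↔ IsUp cs u σ.reflWord :=
    concordant_iff_isUp
      (by rw [length_mul_wordProd_of_mem_plusSet hω hu, reflLength_wordProd hω]) σ
  refine ⟨fun ⟨σ, hσπ, hσ⟩ => ?_, fun h => ⟨π, rfl, (hconc π).mpr h⟩⟩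
  exact ((hconc σ).mp hσ).of_commEquiv (commClass_eq_commClass_iff.mp hσπ)
    (isReflection_of_mem_reflWord σ)

theorem isIncreasingClass_commClass_iff (hω : IsCoxeterWord ω)
    {π : cs.MaxChain (cs.wordProd ω)} :
    cs.IsIncreasingClass (cs.commClass π) ↔ IsNonacute cs π.reflWord := by
  constructor
  · rintro ⟨σ, hσπ, hσ⟩
    exact ((isFactorization_reflWord hω.nodup σ).isNonacute_of_increasing hω hσ).perm
      (perm_of_commEquiv (commClass_eq_commClass_iff.mp hσπ))
  · intro h
    have hfact := isFactorization_reflWord hω.nodup π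
    obtain ⟨ts, hcomm, hinc⟩ := hfact.exists_commEquiv_increasing hω h
    obtain ⟨σ, rfl⟩ := (hfact.of_commEquiv hcomm).exists_maxChain hω.nodup
    exact ⟨σ, commClass_eq_commClass_iff.mpr (commEquiv_symm hcomm), hinc⟩

theorem isDecreasingClass_commClass_iff (hω : IsCoxeterWord ω)
    {π : cs.MaxChain (cs.wordProd ω)} :
    cs.IsDecreasingClass (cs.commClass π) ↔ IsNonobtuse cs π.reflWord := by
  constructor
  · rintro ⟨σ, hσπ, hσ⟩
    exact ((isFactorization_reflWord hω.nodup σ).isNonobtuse_of_decreasing hω hσ).perm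
      (perm_of_commEquiv (commClass_eq_commClass_iff.mp hσπ))
  · intro h
    have hfact := isFactorization_reflWord hω.nodup π
    obtain ⟨ts, hcomm, hdec⟩ := hfact.exists_commEquiv_decreasing hω h
    obtain ⟨σ, rfl⟩ := (hfact.of_commEquiv hcomm).exists_maxChain hω.nodup
    exact ⟨σ, commClass_eq_commClass_iff.mpr (commEquiv_symm hcomm), hdec⟩

omit [Finite W] in
theorem isNonacute_map_simple (hω : ω.Nodup) : IsNonacute cs (ω.map cs.simple) := by
  refine List.pairwise_map.mpr (hω.imp fun hij => ?_)
  rw [root_simple, root_simple]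
  exact cosForm_simpleRoot_nonpos M hij

theorem isIncreasingClass_iff (hω : IsCoxeterWord ω) {π : cs.MaxChain (cs.wordProd ω)}
    (hπ : π.reflWord = ω.map cs.simple) (C : cs.CommClass (cs.wordProd ω)) :
    cs.IsIncreasingClass C ↔ C = cs.commClass π := by
  obtain ⟨σ, rfl⟩ := exists_commClass_eq C
  rw [isIncreasingClass_commClass_iff hω, commClass_eq_commClass_iff, hπ]
  exact ⟨(isFactorization_reflWord hω.nodup σ).commEquiv_of_isNonacute hω.nodup,
    fun h => (isNonacute_map_simple hω.nodup).perm (perm_of_commEquiv h).symm⟩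

theorem existsUnique_isDecreasingClass (hω : IsCoxeterWord ω) {u : W}
    (hu : u ∈ cs.plusSet (cs.wordProd ω)) :
    ∃! D : cs.CommClass (cs.wordProd ω),
      D ∈ cs.concordantClasses (cs.wordProd ω) u ∧ cs.IsDecreasingClass D := by
  have hiff (σ : cs.MaxChain (cs.wordProd ω)) :
      cs.commClass σ ∈ cs.concordantClasses (cs.wordProd ω) u ∧
        cs.IsDecreasingClass (cs.commClass σ) ↔ IsNonobtuseUp cs ω u σ.reflWord := by
    rw [commClass_mem_concordantClasses_iff hω.nodup hu, isDecreasingClass_commClass_iff hω]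
    exact ⟨fun h => ⟨isFactorization_reflWord hω.nodup σ, h.1, h.2⟩,
      fun h => ⟨h.isUp, h.isNonobtuse⟩⟩
  obtain ⟨ts, hts, huniq⟩ := existsUnique_isNonobtuseUp hω.nodup
    (length_mul_wordProd_of_mem_plusSet hω.nodup hu)
  obtain ⟨π, rfl⟩ := hts.exists_maxChain hω.nodup
  refine ⟨cs.commClass π, (hiff π).mpr hts, fun D hσ => ?_⟩
  obtain ⟨σ, rfl⟩ := exists_commClass_eq D
  exact commClass_eq_commClass_iff.mpr (huniq _ ((hiff σ).mp hσ))

end CommutationClasses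

end NoncrossingChains

open NoncrossingChains

theorem theorem1p4 {B W : Type*} [Group W] [Finite W] {M : CoxeterMatrix B}
    (cs : CoxeterSystem M W) (c : W) (hc : cs.IsStandardCoxeterElement c) :
    ∃ I : cs.CommClass c,
      (∀ C : cs.CommClass c, cs.IsIncreasingClass C ↔ C = I) ∧
      ∀ u ∈ cs.plusSet c,
        I ∈ cs.concordantClasses c u ∧
        ∃! D : cs.CommClass c, D ∈ cs.concordantClasses c u ∧ cs.IsDecreasingClass D := by
  obtain ⟨ω, hnodup, hmem, rfl⟩ := hc
  have hω : IsCoxeterWord ω := ⟨hnodup, hmem⟩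
  obtain ⟨π, hπ⟩ := (isFactorization_map_simple (cs := cs) rfl rfl).exists_maxChain hnodup
  refine ⟨cs.commClass π, isIncreasingClass_iff hω hπ, fun u hu =>
    ⟨?_, existsUnique_isDecreasingClass hω hu⟩⟩
  rw [commClass_mem_concordantClasses_iff hnodup hu, hπ]
  exact isUp_map_simple (length_mul_wordProd_of_mem_plusSet hnodup hu)
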